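/- An instance consists of a connected finite undirected simple graph $G$, edge costs $c:E(G)\to\mathbb{R}_{>0}$, a terminal set $R\subseteq V(G)$, a root terminal $r_0\in R$, and a valid lower bound $L$. Write $n=|V(G)|$, $m=|E(G)|$, $k=|R|$ and $S=R\setminus\{r_0\}$. For $A\subseteq V(G)$ let $\mathrm{smt}(A)$ be the minimum cost of a tree in $G$ containing $A$. A function $L:V(G)\times 2^{R}\to\mathbb{R}_{\ge 0}$ is a *valid lower bound* if $L(r_0,\{r_0\})=0$ and $L(v,I)\le L(w,I')+\mathrm{smt}((I\setminus I')\cup\{v,w\})$ for all $v,w\in V(G)$ and $\{r_0\}\subseteq I'\subseteq I\subseteq R$. The *Dijkstra–Steiner algorithm* works on labels $(v,I)\in V(G)\times 2^{S}$. Initially $l(v,\emptyset)=0$ for all $v\in V(G)$, $l(s,\{s\})=0$ for all $s\in S$, $l=\infty$ for all other labels, $b(v,I)=\emptyset$ for all labels, $N=\{(s,\{s\}):s\in S\}$ and $P=V(G)\times\{\emptyset\}$. While $(r_0,S)\notin P$, it does the following. 1. Choose $(v,I)\in N$ minimizing $l(v,I)+L(v,R\setminus I)$ (ties are broken arbitrarily),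 remove it from $N$ and add it to $P$ (it becomes permanent). 2. For all edges $e=\{v,w\}$ incident to $v$ (in any order): if $l(v,I)+c(e)<l(w,I)$ and $(w,I)\notin P$, set $l(w,I):=l(v,I)+c(e)$ and $b(w,I):=\{(v,I)\}$, and add $(w,I)$ to $N$. 3. For all $\emptyset\ne J\subseteq S\setminus I$ with $(v,J)\in P$ (in any order): if $l(v,I)+l(v,J)<l(v,I\cup J)$ and $(v,I\cup J)\notin P$, set $l(v,I\cup J):=l(v,I)+l(v,J)$ and $b(v,I\cup J):=\{(v,I),(v,J)\}$, and add $(v,I\cup J)$ to $N$. Finally it returns $\mathrm{backtrack}(r_0,S)$, where $\mathrm{backtrack}(v,I)=\{\{v,w\}\}\cup\mathrm{backtrack}(w,I)$ if $b(v,I)=\{(w,I)\}$ for some $w$, and $\mathrm{backtrack}(v,I)=\bigcup_{(w,I')\in b(v,I)}\mathrm{backtrack}(w,I')$ otherwise. **Theorem.** The Dijkstra–Steiner algorithm can be implemented to run in $$O\bigl(3^k n+2^k(n\log n+m)+2^k n f_L\bigr)$$ time, where $f_L$ is an upper bound on the time required to evaluate $L$. Precisely: there are a fixed program $p$ for a uniform-cost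 random access machine and a constant $C$ such that the following holds for every instance. (The machine has registers and arrays of natural numbers, with addition, truncated subtraction, comparison and use as array indices, and registers and arrays of real numbers, with the constant $0$, addition and comparison only; all operations take unit time.) The input is given by $n$, $m$, $k$, a list of the edges with their endpoints and costs, a list of the terminals and the position of $r_0$ in it, in any numbering of vertices, edges and terminals. A query to the oracle for $L$ at $(v,I)$, with $v\in V(G)$ and $\{r_0\}\subseteq I\subseteq R$, where $I$ is given as a bit mask, takes time at most $f_L\in\mathbb{N}$ (in addition to unit time for the call). Then $p$ halts after at most $C\bigl(3^k n+2^k(n\log n+m)+2^k n f_L\bigr)$ steps, and its output is the sequence of labels $(v,I)$ selected in some run of the Dijkstra–Steiner algorithm on the instance, in the order of selection, together with the edge set returned by that run. -/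

import Mathlib

namespace DijkstraSteiner

/-! ### The Steiner tree problem -/

/-- An instance of the Steiner tree problem with a distinguished root terminal: a connected
undirected graph, positive edge costs, a set of terminals and a root among them. -/
structure SteinerInstance (V : Type*) where
  G : SimpleGraph V
  conn : G.Connected
  c : Sym2 V → ℝ
  c_pos : ∀ e ∈ G.edgeSet, 0 < c e
  terminals : Finset V
  root : V
  root_mem : root ∈ terminals

/-- A label `(v, I)`, with `I` a set of source terminals. -/
abbrev Label (V : Type*) := V × Finset V

/-- The variables of the algorithm: the costs `l`, the backtracking data `b`, the set `N` of
candidate labels and the set `P` of permanent labels. -/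
structure State (V : Type*) where
  l : Label V → WithTop ℝ
  b : Label V → Set (Label V)
  N : Set (Label V)
  P : Set (Label V)

section Algorithm

variable {V : Type*} [DecidableEq V]

open Classical in
/-- The body of both inner loops: if `d < l(y)` and `y ∉ P`, then
`l(y) := d`, `b(y) := B` and `N := N ∪ {y}`. -/
noncomputable def State.relax (s : State V) (y : Label V) (d : WithTop ℝ) (B : Set (Label V)) :
    State V :=
  if d < s.l y ∧ y ∉ s.P then
    { l := Function.update s.l y d
      b := Function.update s.b y B
      N := insert y s.N
      P := s.P }
  else s

/-- The loop over sets `J`, for `x = (v, I)`, in the order of the list `Js`. -/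
noncomputable def State.mergeLoop (x : Label V) (Js : List (Finset V)) (s : State V) : State V :=
  Js.foldl (fun s J =>
    s.relax (x.1, x.2 ∪ J) (s.l x + s.l (x.1, J)) {x, (x.1, J)}) s

/-- `N := N \ {x}` and `P := P ∪ {x}`. -/
def State.makePermanent (s : State V) (x : Label V) : State V :=
  { s with N := s.N \ {x}, P := insert x s.P }

namespace SteinerInstance

variable (X : SteinerInstance V)

/-- The minimum cost of a tree in `G` that contains all vertices of `A`. -/
noncomputable def smt (A : Finset V) : ℝ :=
  sInf {x : ℝ | ∃ T : X.G.Subgraph, T.coe.IsTree ∧ (A : Set V) ⊆ T.verts ∧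
    x = ∑ᶠ e ∈ T.edgeSet, X.c e}

/-- Valid lower bounds `L : V(G) × 2^R → ℝ≥0`, where `R` is the set of terminals. (Values of `L`
at sets that are not contained in `R` are irrelevant.) -/
structure IsValidLowerBound (L : V → Finset V → ℝ) : Prop where
  nonneg : ∀ v, ∀ I ⊆ X.terminals, 0 ≤ L v I
  root_eq : L X.root {X.root} = 0
  le_add : ∀ v w, ∀ I I' : Finset V, {X.root} ⊆ I' → I' ⊆ I → I ⊆ X.terminals →
    L v I ≤ L w I' + X.smt ((I \ I') ∪ {v, w})

/-- The source terminals: all terminals except the root. -/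
def sources : Finset V := X.terminals.erase X.root

/-! ### The Dijkstra-Steiner algorithm -/

open Classical in
/-- The state in which the main loop is entered. -/
noncomputable def init : State V where
  l := fun x => if x.2 = ∅ ∨ (x.1 ∈ X.sources ∧ x.2 = {x.1}) then 0 else ⊤
  b := fun _ => ∅
  N := {x | x.1 ∈ X.sources ∧ x.2 = {x.1}}
  P := {x | x.2 = ∅}

/-- The quantity `l(v,I) + L(v, R \ I)`, by which labels are selected. -/
noncomputable def key (L : V → Finset V → ℝ) (s : State V) (x : Label V) : WithTop ℝ :=
  s.l x + ((L x.1 (X.terminals \ x.2) : ℝ) : WithTop ℝ)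

/-- The loop over the edges `{v, w}` incident to `v`, for `x = (v, I)`, in the order in which
the list `ws` enumerates the other endpoints. -/
noncomputable def edgeLoop (x : Label V) (ws : List V) (s : State V) : State V :=
  ws.foldl (fun s w =>
    s.relax (w, x.2) (s.l x + ((X.c s(x.1, w) : ℝ) : WithTop ℝ)) {x}) s

/-- `X.Iteration L s x s'`: one iteration of the main loop can select the label `x` and lead from
`s` to `s'`. Ties between labels of minimum key are broken arbitrarily, and the two inner loops
run through their ranges in an arbitrary order. -/
def Iteration (L : V → Finset V → ℝ) (s : State V) (x : Label V) (s' : State V) : Prop :=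
  x ∈ s.N ∧ (∀ y ∈ s.N, X.key L s x ≤ X.key L s y) ∧
  ∃ (ws : List V) (Js : List (Finset V)),
    ws.Nodup ∧ (∀ w, w ∈ ws ↔ X.G.Adj x.1 w) ∧
    Js.Nodup ∧ (∀ J, J ∈ Js ↔
      J ≠ ∅ ∧ J ⊆ X.sources \ x.2 ∧ (x.1, J) ∈ (s.makePermanent x).P) ∧
    s' = (X.edgeLoop x ws (s.makePermanent x)).mergeLoop x Js

/-- The main loop `while (root, sources) ∉ P`, run from the first state until it stops in the last
one; the list consists of the selected labels, in the order of their selection. -/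
inductive MainLoop (L : V → Finset V → ℝ) : State V → List (Label V) → State V → Prop
  | done (s : State V) : (X.root, X.sources) ∈ s.P → MainLoop L s [] s
  | step (s s' s'' : State V) (x : Label V) (xs : List (Label V)) :
      (X.root, X.sources) ∉ s.P → X.Iteration L s x s' → MainLoop L s' xs s'' →
      MainLoop L s (x :: xs) s''

end SteinerInstance

/-- The procedure `backtrack`: `Backtrack b (v, I) F` says that the recursive call
`backtrack(v, I)` terminates and returns the edge set `F`. -/
inductive Backtrack (b : Label V → Set (Label V)) : Label V → Set (Sym2 V) → Prop
  | edge (v w : V) (I : Finset V) (F : Set (Sym2 V)) :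
      b (v, I) = {(w, I)} → Backtrack b (w, I) F → Backtrack b (v, I) ({s(v, w)} ∪ F)
  | union (v : V) (I : Finset V) (F : Label V → Set (Sym2 V)) :
      (¬ ∃ w, b (v, I) = {(w, I)}) → (∀ y ∈ b (v, I), Backtrack b y (F y)) →
      Backtrack b (v, I) (⋃ y ∈ b (v, I), F y)

/-- There is a run of the Dijkstra-Steiner algorithm that makes the labels `xs` permanent, in this
order, and returns the edge set `F`. -/
def SteinerInstance.IsRun (X : SteinerInstance V) (L : V → Finset V → ℝ)
    (xs : List (Label V)) (F : Set (Sym2 V)) : Prop :=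
  ∃ s : State V, X.MainLoop L X.init xs s ∧ Backtrack s.b (X.root, X.sources) F

end Algorithm

/-! ### Random access machines

A uniform cost random access machine with registers and arrays for natural numbers and for real
numbers, and with structured control flow. Natural numbers can be added, subtracted and compared,
and used as array indices. Real numbers can only be added and compared. There is an oracle for a
real function of two natural numbers. -/

/-- The memory: registers and arrays of natural numbers, registers and arrays of reals. -/
structure Store where
  nv : ℕ → ℕ
  na : ℕ → ℕ → ℕ
  rv : ℕ → ℝ
  ra : ℕ → ℕ → ℝ

/-- An oracle: its answers and the time that it takes to give them. -/
structure Oracle where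
  val : ℕ → ℕ → ℝ
  time : ℕ → ℕ → ℕ

/-- Integer expressions. -/
inductive NExp where
  | const (a : ℕ)
  | var (x : ℕ)
  | get (a : ℕ) (i : NExp)
  | add (e₁ e₂ : NExp)
  | sub (e₁ e₂ : NExp)

/-- Real expressions. -/
inductive RExp where
  | zero
  | var (x : ℕ)
  | get (a : ℕ) (i : NExp)
  | add (e₁ e₂ : RExp)

/-- Tests. -/
inductive Test where
  | nlt (e₁ e₂ : NExp)
  | neq (e₁ e₂ : NExp)
  | rlt (e₁ e₂ : RExp)
  | not (b : Test)
  | and (b₁ b₂ : Test)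

/-- Programs. -/
inductive Prog where
  | skip
  | nset (x : ℕ) (e : NExp)
  | nput (a : ℕ) (i e : NExp)
  | rset (x : ℕ) (e : RExp)
  | rput (a : ℕ) (i : NExp) (e : RExp)
  | ask (x : ℕ) (e₁ e₂ : NExp)
  | seq (p q : Prog)
  | ite (b : Test) (p q : Prog)
  | loop (b : Test) (p : Prog)

/-- The value of an integer expression (`sub` is truncated subtraction). -/
def NExp.eval (s : Store) : NExp → ℕ
  | .const a => a
  | .var x => s.nv x
  | .get a i => s.na a (i.eval s)
  | .add e₁ e₂ => e₁.eval s + e₂.eval s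
  | .sub e₁ e₂ => e₁.eval s - e₂.eval s

/-- The number of elementary operations in an integer expression. -/
def NExp.cost : NExp → ℕ
  | .const _ => 1
  | .var _ => 1
  | .get _ i => i.cost + 1
  | .add e₁ e₂ => e₁.cost + e₂.cost + 1
  | .sub e₁ e₂ => e₁.cost + e₂.cost + 1

/-- The value of a real expression. -/
noncomputable def RExp.eval (s : Store) : RExp → ℝ
  | .zero => 0
  | .var x => s.rv x
  | .get a i => s.ra a (i.eval s)
  | .add e₁ e₂ => e₁.eval s + e₂.eval s

/-- The number of elementary operations in a real expression. -/
def RExp.cost : RExp → ℕ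
  | .zero => 1
  | .var _ => 1
  | .get _ i => i.cost + 1
  | .add e₁ e₂ => e₁.cost + e₂.cost + 1

/-- The truth value of a test. -/
def Test.eval (s : Store) : Test → Prop
  | .nlt e₁ e₂ => e₁.eval s < e₂.eval s
  | .neq e₁ e₂ => e₁.eval s = e₂.eval s
  | .rlt e₁ e₂ => e₁.eval s < e₂.eval s
  | .not b => ¬ b.eval s
  | .and b₁ b₂ => b₁.eval s ∧ b₂.eval s

/-- The number of elementary operations in a test. -/
def Test.cost : Test → ℕ
  | .nlt e₁ e₂ => e₁.cost + e₂.cost + 1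
  | .neq e₁ e₂ => e₁.cost + e₂.cost + 1
  | .rlt e₁ e₂ => e₁.cost + e₂.cost + 1
  | .not b => b.cost + 1
  | .and b₁ b₂ => b₁.cost + b₂.cost + 1

/-- `Exec O p s s' t`: the program `p`, started with memory `s` and using the oracle `O`, halts
with memory `s'` after `t` steps. -/
inductive Exec (O : Oracle) : Prog → Store → Store → ℕ → Prop
  | skip (s : Store) : Exec O .skip s s 1
  | nset (s : Store) (x : ℕ) (e : NExp) :
      Exec O (.nset x e) s { s with nv := Function.update s.nv x (e.eval s) } (e.cost + 1)
  | nput (s : Store) (a : ℕ) (i e : NExp) :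
      Exec O (.nput a i e) s
        { s with
          na := Function.update s.na a
            (Function.update (s.na a) (i.eval s) (e.eval s)) }
        (i.cost + e.cost + 1)
  | rset (s : Store) (x : ℕ) (e : RExp) :
      Exec O (.rset x e) s { s with rv := Function.update s.rv x (e.eval s) } (e.cost + 1)
  | rput (s : Store) (a : ℕ) (i : NExp) (e : RExp) :
      Exec O (.rput a i e) s
        { s with
          ra := Function.update s.ra a
            (Function.update (s.ra a) (i.eval s) (e.eval s)) }
        (i.cost + e.cost + 1)
  | ask (s : Store) (x : ℕ) (e₁ e₂ : NExp) :
      Exec O (.ask x e₁ e₂) s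
        { s with rv := Function.update s.rv x (O.val (e₁.eval s) (e₂.eval s)) }
        (e₁.cost + e₂.cost + 1 + O.time (e₁.eval s) (e₂.eval s))
  | seq (p q : Prog) (s s' s'' : Store) (t t' : ℕ) :
      Exec O p s s' t → Exec O q s' s'' t' → Exec O (.seq p q) s s'' (t + t')
  | ite_true (b : Test) (p q : Prog) (s s' : Store) (t : ℕ) :
      b.eval s → Exec O p s s' t → Exec O (.ite b p q) s s' (b.cost + 1 + t)
  | ite_false (b : Test) (p q : Prog) (s s' : Store) (t : ℕ) :
      ¬ b.eval s → Exec O q s s' t → Exec O (.ite b p q) s s' (b.cost + 1 + t)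
  | loop_true (b : Test) (p : Prog) (s s' s'' : Store) (t t' : ℕ) :
      b.eval s → Exec O p s s' t → Exec O (.loop b p) s' s'' t' →
      Exec O (.loop b p) s s'' (b.cost + 1 + t + t')
  | loop_false (b : Test) (p : Prog) (s : Store) :
      ¬ b.eval s → Exec O (.loop b p) s s (b.cost + 1)

/-! ### Input and output -/

section Encoding

variable {V : Type*} [Fintype V] [DecidableEq V]

/-- The number of vertices. -/
def SteinerInstance.n (_ : SteinerInstance V) : ℕ := Fintype.card V

/-- The number of edges. -/
noncomputable def SteinerInstance.m (X : SteinerInstance V) : ℕ := X.G.edgeSet.ncard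

/-- The number of terminals. -/
def SteinerInstance.k (X : SteinerInstance V) : ℕ := X.terminals.card

/-- The choices made in writing down an instance: a numbering of the vertices, a list of the edges,
each with its endpoints in one of the two orders, and a list of the terminals. -/
structure Encoding (X : SteinerInstance V) where
  vertex : V ≃ Fin X.n
  tail : Fin X.m → V
  head : Fin X.m → V
  edge_bij : Set.BijOn (fun i => s(tail i, head i)) Set.univ X.G.edgeSet
  term : Fin X.k → V
  term_bij : Set.BijOn term Set.univ (X.terminals : Set V)
  rootIndex : Fin X.k
  term_rootIndex : term rootIndex = X.root

namespace Encoding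

variable {X : SteinerInstance V} (E : Encoding X)

/-- The natural number that represents a set of terminals: bit `j` is set if and only if the
`j`-th terminal belongs to the set. -/
def mask (I : Finset V) : ℕ := ∑ j : Fin X.k, if E.term j ∈ I then 2 ^ (j : ℕ) else 0

/-- The input: registers `0`, `1`, `2`, `3` contain `n`, `m`, `k` and the position of the root in
the list of terminals; integer arrays `0` and `1` contain the endpoints of the edges, integer array
`2` the terminals, real array `0` the costs of the edges. Everything else is zero. -/
noncomputable def input : Store where
  nv := fun x =>
    if x = 0 then X.n else if x = 1 then X.m else if x = 2 then X.k
    else if x = 3 then E.rootIndex else 0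
  na := fun a i =>
    if a = 0 then (if h : i < X.m then E.vertex (E.tail ⟨i, h⟩) else 0)
    else if a = 1 then (if h : i < X.m then E.vertex (E.head ⟨i, h⟩) else 0)
    else if a = 2 then (if h : i < X.k then E.vertex (E.term ⟨i, h⟩) else 0)
    else 0
  rv := fun _ => 0
  ra := fun a i =>
    if a = 0 then (if h : i < X.m then X.c s(E.tail ⟨i, h⟩, E.head ⟨i, h⟩) else 0) else 0

/-- The output edge set: edge number `i` belongs to it if and only if entry `i` of integer array
`3` is `1`. -/
def outputEdges (s : Store) : Set (Sym2 V) :=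
  {e | ∃ i : Fin X.m, e = s(E.tail i, E.head i) ∧ s.na 3 i = 1}

/-- The memory holds a record of the sequence `xs` of labels: its length in register `4`, the
vertices in integer array `4` and the sets in integer array `5`. -/
def Records (s : Store) (xs : List (Label V)) : Prop :=
  s.nv 4 = xs.length ∧ ∀ (i : ℕ) (h : i < xs.length),
    s.na 4 i = E.vertex xs[i].1 ∧ s.na 5 i = E.mask xs[i].2

/-- The oracle evaluates `L(v, I)` in time at most `f`, for all vertices `v` and all sets `I` of
terminals that contain the root (the only sets at which the algorithm uses `L`). -/
def Evaluates (O : Oracle) (L : V → Finset V → ℝ) (f : ℕ) : Prop :=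
  ∀ v, ∀ I ⊆ X.terminals, X.root ∈ I →
    O.val (E.vertex v) (E.mask I) = L v I ∧ O.time (E.vertex v) (E.mask I) ≤ f

end Encoding

end Encoding

end DijkstraSteiner

namespace DijkstraSteiner

/-! ### Symbolic execution with time credits -/

/-! Give the label `(v, I)` the number `v * 2 ^ k + mask I` and keep the candidates in a priority
queue with constant amortized time for insertion and decrease-key and logarithmic time for
extraction of the minimum. The cost of a run then splits as follows.

There are at most `n * 2 ^ k` extractions. Scanning edges costs the sum of the degrees, `2 * m`, for
each of the `2 ^ (k - 1)` sets. Scanning the subsets `J` of the complement of `I` in `S` costs `2 ^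
|S \ I|` for each label, and the binomial theorem makes the sum over `I` equal to `3 ^ |S|` for each
vertex (`sum_pushes_le`). The lower bound is queried once per label, when its cost first becomes
finite, and is stored from then on. At most about `n ^ 2 * 4 ^ k` queue nodes are ever created, so
an extraction costs `O(log n + k)`; the resulting term `n * 2 ^ k * k` is absorbed by `n * 3 ^ k`
(`pow_mul_le`).

The queue is a hollow heap. Decreasing a key creates a new node for the item and leaves the old one
hollow. The new node takes all children but the two of largest rank, and its rank is two less. Every
tree whose root has rank `r` has at least `fib (r + 3) - 1` nodes, which bounds the ranks of roots
logarithmically (`Inv.two_pow_rank_le`). An extraction destroys hollow roots and links full roots of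
equal rank.

Time is counted by credits: `W O p Q s c` is a total correctness statement in which `c` is the
available time, and amortization keeps part of the credit in `potential`, which pays for roots on
the stack, hollow nodes and labels not yet touched. Correctness is a simulation: `Encoding.Rel` ties
the memory to the abstract state, and `W_relax`, `W_extract`, `W_edges` and `W_merges` show that the
program follows `relax`, the selection of a label and the two inner loops. Connectivity of the graph
ensures that a candidate is always available (`Closed.nonempty`). The backtracking data of a
selected label refer only to labels selected before it, so one pass through the selected labels in
reverse order recovers the edges (`W_back`). -/

/-- The store after an assignment to an integer register. -/
def Store.setN (s : Store) (x v : ℕ) : Store := { s with nv := Function.update s.nv x v }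

/-- The store after an assignment to an entry of an integer array. -/
def Store.putN (s : Store) (a i v : ℕ) : Store :=
  { s with na := Function.update s.na a (Function.update (s.na a) i v) }

/-- The store after an assignment to a real register. -/
def Store.setR (s : Store) (x : ℕ) (v : ℝ) : Store :=
  { s with rv := Function.update s.rv x v }

/-- The store after an assignment to an entry of a real array. -/
def Store.putR (s : Store) (a i : ℕ) (v : ℝ) : Store :=
  { s with ra := Function.update s.ra a (Function.update (s.ra a) i v) }

section Store

variable (s : Store) (a i v x y b : ℕ) (z : ℝ)

@[simp] theorem setN_nv : (s.setN x v).nv y = if y = x then v else s.nv y := by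
  simp [Store.setN, Function.update_apply]
@[simp] theorem setN_na : (s.setN x v).na = s.na := rfl
@[simp] theorem setN_rv : (s.setN x v).rv = s.rv := rfl
@[simp] theorem setN_ra : (s.setN x v).ra = s.ra := rfl
@[simp] theorem putN_nv : (s.putN a i v).nv = s.nv := rfl
@[simp] theorem putN_na : (s.putN a i v).na b =
    if b = a then Function.update (s.na a) i v else s.na b := by
  simp [Store.putN, Function.update_apply]
@[simp] theorem putN_rv : (s.putN a i v).rv = s.rv := rfl
@[simp] theorem putN_ra : (s.putN a i v).ra = s.ra := rfl
@[simp] theorem setR_nv : (s.setR x z).nv = s.nv := rfl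
@[simp] theorem setR_na : (s.setR x z).na = s.na := rfl
@[simp] theorem setR_rv : (s.setR x z).rv y = if y = x then z else s.rv y := by
  simp [Store.setR, Function.update_apply]
@[simp] theorem setR_ra : (s.setR x z).ra = s.ra := rfl
@[simp] theorem putR_nv : (s.putR a i z).nv = s.nv := rfl
@[simp] theorem putR_na : (s.putR a i z).na = s.na := rfl
@[simp] theorem putR_rv : (s.putR a i z).rv = s.rv := rfl
@[simp] theorem putR_ra : (s.putR a i z).ra b =
    if b = a then Function.update (s.ra a) i z else s.ra b := by
  simp [Store.putR, Function.update_apply]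

end Store

attribute [simp] NExp.eval NExp.cost RExp.eval RExp.cost Test.eval Test.cost

/-- `W O p Q s c`: started in `s` with `c` units of credit, `p` halts in a store `s'` with `c'`
units left (after `c - c'` steps), and `Q s' c'` holds. -/
def W (O : Oracle) (p : Prog) (Q : Store → ℕ → Prop) (s : Store) (c : ℕ) : Prop :=
  ∃ s' t c', Exec O p s s' t ∧ t + c' = c ∧ Q s' c'

section Rules

variable {O : Oracle} {Q Q' : Store → ℕ → Prop} {s : Store} {c : ℕ}

/-- The rules are equivalences so that rewriting turns straight-line code into inequalities on the
credit and a postcondition about an explicit store. -/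
theorem W_skip : W O .skip Q s c ↔ 1 ≤ c ∧ Q s (c - 1) := by
  constructor
  · rintro ⟨s', t, c', h, rfl, hq⟩
    cases h
    exact ⟨by omega, by simpa using hq⟩
  · rintro ⟨h, hq⟩
    exact ⟨_, _, _, .skip s, by omega, hq⟩

theorem W_nset {x : ℕ} {e : NExp} : W O (.nset x e) Q s c ↔
    e.cost + 1 ≤ c ∧ Q (s.setN x (e.eval s)) (c - (e.cost + 1)) := by
  constructor
  · rintro ⟨s', t, c', h, rfl, hq⟩
    cases h
    exact ⟨by omega, by rw [Nat.add_sub_cancel_left]; exact hq⟩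
  · rintro ⟨h, hq⟩
    exact ⟨_, _, _, .nset s x e, by omega, hq⟩

theorem W_nput {a : ℕ} {i e : NExp} : W O (.nput a i e) Q s c ↔
    i.cost + e.cost + 1 ≤ c ∧ Q (s.putN a (i.eval s) (e.eval s)) (c - (i.cost + e.cost + 1)) := by
  constructor
  · rintro ⟨s', t, c', h, rfl, hq⟩
    cases h
    exact ⟨by omega, by rw [Nat.add_sub_cancel_left]; exact hq⟩
  · rintro ⟨h, hq⟩
    exact ⟨_, _, _, .nput s a i e, by omega, hq⟩

theorem W_rset {x : ℕ} {e : RExp} : W O (.rset x e) Q s c ↔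
    e.cost + 1 ≤ c ∧ Q (s.setR x (e.eval s)) (c - (e.cost + 1)) := by
  constructor
  · rintro ⟨s', t, c', h, rfl, hq⟩
    cases h
    exact ⟨by omega, by rw [Nat.add_sub_cancel_left]; exact hq⟩
  · rintro ⟨h, hq⟩
    exact ⟨_, _, _, .rset s x e, by omega, hq⟩

theorem W_rput {a : ℕ} {i : NExp} {e : RExp} : W O (.rput a i e) Q s c ↔
    i.cost + e.cost + 1 ≤ c ∧ Q (s.putR a (i.eval s) (e.eval s)) (c - (i.cost + e.cost + 1)) := by
  constructor
  · rintro ⟨s', t, c', h, rfl, hq⟩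
    cases h
    exact ⟨by omega, by rw [Nat.add_sub_cancel_left]; exact hq⟩
  · rintro ⟨h, hq⟩
    exact ⟨_, _, _, .rput s a i e, by omega, hq⟩

theorem W_ask {x : ℕ} {e₁ e₂ : NExp} : W O (.ask x e₁ e₂) Q s c ↔
    e₁.cost + e₂.cost + 1 + O.time (e₁.eval s) (e₂.eval s) ≤ c ∧
      Q (s.setR x (O.val (e₁.eval s) (e₂.eval s)))
        (c - (e₁.cost + e₂.cost + 1 + O.time (e₁.eval s) (e₂.eval s))) := by
  constructor
  · rintro ⟨s', t, c', h, rfl, hq⟩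
    cases h
    exact ⟨by omega, by rw [Nat.add_sub_cancel_left]; exact hq⟩
  · rintro ⟨h, hq⟩
    exact ⟨_, _, _, .ask s x e₁ e₂, by omega, hq⟩

theorem W_seq {p q : Prog} : W O (.seq p q) Q s c ↔ W O p (W O q Q) s c := by
  constructor
  · rintro ⟨s', t, c', h, rfl, hq⟩
    cases h with
    | seq _ _ _ s1 _ t1 t2 h1 h2 => exact ⟨s1, t1, t2 + c', h1, by omega, s', t2, c', h2, rfl, hq⟩
  · rintro ⟨s1, t1, c1, h1, rfl, s', t2, c', h2, rfl, hq⟩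
    exact ⟨s', _, c', .seq _ _ _ _ _ _ _ h1 h2, by omega, hq⟩

theorem W_ite {b : Test} {p q : Prog} : W O (.ite b p q) Q s c ↔
    b.cost + 1 ≤ c ∧ (b.eval s → W O p Q s (c - (b.cost + 1))) ∧
      (¬ b.eval s → W O q Q s (c - (b.cost + 1))) := by
  constructor
  · rintro ⟨s', t, c', h, rfl, hq⟩
    cases h with
    | ite_true _ _ _ _ _ t hb h =>
      exact ⟨by omega, fun _ => ⟨s', t, c', h, by omega, hq⟩, fun h => absurd hb h⟩
    | ite_false _ _ _ _ _ t hb h =>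
      exact ⟨by omega, fun h => absurd h hb, fun _ => ⟨s', t, c', h, by omega, hq⟩⟩
  · rintro ⟨hc, h1, h2⟩
    by_cases hb : b.eval s
    · obtain ⟨s', t, c', h, ht, hq⟩ := h1 hb
      exact ⟨s', _, c', .ite_true _ _ _ _ _ _ hb h, by omega, hq⟩
    · obtain ⟨s', t, c', h, ht, hq⟩ := h2 hb
      exact ⟨s', _, c', .ite_false _ _ _ _ _ _ hb h, by omega, hq⟩

theorem W.mono {p : Prog} (h : W O p Q s c) (hQ : ∀ s' c', Q s' c' → Q' s' c') :
    W O p Q' s c := by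
  obtain ⟨s', t, c', h, ht, hq⟩ := h
  exact ⟨s', t, c', h, ht, hQ _ _ hq⟩

/-- The integer registers that a program may change. -/
@[simp] def Prog.wnv : Prog → List ℕ
  | .nset x _ => [x]
  | .seq p q => p.wnv ++ q.wnv
  | .ite _ p q => p.wnv ++ q.wnv
  | .loop _ p => p.wnv
  | _ => []

/-- The integer arrays that a program may change. -/
@[simp] def Prog.wna : Prog → List ℕ
  | .nput a _ _ => [a]
  | .seq p q => p.wna ++ q.wna
  | .ite _ p q => p.wna ++ q.wna
  | .loop _ p => p.wna
  | _ => []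

/-- The real registers that a program may change. -/
@[simp] def Prog.wrv : Prog → List ℕ
  | .rset x _ => [x]
  | .ask x _ _ => [x]
  | .seq p q => p.wrv ++ q.wrv
  | .ite _ p q => p.wrv ++ q.wrv
  | .loop _ p => p.wrv
  | _ => []

/-- The real arrays that a program may change. -/
@[simp] def Prog.wra : Prog → List ℕ
  | .rput a _ _ => [a]
  | .seq p q => p.wra ++ q.wra
  | .ite _ p q => p.wra ++ q.wra
  | .loop _ p => p.wra
  | _ => []

/-- `s'` agrees with `s` in all places that `p` cannot change. -/
structure Frame (p : Prog) (s s' : Store) : Prop where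
  nv : ∀ x, x ∉ p.wnv → s'.nv x = s.nv x
  na : ∀ x, x ∉ p.wna → s'.na x = s.na x
  rv : ∀ x, x ∉ p.wrv → s'.rv x = s.rv x
  ra : ∀ x, x ∉ p.wra → s'.ra x = s.ra x

theorem Frame.refl (p : Prog) (s : Store) : Frame p s s :=
  ⟨fun _ _ => rfl, fun _ _ => rfl, fun _ _ => rfl, fun _ _ => rfl⟩

theorem Frame.trans {p : Prog} {s s' s'' : Store} (h : Frame p s s') (h' : Frame p s' s'') :
    Frame p s s'' :=
  ⟨fun x hx => (h'.nv x hx).trans (h.nv x hx), fun x hx => (h'.na x hx).trans (h.na x hx),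
    fun x hx => (h'.rv x hx).trans (h.rv x hx), fun x hx => (h'.ra x hx).trans (h.ra x hx)⟩

theorem Frame.of_subset {p q : Prog} {s s' : Store} (h : Frame p s s')
    (h1 : p.wnv ⊆ q.wnv) (h2 : p.wna ⊆ q.wna) (h3 : p.wrv ⊆ q.wrv) (h4 : p.wra ⊆ q.wra) :
    Frame q s s' :=
  ⟨fun x hx => h.nv x (fun h => hx (h1 h)), fun x hx => h.na x (fun h => hx (h2 h)),
    fun x hx => h.rv x (fun h => hx (h3 h)), fun x hx => h.ra x (fun h => hx (h4 h))⟩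

/-- With this, specifications need to describe only what changes; that a given register or array is
untouched becomes a decidable fact about the text of the program. -/
theorem Exec.frame {p : Prog} {s' : Store} {t : ℕ} (h : Exec O p s s' t) : Frame p s s' := by
  induction h with
  | skip s => exact Frame.refl _ _
  | nset s x e =>
    exact ⟨fun y hy => Function.update_of_ne (by simpa using hy) _ _, fun _ _ => rfl,
      fun _ _ => rfl, fun _ _ => rfl⟩
  | nput s a i e =>
    exact ⟨fun _ _ => rfl, fun y hy => Function.update_of_ne (by simpa using hy) _ _,
      fun _ _ => rfl, fun _ _ => rfl⟩
  | rset s x e =>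
    exact ⟨fun _ _ => rfl, fun _ _ => rfl,
      fun y hy => Function.update_of_ne (by simpa using hy) _ _, fun _ _ => rfl⟩
  | rput s a i e =>
    exact ⟨fun _ _ => rfl, fun _ _ => rfl, fun _ _ => rfl,
      fun y hy => Function.update_of_ne (by simpa using hy) _ _⟩
  | ask s x e₁ e₂ =>
    exact ⟨fun _ _ => rfl, fun _ _ => rfl,
      fun y hy => Function.update_of_ne (by simpa using hy) _ _, fun _ _ => rfl⟩
  | seq p q s s' s'' t t' _ _ h1 h2 =>
    refine Frame.trans (h1.of_subset ?_ ?_ ?_ ?_) (h2.of_subset ?_ ?_ ?_ ?_) <;> simp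
  | ite_true b p q s s' t _ _ h => refine h.of_subset ?_ ?_ ?_ ?_ <;> simp
  | ite_false b p q s s' t _ _ h => refine h.of_subset ?_ ?_ ?_ ?_ <;> simp
  | loop_true b p s s' s'' t t' _ _ _ h1 h2 =>
    refine Frame.trans (h1.of_subset ?_ ?_ ?_ ?_) h2 <;> simp
  | loop_false b p s _ => exact Frame.refl _ _

theorem W.frame {p : Prog} (h : W O p Q s c) : W O p (fun s' c' => Q s' c' ∧ Frame p s s') s c := by
  obtain ⟨s', t, c', h, ht, hq⟩ := h
  exact ⟨s', t, c', h, ht, hq, h.frame⟩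

/-- The credit is the termination measure of a loop. -/
theorem W_loop {b : Test} {p : Prog} (I : Store → ℕ → Prop) (h0 : I s c)
    (hc : ∀ s' c', Frame p s s' → I s' c' → b.cost + 1 ≤ c')
    (h1 : ∀ s' c', Frame p s s' → I s' c' → b.eval s' → W O p I s' (c' - (b.cost + 1)))
    (h2 : ∀ s' c', Frame p s s' → I s' c' → ¬ b.eval s' → Q s' (c' - (b.cost + 1))) :
    W O (.loop b p) Q s c := by
  suffices H : ∀ c' s', Frame p s s' → I s' c' → W O (.loop b p) Q s' c' from
    H c s (Frame.refl _ _) h0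
  intro c'
  induction c' using Nat.strong_induction_on with
  | _ c' ih =>
    intro s' hf hI
    have hc' := hc s' c' hf hI
    by_cases hb : b.eval s'
    · obtain ⟨s1, t1, c1, he, ht, hI1⟩ := h1 s' c' hf hI hb
      -- Evaluating the test already costs at least one unit, so less credit remains for the other
      -- passes.
      obtain ⟨s2, t2, c2, he2, ht2, hq⟩ := ih c1 (by omega) s1 (hf.trans he.frame) hI1
      exact ⟨s2, _, c2, .loop_true _ _ _ _ _ _ _ hb he he2, by omega, hq⟩
    · exact ⟨s', _, _, .loop_false _ _ _ hb, by omega, h2 s' c' hf hI hb⟩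

end Rules

/-! ### Hollow heaps -/

/-- The memory of a hollow heap: for each node its first child, next sibling, rank, item and key,
for each item its current node, and the number of nodes created so far. -/
structure HeapMem where
  child : ℕ → ℕ
  next : ℕ → ℕ
  rank : ℕ → ℕ
  item : ℕ → ℕ
  node : ℕ → ℕ
  key : ℕ → ℝ
  fresh : ℕ

/-- The forest that a hollow heap represents: its nodes, the children of each node in decreasing
order of rank, and the parent of each node (`0` for roots). -/
structure Forest where
  alive : Finset ℕ
  kids : ℕ → List ℕ
  par : ℕ → ℕ

/-- `l` is an initial part of the linked list that starts at `a`. -/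
def Linked (next : ℕ → ℕ) : ℕ → List ℕ → Prop
  | _, [] => True
  | a, c :: l => a = c ∧ Linked next (next c) l

theorem Linked.congr {next next' : ℕ → ℕ} {a : ℕ} {l : List ℕ} (h : Linked next a l)
    (H : ∀ c ∈ l, next' c = next c) : Linked next' a l := by
  induction l generalizing a with
  | nil => trivial
  | cons c l ih =>
    refine ⟨h.1, ?_⟩
    rw [H c (by simp)]
    exact ih h.2 (fun d hd => H d (by simp [hd]))

/-- A node can give up its later children without any write to memory: `Linked` says nothing about
where the chain of siblings ends. -/
theorem Linked.take {next : ℕ → ℕ} {a : ℕ} {l : List ℕ} (h : Linked next a l) (j : ℕ) :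
    Linked next a (l.take j) := by
  induction l generalizing a j with
  | nil => simp [Linked]
  | cons c l ih =>
    cases j with
    | zero => simp [Linked]
    | succ j => exact ⟨h.1, ih h.2 j⟩

/-- The children handed to a new node start at the third sibling. For shorter lists the pointer read
is meaningless, but then the list is empty. -/
theorem Linked.drop_two {next : ℕ → ℕ} {a : ℕ} {l : List ℕ} (h : Linked next a l) :
    Linked next (next (next a)) (l.drop 2) := by
  match l, h with
  | [], _ => trivial
  | [c], _ => trivial
  | c :: d :: l, h =>
    obtain ⟨rfl, rfl, h⟩ := h
    exact h

namespace HeapMem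

/-- A node is full if it is the current node of its item; otherwise it is hollow. -/
def Full (μ : HeapMem) (v : ℕ) : Prop := μ.node (μ.item v) = v

/-- The memory after inserting the item `x` with key `z`, or decreasing its key to `z`. -/
def push (μ : HeapMem) (x : ℕ) (z : ℝ) : HeapMem where
  child := Function.update μ.child (μ.fresh + 1) (μ.next (μ.next (μ.child (μ.node x))))
  next := μ.next
  rank := Function.update μ.rank (μ.fresh + 1) (μ.rank (μ.node x) - 2)
  item := Function.update μ.item (μ.fresh + 1) x
  node := Function.update μ.node x (μ.fresh + 1)
  key := Function.update μ.key (μ.fresh + 1) z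
  fresh := μ.fresh + 1

/-- The memory after making `w` the first child of `u`. -/
def link (μ : HeapMem) (u w : ℕ) : HeapMem :=
  { μ with
    next := Function.update μ.next w (μ.child u)
    child := Function.update μ.child u w
    rank := Function.update μ.rank u (μ.rank u + 1) }

/-- The invariant of a hollow heap. -/
structure Inv (μ : HeapMem) (φ : Forest) : Prop where
  pos : ∀ v ∈ φ.alive, 1 ≤ v ∧ v ≤ μ.fresh
  node_le : ∀ x, μ.node x ≤ μ.fresh
  item_node : ∀ x, μ.node x ≠ 0 → μ.item (μ.node x) = x
  kids_zero : φ.kids 0 = []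
  rank_zero : μ.rank 0 = 0
  kid : ∀ v ∈ φ.alive, ∀ c ∈ φ.kids v, c ∈ φ.alive ∧ φ.par c = v ∧ μ.key v ≤ μ.key c
  par : ∀ v ∈ φ.alive, φ.par v ≠ 0 → φ.par v ∈ φ.alive ∧ v ∈ φ.kids (φ.par v)
  linked : ∀ v ∈ φ.alive, Linked μ.next (μ.child v) (φ.kids v)
  ranks_full : ∀ v ∈ φ.alive, μ.Full v → (φ.kids v).map μ.rank = (List.range (μ.rank v)).reverse
  ranks_hollow : ∀ v ∈ φ.alive, ¬ μ.Full v →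
    (φ.kids v).map μ.rank = (List.range (μ.rank v)).reverse.take 2

/-- `l` enumerates the roots. -/
def Roots (φ : Forest) (l : List ℕ) : Prop :=
  l.Nodup ∧ ∀ v, v ∈ l ↔ v ∈ φ.alive ∧ φ.par v = 0

open Classical in
/-- The number of hollow nodes. -/
noncomputable def hollow (μ : HeapMem) (φ : Forest) : ℕ :=
  (φ.alive.filter fun v => ¬ μ.Full v).card

theorem Roots.perm {φ : Forest} {l l' : List ℕ} (h : Roots φ l) (hp : l.Perm l') : Roots φ l' :=
  ⟨hp.nodup_iff.1 h.1, fun v => by rw [← hp.mem_iff]; exact h.2 v⟩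

/-! ### Decrease-key, link and removal of a root in a hollow heap. -/

variable {μ : HeapMem} {φ : Forest}

theorem drop_two_reverse_range (r : ℕ) :
    (List.range r).reverse.drop 2 = (List.range (r - 2)).reverse := by
  match r with
  | 0 => rfl
  | 1 => rfl
  | r + 2 => simp [List.range_succ]

-- Insertion is a decrease-key at the fictitious node `0`, which has no children and rank `0`. If
-- `u` is the old node, of rank `r`, its children have ranks `r - 1, ..., 0`; it keeps the first
-- two, as a hollow node should, and the others have exactly the ranks that a full node of rank `r -
-- 2` needs. Heap order survives because the new key is at most the old one.
open Classical in
theorem Inv.push (h : μ.Inv φ) {x : ℕ} {z : ℝ} {l : List ℕ} (hr : Roots φ l)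
    (hx : μ.node x = 0 ∨ μ.node x ∈ φ.alive ∧ z ≤ μ.key (μ.node x)) :
    ∃ φ' : Forest, φ'.alive = insert (μ.fresh + 1) φ.alive ∧ (μ.push x z).Inv φ' ∧
      Roots φ' (l ++ [μ.fresh + 1]) ∧ (μ.push x z).hollow φ' ≤ μ.hollow φ + 1 := by
  set u := μ.node x with hu
  set n := μ.fresh + 1 with hn
  have hlt : ∀ v ∈ φ.alive, v ≠ n := fun v hv => by have := (h.pos v hv).2; omega
  have hun : u ≠ n := by have := h.node_le x; omega
  have hn0 : n ≠ 0 := by omega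
  have h0 : 0 ∉ φ.alive := fun h0 => by have := (h.pos 0 h0).1; omega
  have hDr : ((φ.kids u).drop 2).map μ.rank = (List.range (μ.rank u - 2)).reverse := by
    rcases hx with hx | hx
    · rw [hx, h.kids_zero, h.rank_zero]; rfl
    · have hf : μ.Full u := by
        show μ.node (μ.item u) = u
        rw [hu, h.item_node x]
        rw [← hu]; rintro h'; rw [h'] at hx; exact h0 hx.1
      rw [List.map_drop, h.ranks_full u hx.1 hf, drop_two_reverse_range]
  have hkid : ∀ c ∈ φ.kids u, u ∈ φ.alive ∧ c ∈ φ.alive ∧ φ.par c = u ∧ z ≤ μ.key c := by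
    intro c hc
    rcases hx with hx | hx
    · rw [hx, h.kids_zero] at hc; simp at hc
    · obtain ⟨h1, h2, h3⟩ := h.kid u hx.1 c hc
      exact ⟨hx.1, h1, h2, hx.2.trans h3⟩
  have hnodup : (φ.kids u).Nodup := by
    rcases hx with hx | hx
    · rw [hx, h.kids_zero]; exact List.nodup_nil
    · apply List.Nodup.of_map μ.rank
      by_cases hf : μ.Full u
      · rw [h.ranks_full u hx.1 hf]; exact List.nodup_reverse.2 List.nodup_range
      · rw [h.ranks_hollow u hx.1 hf]
        exact (List.nodup_reverse.2 List.nodup_range).sublist (List.take_sublist _ _)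
  have hdisj : ∀ c ∈ (φ.kids u).take 2, c ∉ (φ.kids u).drop 2 := by
    intro c h1 h2
    rw [← List.take_append_drop 2 (φ.kids u)] at hnodup
    exact List.disjoint_of_nodup_append hnodup h1 h2
  -- The old node of the item is the only one that loses its status.
  have hfull : ∀ v ∈ φ.alive, ((μ.push x z).Full v ↔ μ.Full v ∧ v ≠ u) := by
    intro v hv
    have hvn := hlt v hv
    have hv0 : v ≠ 0 := by rintro rfl; exact h0 hv
    simp only [HeapMem.Full, HeapMem.push, ← hn, Function.update_of_ne hvn]
    by_cases hxv : μ.item v = x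
    · rw [hxv, Function.update_self, ← hu]
      constructor
      · intro h'; exact absurd h'.symm hvn
      · rintro ⟨h1, h2⟩; exact absurd h1.symm h2
    · rw [Function.update_of_ne hxv]
      constructor
      · intro h'
        refine ⟨h', ?_⟩
        rintro rfl
        exact hxv (h.item_node x (by rw [← hu]; exact hv0))
      · exact fun h' => h'.1
  have hfulln : (μ.push x z).Full n := by
    simp [HeapMem.Full, HeapMem.push, ← hn]
  -- The new forest: `n` is a root that receives all but the first two children of `u`.
  let K : ℕ → List ℕ := fun v =>
    if v = n then (φ.kids u).drop 2 else if v = u then (φ.kids u).take 2 else φ.kids v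
  let P : ℕ → ℕ := fun c => if c ∈ (φ.kids u).drop 2 then n else if c = n then 0 else φ.par c
  have hnD : n ∉ (φ.kids u).drop 2 := fun h' =>
    hlt n (hkid n (List.mem_of_mem_drop h')).2.1 rfl
  have hKn : K n = (φ.kids u).drop 2 := by simp [K]
  have hKu : K u = (φ.kids u).take 2 := by simp [K, hun]
  have hKv : ∀ v, v ≠ n → v ≠ u → K v = φ.kids v := fun v h1 h2 => by simp [K, h1, h2]
  have hKsub : ∀ v, v ≠ n → ∀ c ∈ K v, c ∈ φ.kids v ∧ c ∉ (φ.kids u).drop 2 ∨ v ∉ φ.alive := by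
    intro v hv c hc
    by_cases hva : v ∈ φ.alive
    · left
      by_cases hvu : v = u
      · subst hvu
        rw [hKu] at hc
        exact ⟨List.mem_of_mem_take hc, hdisj c hc⟩
      · rw [hKv v hv hvu] at hc
        refine ⟨hc, fun h' => hvu ?_⟩
        rw [← (h.kid v hva c hc).2.1]
        exact (hkid c (List.mem_of_mem_drop h')).2.2.1
    · right; exact hva
  have hrank : ∀ c ∈ φ.alive, (μ.push x z).rank c = μ.rank c := fun c hc => by
    simp only [HeapMem.push, ← hn, Function.update_of_ne (hlt c hc)]
  have hkey : ∀ c ∈ φ.alive, (μ.push x z).key c = μ.key c := fun c hc => by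
    simp only [HeapMem.push, ← hn, Function.update_of_ne (hlt c hc)]
  have hmaprank : ∀ l : List ℕ, (∀ c ∈ l, c ∈ φ.alive) →
      l.map (μ.push x z).rank = l.map μ.rank := fun l hl =>
    List.map_congr_left fun c hc => hrank c (hl c hc)
  refine ⟨⟨insert n φ.alive, K, P⟩, rfl, ?_, ?_, ?_⟩
  · constructor
    · intro v hv
      rcases Finset.mem_insert.1 hv with rfl | hv
      · simp only [HeapMem.push]; omega
      · have := h.pos v hv
        simp only [HeapMem.push]; omega
    · intro y
      simp only [HeapMem.push, Function.update_apply]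
      split
      · omega
      · have := h.node_le y; omega
    · intro y hy
      by_cases hyx : y = x
      · subst hyx; simp [HeapMem.push]
      · simp only [HeapMem.push, ← hn, Function.update_of_ne hyx] at hy ⊢
        rw [Function.update_of_ne (by have := h.node_le y; omega), h.item_node y hy]
    · show K 0 = []
      by_cases hu0 : u = 0
      · rw [← hu0, hKu, hu0, h.kids_zero]; rfl
      · rw [hKv 0 hn0.symm (Ne.symm hu0), h.kids_zero]
    · simp only [HeapMem.push, ← hn]
      rw [Function.update_of_ne hn0.symm, h.rank_zero]
    · intro v hv c hc
      rcases Finset.mem_insert.1 hv with rfl | hv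
      · change c ∈ K n at hc
        rw [hKn] at hc
        obtain ⟨_, hca, -, hz⟩ := hkid c (List.mem_of_mem_drop hc)
        refine ⟨Finset.mem_insert_of_mem hca, by simp [P, hc], ?_⟩
        rw [hkey c hca]
        simpa [HeapMem.push, ← hn] using hz
      · have hc' := (hKsub v (hlt v hv) c hc).resolve_right (not_not.2 hv)
        obtain ⟨h1, h2, h3⟩ := h.kid v hv c hc'.1
        refine ⟨Finset.mem_insert_of_mem h1, ?_, ?_⟩
        · simp [P, hc'.2, hlt c h1, h2]
        · rwa [hkey c h1, hkey v hv]
    · intro v hv hp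
      change P v ≠ 0 at hp
      show P v ∈ insert n φ.alive ∧ v ∈ K (P v)
      by_cases hvD : v ∈ (φ.kids u).drop 2
      · have : P v = n := by simp [P, hvD]
        rw [this, hKn]
        exact ⟨Finset.mem_insert_self _ _, hvD⟩
      · rcases Finset.mem_insert.1 hv with rfl | hv
        · simp [P, hvD] at hp
        · have hPv : P v = φ.par v := by simp [P, hvD, hlt v hv]
          rw [hPv] at hp ⊢
          obtain ⟨h1, h2⟩ := h.par v hv hp
          refine ⟨Finset.mem_insert_of_mem h1, ?_⟩
          by_cases hpu : φ.par v = u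
          · rw [hpu, hKu]
            rw [hpu, ← List.take_append_drop 2 (φ.kids u), List.mem_append] at h2
            exact h2.resolve_right hvD
          · rwa [hKv _ (hlt _ h1) hpu]
    · intro v hv
      show Linked μ.next _ (K v)
      rcases Finset.mem_insert.1 hv with rfl | hv
      · rw [hKn]
        simp only [HeapMem.push, ← hn, Function.update_self, ← hu]
        rcases hx with hx | hx
        · rw [hx, h.kids_zero]; trivial
        · exact (h.linked u hx.1).drop_two
      · simp only [HeapMem.push, ← hn, Function.update_of_ne (hlt v hv)]
        by_cases hvu : v = u
        · subst hvu
          rw [hKu]; exact (h.linked _ hv).take 2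
        · rw [hKv v (hlt v hv) hvu]; exact h.linked v hv
    · intro v hv hf
      show (K v).map _ = _
      rcases Finset.mem_insert.1 hv with rfl | hv
      · rw [hKn, hmaprank _ (fun c hc => (hkid c (List.mem_of_mem_drop hc)).2.1), hDr]
        simp [HeapMem.push, ← hn, ← hu]
      · obtain ⟨hf, hvu⟩ := (hfull v hv).1 hf
        rw [hKv v (hlt v hv) hvu, hmaprank _ (fun c hc => (h.kid v hv c hc).1), hrank v hv]
        exact h.ranks_full v hv hf
    · intro v hv hf
      show (K v).map _ = _
      rcases Finset.mem_insert.1 hv with rfl | hv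
      · exact absurd hfulln hf
      · by_cases hvu : v = u
        · subst hvu
          rw [hKu, hmaprank _ (fun c hc => (h.kid _ hv c (List.mem_of_mem_take hc)).1), hrank _ hv]
          by_cases hf' : μ.Full (μ.node x)
          · rw [List.map_take, h.ranks_full _ hv hf']
          · rw [List.map_take, h.ranks_hollow _ hv hf', List.take_take]; rfl
        · have hf' : ¬ μ.Full v := fun h' => hf ((hfull v hv).2 ⟨h', hvu⟩)
          rw [hKv v (hlt v hv) hvu, hmaprank _ (fun c hc => (h.kid v hv c hc).1), hrank v hv]
          exact h.ranks_hollow v hv hf'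
  · constructor
    · refine List.Nodup.append hr.1 (List.nodup_singleton n) ?_
      intro a ha hb
      rw [List.mem_singleton] at hb
      exact hlt a ((hr.2 a).1 ha).1 hb
    · intro v
      show v ∈ l ++ [n] ↔ v ∈ insert n φ.alive ∧ P v = 0
      rw [List.mem_append, hr.2, Finset.mem_insert, List.mem_singleton]
      by_cases hvD : v ∈ (φ.kids u).drop 2
      · obtain ⟨h0', h1, h2, -⟩ := hkid v (List.mem_of_mem_drop hvD)
        have : P v = n := by simp [P, hvD]
        rw [this]
        have hu0 : u ≠ 0 := by intro h'; rw [h'] at h0'; exact h0 h0'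
        have := hlt v h1
        simp [hn0, h2, hu0, this]
      · by_cases hvn : v = n
        · simp [hvn, P, hnD]
        · simp [P, hvD, hvn]
  -- The new node is full, so only `u` can be an additional hollow node.
  · have : (insert n φ.alive).filter (fun v => ¬ (μ.push x z).Full v) ⊆
        insert u (φ.alive.filter fun v => ¬ μ.Full v) := by
      intro v hv
      rw [Finset.mem_filter, Finset.mem_insert] at hv
      obtain ⟨rfl | hv, hf⟩ := hv
      · exact absurd hfulln hf
      · rw [hfull v hv, not_and_or, not_not] at hf
        rw [Finset.mem_insert, Finset.mem_filter]
        rcases hf with hf | hf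
        · exact Or.inr ⟨hv, hf⟩
        · exact Or.inl hf
    exact (Finset.card_le_card this).trans (Finset.card_insert_le _ _)

theorem Inv.nodup_kids (h : μ.Inv φ) {v : ℕ} (hv : v ∈ φ.alive) : (φ.kids v).Nodup := by
  apply List.Nodup.of_map μ.rank
  by_cases hf : μ.Full v
  · rw [h.ranks_full v hv hf]; exact List.nodup_reverse.2 List.nodup_range
  · rw [h.ranks_hollow v hv hf]
    exact (List.nodup_reverse.2 List.nodup_range).sublist (List.take_sublist _ _)

theorem Inv.rank_lt (h : μ.Inv φ) {v c : ℕ} (hv : v ∈ φ.alive) (hc : c ∈ φ.kids v) :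
    μ.rank c < μ.rank v := by
  have hc' : μ.rank c ∈ (φ.kids v).map μ.rank := List.mem_map_of_mem hc
  by_cases hf : μ.Full v
  · rw [h.ranks_full v hv hf] at hc'; simpa using hc'
  · rw [h.ranks_hollow v hv hf] at hc'; simpa using List.mem_of_mem_take hc'

/-- A full node of rank `r` has children of ranks `r - 1, ..., 0`. Putting a root of rank `r` in
front continues this pattern to rank `r + 1`, and the comparison of keys preserves heap order. -/
theorem Inv.link (h : μ.Inv φ) {u w : ℕ} {l : List ℕ} (hr : Roots φ (w :: u :: l))
    (hu : μ.Full u) (hrank : μ.rank w = μ.rank u) (hkey : μ.key u ≤ μ.key w) :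
    ∃ φ' : Forest, φ'.alive = φ.alive ∧ (μ.link u w).Inv φ' ∧ Roots φ' (u :: l) ∧
      (μ.link u w).hollow φ' = μ.hollow φ := by
  have hw' := (hr.2 w).1 (by simp)
  have hu' := (hr.2 u).1 (by simp)
  have hwu : w ≠ u := by
    have := hr.1; simp only [List.nodup_cons, List.mem_cons, not_or] at this; exact this.1.1
  have hu0 : u ≠ 0 := by have := h.pos u hu'.1; omega
  have hw0 : w ≠ 0 := by have := h.pos w hw'.1; omega
  have hkw : ∀ v ∈ φ.alive, w ∉ φ.kids v := fun v hv hc => by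
    have h1 := (h.kid v hv w hc).2.1
    have := (h.pos v hv).1
    omega
  have hku : ∀ v ∈ φ.alive, u ∉ φ.kids v := fun v hv hc => by
    have h1 := (h.kid v hv u hc).2.1
    have := (h.pos v hv).1
    omega
  have hmr : ∀ v ∈ φ.alive, (φ.kids v).map (μ.link u w).rank = (φ.kids v).map μ.rank := by
    intro v hv
    refine List.map_congr_left fun c hc => ?_
    have : c ≠ u := by rintro rfl; exact hku v hv hc
    simp [HeapMem.link, this]
  have hlk : ∀ v ∈ φ.alive, ∀ a, Linked μ.next a (φ.kids v) →
      Linked (μ.link u w).next a (φ.kids v) := fun v hv a ha =>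
    ha.congr fun c hc => by
      have : c ≠ w := by rintro rfl; exact hkw v hv hc
      simp [HeapMem.link, this]
  refine ⟨⟨φ.alive, Function.update φ.kids u (w :: φ.kids u), Function.update φ.par w u⟩, rfl,
    ?_, ?_, rfl⟩
  · constructor
    · exact h.pos
    · exact h.node_le
    · exact h.item_node
    · simp [Function.update_of_ne hu0.symm, h.kids_zero]
    · simp [HeapMem.link, Function.update_of_ne hu0.symm, h.rank_zero]
    · intro v hv c hc
      simp only [Function.update_apply] at hc ⊢
      have key : c ∈ φ.kids v → c ∈ φ.alive ∧ (if c = w then u else φ.par c) = v ∧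
          (μ.link u w).key v ≤ (μ.link u w).key c := fun hc => by
        have : c ≠ w := fun e => hkw v hv (e ▸ hc)
        rw [if_neg this]; exact h.kid v hv c hc
      split_ifs at hc with hvu
      · subst hvu
        rcases List.mem_cons.1 hc with rfl | hc
        · exact ⟨hw'.1, by simp, hkey⟩
        · exact key hc
      · exact key hc
    · intro v hv hp
      simp only [Function.update_apply] at hp ⊢
      by_cases hvw : v = w
      · subst hvw; simp [hu'.1]
      · rw [if_neg hvw] at hp ⊢
        obtain ⟨h1, h2⟩ := h.par v hv hp
        refine ⟨h1, ?_⟩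
        split_ifs with h3
        · rw [h3] at h2; exact List.mem_cons_of_mem _ h2
        · exact h2
    · intro v hv
      by_cases hvu : v = u
      · subst hvu
        simp only [Function.update_self]
        refine ⟨by simp [HeapMem.link], ?_⟩
        have := hlk v hv _ (h.linked v hv)
        simpa [HeapMem.link] using this
      · simp only [Function.update_of_ne hvu]
        have := hlk v hv _ (h.linked v hv)
        simpa [HeapMem.link, Function.update_of_ne hvu] using this
    · intro v hv hf
      have hf' : μ.Full v := hf
      by_cases hvu : v = u
      · subst hvu
        simp only [Function.update_self, List.map_cons]
        rw [hmr v hv, h.ranks_full v hv hf']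
        simp [HeapMem.link, List.range_succ, Function.update_of_ne hwu, hrank]
      · simp only [Function.update_of_ne hvu]
        rw [hmr v hv, h.ranks_full v hv hf']
        simp [HeapMem.link, Function.update_of_ne hvu]
    · intro v hv hf
      have hf' : ¬ μ.Full v := hf
      have hvu : v ≠ u := by rintro rfl; exact hf' hu
      simp only [Function.update_of_ne hvu]
      rw [hmr v hv, h.ranks_hollow v hv hf']
      simp [HeapMem.link, Function.update_of_ne hvu]
  · constructor
    · exact (List.nodup_cons.1 hr.1).2
    · intro v
      have := hr.2 v
      have hnd := (List.nodup_cons.1 hr.1).1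
      simp only [Function.update_apply]
      by_cases hvw : v = w
      · subst hvw; simp [hnd, hu0]
      · rw [List.mem_cons] at this
        simpa [hvw] using this

-- Used both for destroying a hollow root and for extracting the minimum. In the first case the
-- number of hollow nodes drops, and this releases the credit with which the children are pushed.
-- The memory does not change: the node merely leaves the forest.
open Classical in
theorem Inv.remove (h : μ.Inv φ) {v : ℕ} {l : List ℕ} (hr : Roots φ (v :: l)) :
    ∃ φ' : Forest, φ'.alive = φ.alive.erase v ∧ μ.Inv φ' ∧ Roots φ' (φ.kids v ++ l) ∧
      μ.hollow φ' + (if μ.Full v then 0 else 1) = μ.hollow φ := by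
  have hv := (hr.2 v).1 (by simp)
  have hv0 : v ≠ 0 := by have := h.pos v hv.1; omega
  have hk : ∀ w ∈ φ.alive, w ≠ v → ∀ c ∈ φ.kids w, c ∉ φ.kids v := by
    intro w hw hwv c hc hc'
    exact hwv ((h.kid w hw c hc).2.1.symm.trans (h.kid v hv.1 c hc').2.1)
  have hvk : ∀ w ∈ φ.alive, v ∉ φ.kids w := fun w hw hc => by
    have h1 := (h.kid w hw v hc).2.1
    have := (h.pos w hw).1
    omega
  refine ⟨⟨φ.alive.erase v, φ.kids, fun c => if c ∈ φ.kids v then 0 else φ.par c⟩, rfl, ?_, ?_, ?_⟩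
  · constructor
    · exact fun w hw => h.pos w (Finset.mem_of_mem_erase hw)
    · exact h.node_le
    · exact h.item_node
    · exact h.kids_zero
    · exact h.rank_zero
    · intro w hw c hc
      obtain ⟨hwv, hw'⟩ := Finset.mem_erase.1 hw
      obtain ⟨h1, h2, h3⟩ := h.kid w hw' c hc
      refine ⟨Finset.mem_erase.2 ⟨?_, h1⟩, ?_, h3⟩
      · exact fun e => hvk w hw' (e ▸ hc)
      · simp [hk w hw' hwv c hc, h2]
    · intro w hw hp
      obtain ⟨hwv, hw⟩ := Finset.mem_erase.1 hw
      by_cases hwk : w ∈ φ.kids v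
      · simp [hwk] at hp
      · simp only [hwk, if_false] at hp ⊢
        obtain ⟨h1, h2⟩ := h.par w hw hp
        refine ⟨Finset.mem_erase.2 ⟨?_, h1⟩, h2⟩
        intro h'; rw [h'] at h2; exact hwk h2
    · exact fun w hw => h.linked w (Finset.mem_of_mem_erase hw)
    · exact fun w hw => h.ranks_full w (Finset.mem_of_mem_erase hw)
    · exact fun w hw => h.ranks_hollow w (Finset.mem_of_mem_erase hw)
  · constructor
    · refine List.Nodup.append (h.nodup_kids hv.1) (List.nodup_cons.1 hr.1).2 ?_
      intro c hc hc'
      have h1 := (h.kid v hv.1 c hc).2.1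
      have h2 := ((hr.2 c).1 (by simp [hc'])).2
      omega
    · intro c
      have h1 := hr.2 c
      have h2 := (List.nodup_cons.1 hr.1).1
      simp only [List.mem_append, Finset.mem_erase]
      by_cases hc : c ∈ φ.kids v
      · have h3 := (h.kid v hv.1 c hc).1
        have h4 : c ≠ v := by rintro rfl; exact hvk c hv.1 hc
        simp [hc, h3, h4]
      · by_cases hcv : c = v
        · subst hcv; simp [hc, h2]
        · rw [List.mem_cons] at h1
          simpa [hc, hcv] using h1
  · unfold hollow
    simp only
    by_cases hf : μ.Full v
    · rw [if_pos hf, Finset.filter_erase, Finset.erase_eq_of_notMem]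
      · rfl
      · simp [hf]
    · rw [if_neg hf, Finset.filter_erase]
      exact Finset.card_erase_add_one (by simp [hf, hv.1])

/-- Walk from `v` to its parent repeatedly: keys do not increase. The walk ends at a root because
ranks strictly increase, so no separate acyclicity assumption on the forest is needed. -/
theorem Inv.exists_root_le (h : μ.Inv φ) {l : List ℕ} (hr : Roots φ l) {v : ℕ}
    (hv : v ∈ φ.alive) : ∃ w ∈ l, μ.key w ≤ μ.key v := by
  induction hm : φ.alive.sup μ.rank - μ.rank v using Nat.strong_induction_on generalizing v with
  | _ m ih =>
    by_cases hp : φ.par v = 0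
    · exact ⟨v, (hr.2 v).2 ⟨hv, hp⟩, le_rfl⟩
    · obtain ⟨h1, h2⟩ := h.par v hv hp
      have h3 := h.rank_lt h1 h2
      have h4 : μ.rank (φ.par v) ≤ φ.alive.sup μ.rank := Finset.le_sup h1
      obtain ⟨w, hw, hle⟩ := ih _ (by omega) h1 rfl
      exact ⟨w, hw, hle.trans (h.kid _ h1 v h2).2.2⟩

/-! ### Fibonacci bounds for the ranks of roots. -/

/-- The minimum number of nodes of a tree whose root has rank `r`. -/
def minSize (r : ℕ) : ℤ := Nat.fib (r + 3) - 1

theorem minSize_pos (r : ℕ) : 0 < minSize r := by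
  have : Nat.fib 3 ≤ Nat.fib (r + 3) := Nat.fib_mono (by omega)
  have h3 : Nat.fib 3 = 2 := rfl
  unfold minSize
  omega

theorem sum_minSize_range (r : ℕ) :
    ((List.range r).map minSize).sum = Nat.fib (r + 4) - 3 - (r : ℤ) := by
  induction r with
  | zero => rfl
  | succ r ih =>
    have : Nat.fib (r + 1 + 4) = Nat.fib (r + 3) + Nat.fib (r + 4) := Nat.fib_add_two
    rw [List.range_succ, List.map_append, List.sum_append, ih, this]
    simp [minSize]
    ring

theorem succ_le_fib (r : ℕ) : r + 1 ≤ Nat.fib (r + 2) := by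
  induction r with
  | zero => decide
  | succ r ih =>
    have h1 : Nat.fib (r + 1 + 2) = Nat.fib (r + 1) + Nat.fib (r + 2) := Nat.fib_add_two
    have h2 : 0 < Nat.fib (r + 1) := Nat.fib_pos.2 (by omega)
    omega

theorem two_pow_le_minSize (r : ℕ) : (2 : ℤ) ^ (r / 2) ≤ minSize r := by
  induction r using Nat.strong_induction_on with
  | _ r ih =>
    match r with
    | 0 => decide
    | 1 => decide
    | r + 2 =>
      have h := ih r (by omega)
      have h1 : Nat.fib (r + 2 + 3) = Nat.fib (r + 3) + Nat.fib (r + 4) := Nat.fib_add_two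
      have h2 : Nat.fib (r + 3) ≤ Nat.fib (r + 4) := Nat.fib_mono (by omega)
      have h3 : (r + 2) / 2 = r / 2 + 1 := by omega
      rw [h3, pow_succ]
      unfold minSize at *
      omega

/-- Local form of the size bound: a node contributes at most `1` beyond its children. For a full
node of rank `r` the difference is `r + 2 - fib (r + 2)`, which is at most `1` by `succ_le_fib`. For
a hollow node of rank at least two it is exactly `1`, by the Fibonacci recursion. -/
theorem Inv.weight_le (h : μ.Inv φ) {v : ℕ} (hv : v ∈ φ.alive) :
    minSize (μ.rank v) - ((φ.kids v).map fun c => minSize (μ.rank c)).sum ≤ 1 := by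
  have hm : (φ.kids v).map (fun c => minSize (μ.rank c)) = ((φ.kids v).map μ.rank).map minSize := by
    rw [List.map_map]; rfl
  rw [hm]
  by_cases hf : μ.Full v
  · rw [h.ranks_full v hv hf, List.map_reverse, List.sum_reverse, sum_minSize_range]
    have h1 : Nat.fib (μ.rank v + 4) = Nat.fib (μ.rank v + 2) + Nat.fib (μ.rank v + 3) :=
      Nat.fib_add_two
    have h2 := succ_le_fib (μ.rank v)
    unfold minSize
    omega
  · rw [h.ranks_hollow v hv hf]
    match μ.rank v with
    | 0 => decide
    | 1 => decide
    | r + 2 =>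
      have h1 : Nat.fib (r + 2 + 3) = Nat.fib (r + 3) + Nat.fib (r + 4) := Nat.fib_add_two
      simp [List.range_succ, minSize]
      have h2 : Nat.fib (r + 1 + 3) = Nat.fib (r + 4) := rfl
      omega

-- Sum `weight_le` over all nodes. Each node that is not a root is a child of exactly one node, so
-- its weight cancels; the roots remain on the left and the number of nodes on the right. This
-- replaces an induction over trees.
open Classical in
theorem Inv.sum_roots_le (h : μ.Inv φ) :
    ∑ v ∈ φ.alive.filter (fun v => φ.par v = 0), minSize (μ.rank v) ≤ μ.fresh := by
  have h1 : ∑ v ∈ φ.alive.filter (fun v => ¬ φ.par v = 0), minSize (μ.rank v) =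
      ∑ v ∈ φ.alive, ((φ.kids v).map fun c => minSize (μ.rank c)).sum := by
    rw [← Finset.sum_fiberwise_of_maps_to (t := φ.alive) (g := φ.par)]
    · refine Finset.sum_congr rfl fun v hv => ?_
      rw [← List.sum_toFinset _ (h.nodup_kids hv)]
      refine Finset.sum_congr ?_ fun _ _ => rfl
      ext c
      simp only [Finset.mem_filter, List.mem_toFinset]
      constructor
      · rintro ⟨⟨hc, hp⟩, rfl⟩
        exact (h.par c hc hp).2
      · intro hc
        obtain ⟨h1, h2, -⟩ := h.kid v hv c hc
        have := (h.pos v hv).1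
        exact ⟨⟨h1, by omega⟩, h2⟩
    · intro v hv
      rw [Finset.mem_filter] at hv
      exact (h.par v hv.1 hv.2).1
  have h2 := Finset.sum_filter_add_sum_filter_not φ.alive (fun v => φ.par v = 0)
    (fun v => minSize (μ.rank v))
  have h3 : ∑ v ∈ φ.alive, (minSize (μ.rank v) -
      ((φ.kids v).map fun c => minSize (μ.rank c)).sum) ≤ ∑ v ∈ φ.alive, 1 :=
    Finset.sum_le_sum fun v hv => h.weight_le hv
  have h4 : φ.alive.card ≤ μ.fresh := by
    have : φ.alive ⊆ Finset.Icc 1 μ.fresh := fun v hv => Finset.mem_Icc.2 (h.pos v hv)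
    simpa using Finset.card_le_card this
  rw [Finset.sum_sub_distrib, Finset.sum_const, nsmul_eq_mul, mul_one] at h3
  have h5 : (φ.alive.card : ℤ) ≤ μ.fresh := by exact_mod_cast h4
  linarith

/-- The weight of a single root is at most the total weight of the roots, and weights at least
double whenever the rank grows by two. -/
theorem Inv.two_pow_rank_le (h : μ.Inv φ) {v : ℕ} (hv : v ∈ φ.alive) (hp : φ.par v = 0) :
    2 ^ (μ.rank v / 2) ≤ μ.fresh := by
  classical
  have h1 := Finset.single_le_sum (f := fun v => minSize (μ.rank v))
    (s := φ.alive.filter (fun v => φ.par v = 0)) (fun w _ => (minSize_pos _).le)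
    (Finset.mem_filter.2 ⟨hv, hp⟩)
  have h2 := h.sum_roots_le
  have h3 := two_pow_le_minSize (μ.rank v)
  have h4 : ((2 : ℤ) ^ (μ.rank v / 2)) ≤ μ.fresh := h3.trans (h1.trans h2)
  exact_mod_cast h4

theorem Inv.kids_length_full (h : μ.Inv φ) {v : ℕ} (hv : v ∈ φ.alive) (hf : μ.Full v) :
    (φ.kids v).length = μ.rank v := by
  rw [← List.length_map (f := μ.rank), h.ranks_full v hv hf]; simp

theorem Inv.kids_length_hollow (h : μ.Inv φ) {v : ℕ} (hv : v ∈ φ.alive) (hf : ¬ μ.Full v) :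
    (φ.kids v).length = min 2 (μ.rank v) := by
  rw [← List.length_map (f := μ.rank), h.ranks_hollow v hv hf]; simp

end HeapMem

end DijkstraSteiner

set_option linter.unusedSectionVars false

namespace DijkstraSteiner

/-! ### Bit masks and indices of labels -/

namespace Encoding

variable {V : Type*} [Fintype V] [DecidableEq V] {X : SteinerInstance V} (E : Encoding X)

/-- The `i`-th terminal exists and belongs to `C`. -/
def Bit (C : Finset V) (i : ℕ) : Prop := ∃ h : i < X.k, E.term ⟨i, h⟩ ∈ C

open Classical in
/-- The part of the mask of `C` below bit `j`. -/
noncomputable def low (C : Finset V) (j : ℕ) : ℕ :=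
  ∑ i ∈ Finset.range j, if E.Bit C i then 2 ^ i else 0

/-- The terminals in `C` at positions at least `j`. -/
def high (C : Finset V) (j : ℕ) : Finset V :=
  (Finset.univ.filter fun i : Fin X.k => j ≤ i ∧ E.term i ∈ C).image E.term

variable {C I J : Finset V} {j : ℕ}

theorem term_injective : Function.Injective E.term := fun i j h =>
  E.term_bij.injOn (Set.mem_univ i) (Set.mem_univ j) h

theorem term_mem (j : Fin X.k) : E.term j ∈ X.terminals :=
  E.term_bij.mapsTo (Set.mem_univ j)

theorem exists_term {v : V} (h : v ∈ X.terminals) : ∃ j, E.term j = v := by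
  obtain ⟨j, -, hj⟩ := E.term_bij.surjOn h
  exact ⟨j, hj⟩

open Classical in
theorem mask_eq_low : E.mask C = E.low C X.k := by
  rw [low, ← Fin.sum_univ_eq_sum_range (fun i => if E.Bit C i then 2 ^ i else 0)]
  refine Finset.sum_congr rfl fun j _ => ?_
  simp [Bit]

open Classical in
theorem low_succ : E.low C (j + 1) = E.low C j + if E.Bit C j then 2 ^ j else 0 :=
  Finset.sum_range_succ _ _

theorem low_lt : E.low C j < 2 ^ j := by
  classical
  induction j with
  | zero => simp [low]
  | succ j ih =>
    rw [low_succ, pow_succ]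
    split <;> omega

/-- The machine has no bit operations, so bits are read from the top: compare with `2 ^ j`, subtract
it if the bit is set, and go on with the lower part. -/
theorem low_succ_lt_iff : E.low C (j + 1) < 2 ^ j ↔ ¬ E.Bit C j := by
  classical
  have := E.low_lt (C := C) (j := j)
  rw [low_succ]
  by_cases h : E.Bit C j
  · simp only [h, if_true, not_true, iff_false]; omega
  · simpa [h] using this

theorem high_k : E.high C X.k = ∅ := by
  simp only [high, Finset.image_eq_empty, Finset.filter_eq_empty_iff]
  rintro i - ⟨h, -⟩
  have := i.2
  omega

theorem high_zero (h : C ⊆ X.terminals) : E.high C 0 = C := by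
  ext v
  simp only [high, Finset.mem_image, Finset.mem_filter, Finset.mem_univ, true_and, Nat.zero_le]
  constructor
  · rintro ⟨i, hi, rfl⟩; exact hi
  · intro hv
    obtain ⟨i, rfl⟩ := E.exists_term (h hv)
    exact ⟨i, hv, rfl⟩

theorem high_of_bit (hj : j < X.k) (h : E.Bit C j) :
    E.high C j = insert (E.term ⟨j, hj⟩) (E.high C (j + 1)) := by
  obtain ⟨hj', h⟩ := h
  ext v
  simp only [high, Finset.mem_image, Finset.mem_filter, Finset.mem_univ, true_and,
    Finset.mem_insert]
  constructor
  · rintro ⟨i, ⟨h1, h2⟩, rfl⟩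
    rcases Nat.eq_or_lt_of_le h1 with h1 | h1
    · left; congr 1; exact Fin.ext h1.symm
    · exact Or.inr ⟨i, ⟨h1, h2⟩, rfl⟩
  · rintro (rfl | ⟨i, ⟨h1, h2⟩, rfl⟩)
    · exact ⟨_, ⟨le_rfl, h⟩, rfl⟩
    · exact ⟨i, ⟨by omega, h2⟩, rfl⟩

theorem high_of_not_bit (h : ¬ E.Bit C j) : E.high C j = E.high C (j + 1) := by
  unfold high
  congr 1
  ext i
  simp only [Finset.mem_filter, Finset.mem_univ, true_and]
  constructor
  · rintro ⟨h1, h2⟩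
    refine ⟨?_, h2⟩
    rcases Nat.eq_or_lt_of_le h1 with h1 | h1
    · exact absurd ⟨h1 ▸ i.2, by simpa [h1] using h2⟩ h
    · exact h1
  · rintro ⟨h1, h2⟩
    exact ⟨by omega, h2⟩

theorem term_notMem_high (hj : j < X.k) : E.term ⟨j, hj⟩ ∉ E.high C (j + 1) := by
  simp only [high, Finset.mem_image, Finset.mem_filter, Finset.mem_univ, true_and, not_exists,
    not_and]
  rintro i ⟨h1, -⟩ h
  have := E.term_injective h
  subst this
  simp at h1

theorem mask_lt : E.mask I < 2 ^ X.k := by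
  rw [mask_eq_low]; exact E.low_lt

/-- Only unions of disjoint sets and complements within a larger set occur in the program, so
addition and truncated subtraction of masks suffice. -/
theorem mask_union (h : Disjoint I J) : E.mask (I ∪ J) = E.mask I + E.mask J := by
  unfold mask
  rw [← Finset.sum_add_distrib]
  refine Finset.sum_congr rfl fun j _ => ?_
  by_cases h1 : E.term j ∈ I
  · simp [h1, Finset.disjoint_left.1 h h1]
  · simp [h1]

theorem mask_empty : E.mask ∅ = 0 := by simp [mask]

theorem mask_singleton_term (j : Fin X.k) : E.mask {E.term j} = 2 ^ (j : ℕ) := by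
  unfold mask
  rw [Finset.sum_eq_single j]
  · simp
  · intro i _ hi
    have : E.term i ≠ E.term j := fun h => hi (E.term_injective h)
    simp [this]
  · simp

theorem mask_insert_term (j : Fin X.k) (h : E.term j ∉ I) :
    E.mask (insert (E.term j) I) = E.mask I + 2 ^ (j : ℕ) := by
  rw [Finset.insert_eq, Finset.union_comm, E.mask_union, E.mask_singleton_term]
  exact Finset.disjoint_singleton_right.2 h

theorem mask_terminals : E.mask X.terminals + 1 = 2 ^ X.k := by
  have h1 : E.mask X.terminals = ∑ j : Fin X.k, 2 ^ (j : ℕ) :=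
    Finset.sum_congr rfl fun j _ => by simp [E.term_mem j]
  rw [h1, Fin.sum_univ_eq_sum_range (fun j => 2 ^ j), Nat.geomSum_eq le_rfl]
  have := Nat.one_le_two_pow (n := X.k)
  omega

theorem mask_sdiff {A : Finset V} (h : I ⊆ A) : E.mask (A \ I) = E.mask A - E.mask I := by
  have := E.mask_union (I := I) (J := A \ I) Finset.disjoint_sdiff
  rw [Finset.union_sdiff_of_subset h] at this
  omega

theorem mask_sources : E.mask X.sources = 2 ^ X.k - 1 - 2 ^ (E.rootIndex : ℕ) := by
  have h1 := E.mask_terminals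
  have h2 : X.sources = X.terminals \ {X.root} := by
    rw [SteinerInstance.sources, Finset.sdiff_singleton_eq_erase]
  rw [h2, E.mask_sdiff (Finset.singleton_subset_iff.2 X.root_mem), ← E.term_rootIndex,
    E.mask_singleton_term]
  omega

theorem mask_injOn (hI : I ⊆ X.terminals) (hJ : J ⊆ X.terminals) (h : E.mask I = E.mask J) :
    I = J := by
  have key : ∀ A : Finset V, E.mask A =
      ∑ i ∈ (Finset.univ.filter fun j : Fin X.k => E.term j ∈ A).map Fin.valEmbedding, 2 ^ i := by
    intro A
    rw [Finset.sum_map, Finset.sum_filter]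
    rfl
  rw [key, key] at h
  have h := Finset.geomSum_injective le_rfl h
  have h := Finset.map_injective _ h
  ext v
  constructor
  · intro hv
    obtain ⟨j, rfl⟩ := E.exists_term (hI hv)
    have : j ∈ Finset.univ.filter fun j : Fin X.k => E.term j ∈ I := by simp [hv]
    rw [h] at this
    simpa using this
  · intro hv
    obtain ⟨j, rfl⟩ := E.exists_term (hJ hv)
    have : j ∈ Finset.univ.filter fun j : Fin X.k => E.term j ∈ J := by simp [hv]
    rw [← h] at this
    simpa using this

/-- The number of a label. -/
def idx (x : Label V) : ℕ := E.vertex x.1 * 2 ^ X.k + E.mask x.2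

theorem idx_inj {x y : Label V} (hx : x.2 ⊆ X.terminals) (hy : y.2 ⊆ X.terminals)
    (h : E.idx x = E.idx y) : x = y := by
  have h1 := E.mask_lt (I := x.2)
  have h2 := E.mask_lt (I := y.2)
  unfold idx at h
  have hp : 0 < 2 ^ X.k := by positivity
  have hm : E.mask x.2 = E.mask y.2 := by
    have := congrArg (· % 2 ^ X.k) h
    simpa [Nat.mul_add_mod_of_lt, Nat.mod_eq_of_lt h1, Nat.mod_eq_of_lt h2, Nat.add_mod] using this
  rw [hm] at h
  have hv := Nat.eq_of_mul_eq_mul_right hp (Nat.add_right_cancel h)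
  exact Prod.ext (E.vertex.injective (Fin.ext hv)) (E.mask_injOn hx hy hm)

theorem idx_union {v : V} (h : Disjoint I J) : E.idx (v, I ∪ J) = E.idx (v, I) + E.mask J := by
  simp only [idx, E.mask_union h]
  omega

end Encoding

/-- `l` enumerates the subsets of `D`, beginning with the empty set. -/
structure EnumSubsets {V : Type*} (l : List (Finset V)) (D : Finset V) : Prop where
  nodup : l.Nodup
  mem : ∀ J, J ∈ l ↔ J ⊆ D
  head : ∃ r, l = ∅ :: r

section EnumSubsets

variable {V : Type*} [DecidableEq V]

theorem EnumSubsets.empty : EnumSubsets [∅] (∅ : Finset V) :=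
  ⟨List.nodup_singleton _, by simp [Finset.subset_empty], [], rfl⟩

/-- The list of subsets doubles with each new element. Appending the second half leaves the empty
set in position `0`, where the loop over the sets `J` can skip it. -/
theorem EnumSubsets.insert {l : List (Finset V)} {D : Finset V} (h : EnumSubsets l D) {t : V}
    (ht : t ∉ D) : EnumSubsets (l ++ l.map (Insert.insert t)) (Insert.insert t D) := by
  have hl : ∀ J ∈ l, t ∉ J := fun J hJ hJ' => ht ((h.mem J).1 hJ hJ')
  refine ⟨?_, ?_, ?_⟩
  · refine List.Nodup.append h.nodup ?_ ?_
    · refine List.Nodup.map_on ?_ h.nodup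
      intro J hJ J' hJ' e
      rw [← Finset.erase_insert (hl J hJ), e, Finset.erase_insert (hl J' hJ')]
    · intro J hJ hJ'
      obtain ⟨J', -, rfl⟩ := List.mem_map.1 hJ'
      exact hl _ hJ (Finset.mem_insert_self _ _)
  · intro J
    rw [List.mem_append, List.mem_map, h.mem]
    constructor
    · rintro (h1 | ⟨J', h1, rfl⟩)
      · exact h1.trans (Finset.subset_insert _ _)
      · exact Finset.insert_subset_insert _ ((h.mem J').1 h1)
    · intro h1
      by_cases hJ : t ∈ J
      · exact Or.inr ⟨J.erase t, (h.mem _).2 (Finset.subset_insert_iff.1 h1), Finset.insert_erase hJ⟩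
      · refine Or.inl fun v hv => ?_
        rcases Finset.mem_insert.1 (h1 hv) with rfl | h2
        · exact absurd hv hJ
        · exact h2
  · obtain ⟨r, rfl⟩ := h.head
    exact ⟨_, rfl⟩

theorem EnumSubsets.length_eq {l : List (Finset V)} {D : Finset V} (h : EnumSubsets l D) :
    l.length = 2 ^ D.card := by
  rw [← Finset.card_powerset, ← List.toFinset_card_of_nodup h.nodup]
  congr 1
  ext J
  rw [List.mem_toFinset, h.mem, Finset.mem_powerset]

end EnumSubsets

/-- `l` is the linked list that starts at `a` and ends with `0`. -/
def Chained (next : ℕ → ℕ) : ℕ → List ℕ → Prop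
  | a, [] => a = 0
  | a, h :: l => a = h ∧ h ≠ 0 ∧ Chained next (next h) l

theorem Chained.congr {next next' : ℕ → ℕ} {a : ℕ} {l : List ℕ} (h : Chained next a l)
    (H : ∀ c ∈ l, next' c = next c) : Chained next' a l := by
  induction l generalizing a with
  | nil => exact h
  | cons c l ih =>
    refine ⟨h.1, h.2.1, ?_⟩
    rw [H c (by simp)]
    exact ih h.2.2 (fun d hd => H d (by simp [hd]))

/-! ### Invariants of the Dijkstra-Steiner algorithm -/

section Algorithm

variable {V : Type*} [DecidableEq V] {X : SteinerInstance V} {st : State V} {xs : List (Label V)}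

namespace State

variable {x y z : Label V} {d : WithTop ℝ} {B : Set (Label V)}

theorem relax_of (h : d < st.l y ∧ y ∉ st.P) : st.relax y d B =
    { l := Function.update st.l y d
      b := Function.update st.b y B
      N := insert y st.N
      P := st.P } := if_pos h

theorem relax_of_not (h : ¬ (d < st.l y ∧ y ∉ st.P)) : st.relax y d B = st := if_neg h

@[simp] theorem relax_P : (st.relax y d B).P = st.P := by
  unfold relax; split <;> rfl

theorem relax_l_ne_top (h : st.l z ≠ ⊤) : (st.relax y d B).l z ≠ ⊤ := by
  by_cases hc : d < st.l y ∧ y ∉ st.P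
  · rw [relax_of hc]
    simp only [Function.update_apply]
    split
    · exact hc.1.ne_top
    · exact h
  · rwa [relax_of_not hc]

theorem relax_l_self (hd : d ≠ ⊤) (h : y ∈ st.P → st.l y ≠ ⊤) : (st.relax y d B).l y ≠ ⊤ := by
  by_cases hc : d < st.l y ∧ y ∉ st.P
  · rw [relax_of hc]
    simpa using hc.1.ne_top
  · rw [relax_of_not hc]
    by_cases hP : y ∈ st.P
    · exact h hP
    · intro h'
      exact hc ⟨h' ▸ hd.lt_top, hP⟩

end State

namespace SteinerInstance

/-- The labels `(v, I)` with `I` a nonempty set of source terminals. -/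
def IsLabel (X : SteinerInstance V) (x : Label V) : Prop := x.2 ⊆ X.sources ∧ x.2 ≠ ∅

/-- The invariant of the main loop after the selection of the labels in `xs`. -/
structure Inv (X : SteinerInstance V) (st : State V) (xs : List (Label V)) : Prop where
  label : ∀ x ∈ xs, X.IsLabel x
  nodup : xs.Nodup
  perm : ∀ y, y ∈ st.P ↔ y.2 = ∅ ∨ y ∈ xs
  cand : ∀ y ∈ st.N, X.IsLabel y ∧ y ∉ st.P
  fin : ∀ y, X.IsLabel y → (st.l y ≠ ⊤ ↔ y ∈ st.N ∨ y ∈ st.P)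
  back_mem : ∀ y, X.IsLabel y → ∀ z ∈ st.b y, z ∈ xs
  back_lt : ∀ (j : ℕ) (h : j < xs.length), ∀ z ∈ st.b xs[j], z ∈ xs.take j

/-- All labels that can be reached from permanent labels have been given a finite cost. -/
structure Closed (X : SteinerInstance V) (st : State V) (xs : List (Label V)) : Prop where
  source : ∀ s ∈ X.sources, st.l (s, {s}) ≠ ⊤
  edge : ∀ x ∈ xs, ∀ w, X.G.Adj x.1 w → st.l (w, x.2) ≠ ⊤
  union : ∀ v I J, (v, I) ∈ xs → (v, J) ∈ xs → Disjoint I J → st.l (v, I ∪ J) ≠ ⊤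

variable {x y : Label V} {d : WithTop ℝ} {B : Set (Label V)}

theorem Inv.fin_of_mem (h : X.Inv st xs) (hx : x ∈ xs) : st.l x ≠ ⊤ :=
  (h.fin x (h.label x hx)).2 (Or.inr ((h.perm x).2 (Or.inr hx)))

theorem Inv.relax (h : X.Inv st xs) (hy : X.IsLabel y) (hB : ∀ z ∈ B, z ∈ xs) :
    X.Inv (st.relax y d B) xs := by
  by_cases hc : d < st.l y ∧ y ∉ st.P
  · rw [State.relax_of hc]
    have hyx : y ∉ xs := fun h' => hc.2 ((h.perm y).2 (Or.inr h'))
    refine ⟨h.label, h.nodup, h.perm, ?_, ?_, ?_, ?_⟩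
    · rintro z (rfl | hz)
      · exact ⟨hy, hc.2⟩
      · exact h.cand z hz
    · intro z hz
      simp only [Function.update_apply, Set.mem_insert_iff]
      by_cases hzy : z = y
      · simp [hzy, hc.1.ne_top]
      · simp only [hzy, if_false, false_or]
        exact h.fin z hz
    · intro z hz
      simp only [Function.update_apply]
      split
      · exact hB
      · exact h.back_mem z hz
    · intro j hj
      have : xs[j] ≠ y := fun e => hyx (e ▸ List.getElem_mem hj)
      simp only [Function.update_of_ne this]
      exact h.back_lt j hj
  · rwa [State.relax_of_not hc]

/-- At the moment of selection `b x` contains only labels in `xs`. Since `relax` never touches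
permanent labels, this set stays fixed, so `back_mem` for `x` becomes `back_lt` for the new last
position. -/
theorem Inv.makePermanent (h : X.Inv st xs) (hx : x ∈ st.N) :
    X.Inv (st.makePermanent x) (xs ++ [x]) := by
  obtain ⟨hl, hP⟩ := h.cand x hx
  have hxx : x ∉ xs := fun h' => hP ((h.perm x).2 (Or.inr h'))
  refine ⟨?_, ?_, ?_, ?_, ?_, ?_, ?_⟩
  · intro y hy
    rcases List.mem_append.1 hy with hy | hy
    · exact h.label y hy
    · rw [List.mem_singleton.1 hy]; exact hl
  · refine List.Nodup.append h.nodup (List.nodup_singleton x) ?_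
    intro a ha hb
    rw [List.mem_singleton] at hb
    exact hxx (hb ▸ ha)
  · intro y
    simp only [State.makePermanent, Set.mem_insert_iff, h.perm, List.mem_append,
      List.mem_singleton]
    tauto
  · rintro y ⟨hy, hyx⟩
    obtain ⟨h1, h2⟩ := h.cand y hy
    exact ⟨h1, fun h' => h'.elim hyx h2⟩
  · intro y hy
    show st.l y ≠ ⊤ ↔ y ∈ st.N \ {x} ∨ y ∈ insert x st.P
    rw [h.fin y hy]
    by_cases hyx : y = x
    · subst hyx; simp [hx]
    · simp [hyx]
  · intro y hy z hz
    exact List.mem_append_left _ (h.back_mem y hy z hz)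
  · intro j hj z hz
    change z ∈ st.b _ at hz
    by_cases hj' : j < xs.length
    · rw [List.getElem_append_left hj'] at hz
      rw [List.take_append_of_le_length hj'.le]
      exact h.back_lt j hj' z hz
    · have hj2 : j = xs.length := by simp at hj; omega
      subst hj2
      rw [List.getElem_append_right le_rfl] at hz
      rw [List.take_left']
      · exact h.back_mem x hl z (by simpa using hz)
      · rfl

theorem isLabel_edge (hx : X.IsLabel x) (w : V) : X.IsLabel (w, x.2) := hx

theorem isLabel_union {J : Finset V} (hx : X.IsLabel x) (hJ : J ⊆ X.sources \ x.2) :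
    X.IsLabel (x.1, x.2 ∪ J) := by
  refine ⟨Finset.union_subset hx.1 (hJ.trans Finset.sdiff_subset), ?_⟩
  intro h
  exact hx.2 (Finset.union_eq_empty.1 h).1

theorem edgeLoop_cons (w : V) (ws : List V) :
    X.edgeLoop x (w :: ws) st = X.edgeLoop x ws
      (st.relax (w, x.2) (st.l x + ((X.c s(x.1, w) : ℝ) : WithTop ℝ)) {x}) := rfl

theorem mergeLoop_cons (J : Finset V) (Js : List (Finset V)) :
    st.mergeLoop x (J :: Js) =
      (st.relax (x.1, x.2 ∪ J) (st.l x + st.l (x.1, J)) {x, (x.1, J)}).mergeLoop x Js := rfl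

theorem Inv.edgeLoop (h : X.Inv st xs) (hx : x ∈ xs) (ws : List V) :
    X.Inv (X.edgeLoop x ws st) xs := by
  induction ws generalizing st with
  | nil => exact h
  | cons w ws ih =>
    rw [edgeLoop_cons]
    exact ih (h.relax (isLabel_edge (h.label x hx) w) (by simpa using hx))

theorem edgeLoop_l_ne_top (ws : List V) {z : Label V} (hz : st.l z ≠ ⊤) :
    (X.edgeLoop x ws st).l z ≠ ⊤ := by
  induction ws generalizing st with
  | nil => exact hz
  | cons w ws ih =>
    rw [edgeLoop_cons]
    exact ih (State.relax_l_ne_top hz)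

@[simp] theorem edgeLoop_P (ws : List V) : (X.edgeLoop x ws st).P = st.P := by
  induction ws generalizing st with
  | nil => rfl
  | cons w ws ih => rw [edgeLoop_cons, ih, State.relax_P]

theorem Inv.edgeLoop_l_self (h : X.Inv st xs) (hx : x ∈ xs) {ws : List V} {w : V} (hw : w ∈ ws) :
    (X.edgeLoop x ws st).l (w, x.2) ≠ ⊤ := by
  induction ws generalizing st with
  | nil => simp at hw
  | cons w' ws ih =>
    rw [edgeLoop_cons]
    have hl := isLabel_edge (h.label x hx)
    rcases List.mem_cons.1 hw with rfl | hw
    · apply edgeLoop_l_ne_top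
      apply State.relax_l_self
      · exact WithTop.add_ne_top.2 ⟨h.fin_of_mem hx, WithTop.coe_ne_top⟩
      · intro hP
        exact (h.fin _ (hl w)).2 (Or.inr hP)
    · exact ih (h.relax (hl w') (by simpa using hx)) hw

/-- The conditions on a set `J` in the second inner loop. -/
def Mergeable (X : SteinerInstance V) (P : Set (Label V)) (x : Label V) (J : Finset V) : Prop :=
  J ≠ ∅ ∧ J ⊆ X.sources \ x.2 ∧ (x.1, J) ∈ P

theorem Inv.mem_of_mergeable (h : X.Inv st xs) {J : Finset V} (hJ : X.Mergeable st.P x J) :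
    (x.1, J) ∈ xs := by
  have := (h.perm _).1 hJ.2.2
  exact this.resolve_left hJ.1

theorem Inv.relax_merge (h : X.Inv st xs) (hx : x ∈ xs) {J : Finset V}
    (hJ : X.Mergeable st.P x J) :
    X.Inv (st.relax (x.1, x.2 ∪ J) (st.l x + st.l (x.1, J)) {x, (x.1, J)}) xs := by
  refine h.relax (isLabel_union (h.label x hx) hJ.2.1) ?_
  rintro z (rfl | rfl)
  · exact hx
  · exact h.mem_of_mergeable hJ

theorem Inv.mergeLoop (h : X.Inv st xs) (hx : x ∈ xs) {Js : List (Finset V)}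
    (hJ : ∀ J ∈ Js, X.Mergeable st.P x J) : X.Inv (st.mergeLoop x Js) xs := by
  induction Js generalizing st with
  | nil => exact h
  | cons J Js ih =>
    rw [mergeLoop_cons]
    refine ih (h.relax_merge hx (hJ J (by simp))) fun J' hJ' => ?_
    rw [State.relax_P]
    exact hJ J' (by simp [hJ'])

theorem mergeLoop_l_ne_top (Js : List (Finset V)) {z : Label V} (hz : st.l z ≠ ⊤) :
    (st.mergeLoop x Js).l z ≠ ⊤ := by
  induction Js generalizing st with
  | nil => exact hz
  | cons w ws ih =>
    rw [mergeLoop_cons]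
    exact ih (State.relax_l_ne_top hz)

@[simp] theorem mergeLoop_P (Js : List (Finset V)) : (st.mergeLoop x Js).P = st.P := by
  induction Js generalizing st with
  | nil => rfl
  | cons w ws ih => rw [mergeLoop_cons, ih, State.relax_P]

theorem Inv.mergeLoop_l_self (h : X.Inv st xs) (hx : x ∈ xs) {Js : List (Finset V)}
    (hJ : ∀ J ∈ Js, X.Mergeable st.P x J) {J : Finset V} (hm : J ∈ Js) :
    (st.mergeLoop x Js).l (x.1, x.2 ∪ J) ≠ ⊤ := by
  induction Js generalizing st with
  | nil => simp at hm
  | cons J' Js ih =>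
    rw [mergeLoop_cons]
    rcases List.mem_cons.1 hm with rfl | hm
    · apply mergeLoop_l_ne_top
      have hJ' := hJ J (by simp)
      apply State.relax_l_self
      · exact WithTop.add_ne_top.2 ⟨h.fin_of_mem hx, h.fin_of_mem (h.mem_of_mergeable hJ')⟩
      · intro hP
        exact (h.fin _ (isLabel_union (h.label x hx) hJ'.2.1)).2 (Or.inr hP)
    · refine ih (h.relax_merge hx (hJ J' (by simp))) (fun J' hJ' => ?_) hm
      rw [State.relax_P]
      exact hJ J' (by simp [hJ'])

theorem Inv.iteration (h : X.Inv st xs) (hc : X.Closed st xs) {L : V → Finset V → ℝ}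
    {st' : State V} (hi : X.Iteration L st x st') :
    X.Inv st' (xs ++ [x]) ∧ X.Closed st' (xs ++ [x]) := by
  obtain ⟨hx, -, ws, Js, -, hws, -, hJs, rfl⟩ := hi
  have h1 := h.makePermanent hx
  have hxm : x ∈ xs ++ [x] := by simp
  have h2 := h1.edgeLoop hxm ws
  have hJ : ∀ J ∈ Js, X.Mergeable (X.edgeLoop x ws (st.makePermanent x)).P x J := by
    intro J hJ
    rw [edgeLoop_P]
    exact (hJs J).1 hJ
  have h3 := h2.mergeLoop hxm hJ
  have mono : ∀ z, st.l z ≠ ⊤ →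
      ((X.edgeLoop x ws (st.makePermanent x)).mergeLoop x Js).l z ≠ ⊤ := fun z hz =>
    mergeLoop_l_ne_top _ (edgeLoop_l_ne_top _ hz)
  have hnew : ∀ J, (x.1, J) ∈ xs ++ [x] → Disjoint x.2 J →
      ((X.edgeLoop x ws (st.makePermanent x)).mergeLoop x Js).l (x.1, x.2 ∪ J) ≠ ⊤ := by
    intro J hm hd
    have hl := h3.label _ hm
    refine h2.mergeLoop_l_self hxm hJ ((hJs J).2 ⟨hl.2, ?_, (h1.perm _).2 (Or.inr hm)⟩)
    intro v hv
    exact Finset.mem_sdiff.2 ⟨hl.1 hv, fun hv' => Finset.disjoint_left.1 hd hv' hv⟩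
  refine ⟨h3, ⟨fun s hs => mono _ (hc.source s hs), ?_, ?_⟩⟩
  · intro y hy w hw
    rcases List.mem_append.1 hy with hy | hy
    · exact mono _ (hc.edge y hy w hw)
    · rw [List.mem_singleton] at hy
      subst hy
      exact mergeLoop_l_ne_top _ (h1.edgeLoop_l_self hxm ((hws w).2 hw))
  -- If neither of the two labels is new, the claim is inherited; otherwise the merge took place
  -- when the later one was selected, whichever of them that was.
  · intro v I J hI hJ' hd
    by_cases h1 : (v, I) = x
    · subst h1
      exact hnew J hJ' hd
    · by_cases h2 : (v, J) = x
      · subst h2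
        rw [Finset.union_comm]
        exact hnew I hI hd.symm
      · simp only [List.mem_append, List.mem_singleton, h1, h2, or_false] at hI hJ'
        exact mono _ (hc.union v I J hI hJ' hd)

/-- The main loop cannot get stuck. Without candidates, every label of finite cost is permanent;
walking along edges from `s` makes all labels `(v, {s})` permanent, since the graph is connected,
and adding one terminal at a time makes all labels permanent, including the goal. -/
theorem Closed.nonempty (h : X.Inv st xs) (hc : X.Closed st xs)
    (hg : (X.root, X.sources) ∉ st.P) : st.N.Nonempty := by
  by_contra hN
  rw [Set.not_nonempty_iff_eq_empty] at hN
  have hmem : ∀ y, X.IsLabel y → st.l y ≠ ⊤ → y ∈ xs := by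
    intro y hy hl
    have := (h.fin y hy).1 hl
    rw [hN] at this
    exact ((h.perm y).1 (this.resolve_left (by simp))).resolve_left hy.2
  have hsing : ∀ s ∈ X.sources, ∀ v, (v, {s}) ∈ xs := by
    intro s hs v
    have hl : ∀ v, X.IsLabel (v, {s}) := fun v =>
      ⟨Finset.singleton_subset_iff.2 hs, Finset.singleton_ne_empty s⟩
    obtain ⟨p⟩ := X.conn.preconnected v s
    induction p with
    | nil => exact hmem _ (hl _) (hc.source _ hs)
    | cons hadj _ ih =>
      exact hmem _ (hl _) (hc.edge _ (ih hs hl) _ hadj.symm)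
  have hall : ∀ I : Finset V, I ⊆ X.sources → I ≠ ∅ → ∀ v, (v, I) ∈ xs := by
    intro I
    induction I using Finset.induction_on with
    | empty => intro _ h; exact absurd rfl h
    | insert s I hs ih =>
      intro hI _ v
      have hs' : s ∈ X.sources := hI (Finset.mem_insert_self _ _)
      by_cases hI0 : I = ∅
      · subst hI0
        exact hsing s hs' v
      · refine hmem _ ⟨hI, Finset.insert_ne_empty _ _⟩ ?_
        rw [Finset.insert_eq]
        exact hc.union _ _ _ (hsing s hs' v)
          (ih ((Finset.subset_insert _ _).trans hI) hI0 v) (Finset.disjoint_singleton_left.2 hs)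
  apply hg
  rw [h.perm]
  by_cases h0 : X.sources = ∅
  · exact Or.inl h0
  · exact Or.inr (hall _ subset_rfl h0 _)

theorem inv_init : X.Inv X.init [] := by
  refine ⟨by simp, List.nodup_nil, by simp [init], ?_, ?_, ?_, ?_⟩
  · rintro y ⟨h1, h2⟩
    refine ⟨⟨?_, ?_⟩, ?_⟩
    · rw [h2]; exact Finset.singleton_subset_iff.2 h1
    · rw [h2]; exact Finset.singleton_ne_empty _
    · show ¬ y.2 = ∅
      rw [h2]; exact Finset.singleton_ne_empty _
  · intro y hy
    simp only [init, Set.mem_ofPred_eq]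
    have := hy.2
    split_ifs with h
    · simp only [ne_eq, WithTop.zero_ne_top, not_false_eq_true, true_iff]; tauto
    · simp only [ne_eq, not_true, false_iff]; tauto
  · intro y _ z hz
    simp [init] at hz
  · intro j hj
    simp at hj

theorem closed_init : X.Closed X.init [] := by
  refine ⟨?_, by simp, by simp⟩
  intro s hs
  simp [init, hs]

/-! ### Backtracking -/

/-- `y` is reached by backtracking from `x`. -/
def Reach (b : Label V → Set (Label V)) : Label V → Label V → Prop :=
  Relation.ReflTransGen fun x y => y ∈ b x

/-- The edges that are found by backtracking from `x`. -/
def backSet (b : Label V → Set (Label V)) (x : Label V) : Set (Sym2 V) :=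
  {e | ∃ v w I, Reach b x (v, I) ∧ b (v, I) = {(w, I)} ∧ e = s(v, w)}

/-- Recursive calls go to earlier positions, so the recursion terminates, and its result has the
closed form `backSet`: the edges at all reachable labels whose backtracking set is a singleton with
the same terminal set. -/
theorem Inv.backtrack (h : X.Inv st xs) (j : ℕ) (hj : j < xs.length) :
    Backtrack st.b xs[j] (backSet st.b xs[j]) := by
  induction j using Nat.strong_induction_on with
  | _ j ih =>
    have hz : ∀ z ∈ st.b xs[j], Backtrack st.b z (backSet st.b z) := by
      intro z hz
      obtain ⟨i, hi, rfl⟩ := List.mem_take_iff_getElem.1 (h.back_lt j hj z hz)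
      exact ih i (by omega) (by omega)
    generalize xs[j] = y at hz ⊢
    obtain ⟨v, I⟩ := y
    by_cases hw : ∃ w, st.b (v, I) = {(w, I)}
    · obtain ⟨w, hw⟩ := hw
      have : backSet st.b (v, I) = {s(v, w)} ∪ backSet st.b (w, I) := by
        ext e
        constructor
        · rintro ⟨v', w', I', hr, hb, rfl⟩
          rcases Relation.ReflTransGen.cases_head hr with he | ⟨y, hy, hr⟩
          · obtain ⟨rfl, rfl⟩ := Prod.mk.inj he
            rw [hw] at hb
            have := (Prod.mk.inj (Set.singleton_eq_singleton_iff.1 hb)).1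
            left; rw [this]; rfl
          · rw [hw, Set.mem_singleton_iff] at hy
            subst hy
            exact Or.inr ⟨v', w', I', hr, hb, rfl⟩
        · rintro (rfl | ⟨v', w', I', hr, hb, rfl⟩)
          · exact ⟨v, w, I, Relation.ReflTransGen.refl, hw, rfl⟩
          · refine ⟨v', w', I', Relation.ReflTransGen.head ?_ hr, hb, rfl⟩
            rw [hw]; rfl
      rw [this]
      exact .edge v w I _ hw (hz _ (by rw [hw]; rfl))
    · have : backSet st.b (v, I) = ⋃ y ∈ st.b (v, I), backSet st.b y := by
        ext e
        simp only [Set.mem_iUnion]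
        constructor
        · rintro ⟨v', w', I', hr, hb, rfl⟩
          rcases Relation.ReflTransGen.cases_head hr with he | ⟨y, hy, hr⟩
          · obtain ⟨rfl, rfl⟩ := Prod.mk.inj he
            exact absurd ⟨_, hb⟩ hw
          · exact ⟨y, hy, v', w', I', hr, hb, rfl⟩
        · rintro ⟨y, hy, v', w', I', hr, hb, rfl⟩
          exact ⟨v', w', I', Relation.ReflTransGen.head hy hr, hb, rfl⟩
      rw [this]
      exact .union v I _ hw hz

theorem Inv.reach_mem (h : X.Inv st xs) (hx : x ∈ xs) (hr : Reach st.b x y) : y ∈ xs := by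
  induction hr with
  | refl => exact hx
  | tail _ hy ih => exact h.back_mem _ (h.label _ ih) _ hy

end SteinerInstance

end Algorithm

/-! ### Potentials -/

section Potential

variable {V : Type*} [Fintype V] [DecidableEq V] {X : SteinerInstance V} {st : State V}

namespace SteinerInstance

/-- The set of all labels `(v, I)` with `I` nonempty. -/
def labels (X : SteinerInstance V) : Finset (Label V) :=
  (Finset.univ ×ˢ X.sources.powerset).filter fun x => x.2 ≠ ∅

theorem mem_labels {x : Label V} : x ∈ X.labels ↔ X.IsLabel x := by
  simp [labels, IsLabel]

open Classical in
/-- The number of labels of infinite cost. -/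
noncomputable def untouched (X : SteinerInstance V) (st : State V) : ℕ :=
  (X.labels.filter fun x => st.l x = ⊤).card

open Classical in
/-- The sum of `g` over all labels that are not permanent. -/
noncomputable def pending (X : SteinerInstance V) (g : Label V → ℕ) (st : State V) : ℕ :=
  ∑ x ∈ X.labels.filter (fun x => x ∉ st.P), g x

theorem pending_congr {g : Label V → ℕ} {st' : State V} (h : st'.P = st.P) :
    X.pending g st' = X.pending g st := by
  unfold pending; rw [h]

theorem pending_makePermanent (g : Label V → ℕ) {x : Label V} (hx : X.IsLabel x)
    (hP : x ∉ st.P) :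
    X.pending g (st.makePermanent x) + g x = X.pending g st := by
  classical
  unfold pending
  rw [← Finset.sum_erase_add (X.labels.filter fun x => x ∉ st.P) g (a := x)
    (by simp [mem_labels, hx, hP])]
  congr 1
  refine Finset.sum_congr ?_ fun _ _ => rfl
  ext y
  simp only [State.makePermanent, Set.mem_insert_iff, Finset.mem_filter, Finset.mem_erase]
  tauto

/-- The count drops exactly when a cost becomes finite for the first time; this releases the credit
for the query to the oracle. -/
theorem untouched_update (st' : State V) {y : Label V} {d : WithTop ℝ} (hy : X.IsLabel y)
    (hd : d ≠ ⊤) (hl : st'.l = Function.update st.l y d) :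
    X.untouched st' + (if st.l y = ⊤ then 1 else 0) = X.untouched st := by
  classical
  have he : X.labels.filter (fun x => st'.l x = ⊤) =
      (X.labels.filter fun x => st.l x = ⊤).erase y := by
    ext z
    rw [hl]
    simp only [Finset.mem_filter, Finset.mem_erase, Function.update_apply]
    by_cases hz : z = y
    · simp [hz, hd]
    · simp [hz]
  unfold untouched
  rw [he]
  split_ifs with h
  · exact Finset.card_erase_add_one (by simp [mem_labels, hy, h])
  · rw [Finset.erase_eq_of_notMem (by simp [h])]; rfl

end SteinerInstance

end Potential

/-! ### The memory of the implementation -/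

/-- The variable data of the main loop: the heap, the stack of its roots, and for each label a flag
for permanence, its vertex and set, its backtracking data, its cost and its lower bound. -/
structure Mem where
  heap : HeapMem
  stack : List ℕ
  perm : ℕ → ℕ
  vert : ℕ → ℕ
  set : ℕ → ℕ
  kind : ℕ → ℕ
  pred : ℕ → ℕ
  aux : ℕ → ℕ
  cost : ℕ → ℝ
  bound : ℕ → ℝ

namespace Mem

/-- The memory after recording the vertex, the set and the lower bound of a label. -/
def touch (μ : Mem) (y v M : ℕ) (z : ℝ) : Mem :=
  { μ with
    vert := Function.update μ.vert y v
    set := Function.update μ.set y M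
    bound := Function.update μ.bound y z }

/-- The memory after decreasing the cost of a label to `d`. -/
def improve (μ : Mem) (y : ℕ) (d : ℝ) (t q₁ q₂ : ℕ) : Mem :=
  { μ with
    heap := μ.heap.push y (d + μ.bound y)
    stack := μ.stack ++ [μ.heap.fresh + 1]
    kind := Function.update μ.kind y t
    pred := Function.update μ.pred y q₁
    aux := Function.update μ.aux y q₂
    cost := Function.update μ.cost y d }

end Mem

section Rel

variable {V : Type*} [Fintype V] [DecidableEq V] {X : SteinerInstance V} (E : Encoding X)
  (L : V → Finset V → ℝ)

/-- The numbers `t`, `q₁`, `q₂` represent the set `B` of backtracking labels of `y`. -/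
def Encoding.BackCode (t q₁ q₂ : ℕ) (y : Label V) (B : Set (Label V)) : Prop :=
  (t = 0 ∧ B = ∅) ∨
  (t = 1 ∧ ∃ w, B = {(w, y.2)} ∧ q₁ = E.idx (w, y.2) ∧
    ∃ i : Fin X.m, q₂ = i ∧ s(E.tail i, E.head i) = s(y.1, w)) ∨
  (t = 2 ∧ ∃ z z', z ≠ z' ∧ B = {z, z'} ∧ q₁ = E.idx z ∧ q₂ = E.idx z')

/-- The memory `μ`, with the heap representing `φ`, represents the state `st`. -/
structure Encoding.Rel (μ : Mem) (st : State V) (φ : Forest) : Prop where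
  heap : μ.heap.Inv φ
  roots : HeapMem.Roots φ μ.stack
  l : ∀ x, X.IsLabel x →
    st.l x = if μ.heap.node (E.idx x) = 0 then ⊤ else ((μ.cost (E.idx x) : ℝ) : WithTop ℝ)
  perm : ∀ x, X.IsLabel x → (x ∈ st.P ↔ μ.perm (E.idx x) = 1)
  cand : ∀ x, X.IsLabel x →
    (x ∈ st.N ↔ μ.heap.node (E.idx x) ≠ 0 ∧ μ.perm (E.idx x) ≠ 1)
  cand_label : ∀ x ∈ st.N, X.IsLabel x
  data : ∀ x, X.IsLabel x → μ.heap.node (E.idx x) ≠ 0 →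
    μ.bound (E.idx x) = L x.1 (X.terminals \ x.2) ∧ μ.vert (E.idx x) = E.vertex x.1 ∧
      μ.set (E.idx x) = E.mask x.2
  back : ∀ x, X.IsLabel x →
    E.BackCode (μ.kind (E.idx x)) (μ.pred (E.idx x)) (μ.aux (E.idx x)) x (st.b x)
  item : ∀ v ∈ φ.alive, ∃ x, X.IsLabel x ∧ μ.heap.item v = E.idx x ∧ μ.heap.node (E.idx x) ≠ 0
  live : ∀ x, X.IsLabel x → μ.heap.node (E.idx x) ≠ 0 → μ.perm (E.idx x) ≠ 1 →
    μ.heap.node (E.idx x) ∈ φ.alive ∧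
      μ.heap.key (μ.heap.node (E.idx x)) = μ.cost (E.idx x) + μ.bound (E.idx x)
  dead : ∀ x, X.IsLabel x → μ.perm (E.idx x) = 1 → μ.heap.node (E.idx x) ∉ φ.alive

variable {E L} {μ : Mem} {st : State V} {φ : Forest} {x y : Label V}

theorem SteinerInstance.IsLabel.subset (h : X.IsLabel x) : x.2 ⊆ X.terminals :=
  h.1.trans (Finset.erase_subset _ _)

theorem Encoding.idx_ne (hx : X.IsLabel x) (hy : X.IsLabel y) (h : x ≠ y) : E.idx x ≠ E.idx y :=
  fun h' => h (E.idx_inj hx.subset hy.subset h')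

theorem Encoding.Rel.l_eq_top (h : E.Rel L μ st φ) (hx : X.IsLabel x) :
    st.l x = ⊤ ↔ μ.heap.node (E.idx x) = 0 := by
  rw [h.l x hx]; split_ifs with h0 <;> simp [h0]

theorem Encoding.Rel.l_of_ne (h : E.Rel L μ st φ) (hx : X.IsLabel x) (h0 : st.l x ≠ ⊤) :
    st.l x = ((μ.cost (E.idx x) : ℝ) : WithTop ℝ) := by
  rw [h.l x hx, if_neg]
  rwa [← h.l_eq_top hx]

/-- While the cost of `y` is infinite its node is `0`, and `Rel` demands nothing of the stored
vertex, set and bound. They may therefore be written before the label enters the heap. -/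
theorem Encoding.Rel.touch (h : E.Rel L μ st φ) (hy : X.IsLabel y) (h0 : st.l y = ⊤)
    (v M : ℕ) (z : ℝ) : E.Rel L (μ.touch (E.idx y) v M z) st φ := by
  have hy0 := (h.l_eq_top hy).1 h0
  have hne : ∀ x, X.IsLabel x → μ.heap.node (E.idx x) ≠ 0 → E.idx x ≠ E.idx y := by
    intro x hx hn e
    rw [e] at hn; exact hn hy0
  refine ⟨h.heap, h.roots, h.l, h.perm, h.cand, h.cand_label, ?_, h.back, h.item, ?_, h.dead⟩
  · intro x hx hn
    have := hne x hx hn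
    simpa [Mem.touch, Function.update_of_ne this] using h.data x hx hn
  · intro x hx hn hp
    have := hne x hx hn
    simpa [Mem.touch, Function.update_of_ne this] using h.live x hx hn hp

/-- The stored bound of a label never changes once the label is in the heap, so a smaller cost means
a smaller key, as `HeapMem.Inv.push` requires. A label that is not permanent and has a node has it
in the forest. -/
theorem Encoding.Rel.improve (h : E.Rel L μ st φ) (hy : X.IsLabel y) {d : ℝ} {t q₁ q₂ : ℕ}
    {B : Set (Label V)} (hB : E.BackCode t q₁ q₂ y B) (hd : (d : WithTop ℝ) < st.l y)
    (hP : y ∉ st.P)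
    (hdata : μ.bound (E.idx y) = L y.1 (X.terminals \ y.2) ∧ μ.vert (E.idx y) = E.vertex y.1 ∧
      μ.set (E.idx y) = E.mask y.2) :
    ∃ φ', E.Rel L (μ.improve (E.idx y) d t q₁ q₂) (st.relax y d B) φ' ∧
      (μ.improve (E.idx y) d t q₁ q₂).heap.hollow φ' ≤ μ.heap.hollow φ + 1 := by
  have hp1 : μ.perm (E.idx y) ≠ 1 := fun h' => hP ((h.perm y hy).2 h')
  have hx : μ.heap.node (E.idx y) = 0 ∨ μ.heap.node (E.idx y) ∈ φ.alive ∧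
      d + μ.bound (E.idx y) ≤ μ.heap.key (μ.heap.node (E.idx y)) := by
    by_cases h0 : μ.heap.node (E.idx y) = 0
    · exact Or.inl h0
    · obtain ⟨h1, h2⟩ := h.live y hy h0 hp1
      refine Or.inr ⟨h1, ?_⟩
      rw [h2]
      rw [h.l y hy, if_neg h0, WithTop.coe_lt_coe] at hd
      linarith
  obtain ⟨φ', ha, hi, hr, hh⟩ := h.heap.push h.roots hx
  have hn0 : μ.heap.fresh + 1 ≠ 0 := by omega
  have hne : ∀ x, X.IsLabel x → x ≠ y → E.idx x ≠ E.idx y := fun x hx hxy => E.idx_ne hx hy hxy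
  have hnode : ∀ x, μ.heap.node x ≠ μ.heap.fresh + 1 := fun x => by
    have := h.heap.node_le x; omega
  have hnself : (μ.heap.push (E.idx y) (d + μ.bound (E.idx y))).node (E.idx y) =
      μ.heap.fresh + 1 := by simp [HeapMem.push]
  have hnne : ∀ x, X.IsLabel x → x ≠ y →
      (μ.heap.push (E.idx y) (d + μ.bound (E.idx y))).node (E.idx x) = μ.heap.node (E.idx x) := by
    intro x hx hxy
    simp [HeapMem.push, Function.update_of_ne (hne x hx hxy)]
  rw [State.relax_of ⟨hd, hP⟩]
  refine ⟨φ', ⟨hi, hr, ?_, h.perm, ?_, ?_, ?_, ?_, ?_, ?_, ?_⟩, hh⟩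
  · intro x hx
    by_cases hxy : x = y
    · subst hxy
      simp [Mem.improve, hnself]
    · simp only [Mem.improve, hnne x hx hxy, Function.update_of_ne hxy,
        Function.update_of_ne (hne x hx hxy)]
      exact h.l x hx
  · intro x hx
    by_cases hxy : x = y
    · subst hxy
      simp [Mem.improve, hnself, hp1]
    · simp only [Mem.improve, hnne x hx hxy, Set.mem_insert_iff, hxy, false_or]
      exact h.cand x hx
  · rintro x (rfl | hx)
    · exact hy
    · exact h.cand_label x hx
  · intro x hx hn
    by_cases hxy : x = y
    · subst hxy
      exact hdata
    · simp only [Mem.improve, hnne x hx hxy] at hn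
      exact h.data x hx hn
  · intro x hx
    by_cases hxy : x = y
    · subst hxy
      simpa [Mem.improve] using hB
    · simp only [Mem.improve, Function.update_of_ne hxy, Function.update_of_ne (hne x hx hxy)]
      exact h.back x hx
  · intro v hv
    rw [ha, Finset.mem_insert] at hv
    rcases hv with rfl | hv
    · exact ⟨y, hy, by simp [Mem.improve, HeapMem.push], by simp [Mem.improve, HeapMem.push]⟩
    · obtain ⟨x, hx, h1, h2⟩ := h.item v hv
      have hvn : v ≠ μ.heap.fresh + 1 := by have := h.heap.pos v hv; omega
      refine ⟨x, hx, by simp [Mem.improve, HeapMem.push, Function.update_of_ne hvn, h1], ?_⟩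
      by_cases hxy : x = y
      · subst hxy; simp [Mem.improve, hnself]
      · simpa [Mem.improve, hnne x hx hxy] using h2
  · intro x hx hn hp
    rw [ha]
    by_cases hxy : x = y
    · subst hxy
      simp [Mem.improve, HeapMem.push]
    · simp only [Mem.improve, hnne x hx hxy, Function.update_of_ne (hne x hx hxy)] at hn hp ⊢
      obtain ⟨h1, h2⟩ := h.live x hx hn hp
      refine ⟨Finset.mem_insert_of_mem h1, ?_⟩
      rw [← h2]
      simp [HeapMem.push, Function.update_of_ne (hnode _)]
  · intro x hx hp
    rw [ha]
    have hxy : x ≠ y := by rintro rfl; exact hp1 hp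
    simp only [Mem.improve, hnne x hx hxy]
    rw [Finset.mem_insert, not_or]
    exact ⟨hnode _, h.dead x hx hp⟩

end Rel

/-! ### The program: decreasing the cost of a label -/

local infixr:60 " ;; " => Prog.seq
local notation:max "§" x:max => NExp.var x
local notation:max "¢" a:max => NExp.const a

/-- Sets the cost of the label in register `12` and updates the heap. -/
def pushProg : Prog :=
  .rput 1 §12 (.var 0) ;; .nput 16 §12 §15 ;; .nput 17 §12 §16 ;; .nput 18 §12 §17 ;;
  .nset 18 (.get 12 §12) ;; .nset 9 (.add §9 ¢1) ;;
  .nput 19 §9 (.get 20 (.get 20 (.get 19 §18))) ;;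
  .nput 21 §9 (.sub (.get 21 §18) ¢2) ;;
  .nput 22 §9 §12 ;; .rput 3 §9 (.add (.var 0) (.get 2 §12)) ;;
  .nput 12 §12 §9 ;; .nput 23 §10 §9 ;; .nset 10 (.add §10 ¢1)

/-- Compares real register `0` with the cost of the label in register `12`, whose vertex and set
are in registers `13` and `14`, and updates the label with the data in registers `15` to `17`. -/
def relaxProg : Prog :=
  .ite (.neq (.get 13 §12) ¢1) .skip
    (.ite (.neq (.get 12 §12) ¢0)
      (.ask 1 §13 (.sub (.sub §5 ¢1) §14) ;; .rput 2 §12 (.var 1) ;; .nput 14 §12 §13 ;;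
        .nput 15 §12 §14 ;; pushProg)
      (.ite (.rlt (.var 0) (.get 1 §12)) pushProg .skip))

/-- The part of the store that represents the heap. -/
def heapOf (s : Store) : HeapMem :=
  ⟨s.na 19, s.na 20, s.na 21, s.na 22, s.na 12, s.ra 3, s.nv 9⟩

/-- The stack of roots. -/
def stackOf (s : Store) : List ℕ := (List.range (s.nv 10)).map (s.na 23)

/-- The part of the store that represents the variables of the algorithm. -/
def memOf (s : Store) : Mem :=
  ⟨heapOf s, stackOf s, s.na 13, s.na 14, s.na 15, s.na 16, s.na 17, s.na 18, s.ra 1, s.ra 2⟩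

theorem map_range_succ_update (a : ℕ → ℕ) (n v : ℕ) :
    (List.range (n + 1)).map (Function.update a n v) = (List.range n).map a ++ [v] := by
  rw [List.range_succ, List.map_append]
  congr 1
  · refine List.map_congr_left fun i hi => ?_
    rw [List.mem_range] at hi
    rw [Function.update_of_ne (by omega)]
  · simp

section Relax

variable {O : Oracle} {s : Store} {c : ℕ}

theorem W_push (hc : 100 ≤ c) :
    W O pushProg (fun s' c' => c ≤ c' + 100 ∧
      memOf s' = (memOf s).improve (s.nv 12) (s.rv 0) (s.nv 15) (s.nv 16) (s.nv 17)) s c := by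
  simp only [pushProg, W_seq, W_nset, W_nput, W_rput]
  simp
  refine ⟨?_, ?_, ?_, ?_, ?_, ?_, ?_, ?_, ?_, ?_, ?_, ?_, ?_, ?_, ?_⟩
  all_goals first | omega | skip
  simp [memOf, heapOf, stackOf, Mem.improve, HeapMem.push, map_range_succ_update]

variable {V : Type*} [Fintype V] [DecidableEq V] {X : SteinerInstance V} {E : Encoding X}
  {L : V → Finset V → ℝ} {st : State V} {φ : Forest} {y : Label V} {f : ℕ}

/-- The credit that is stored in the data structures. -/
noncomputable def potential (X : SteinerInstance V) (f : ℕ) (μ : Mem) (st : State V)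
    (φ : Forest) : ℕ :=
  300 * μ.stack.length + 500 * μ.heap.hollow φ + (f + 100) * X.untouched st

theorem SteinerInstance.IsLabel.sdiff (hy : X.IsLabel y) :
    X.terminals \ y.2 ⊆ X.terminals ∧ X.root ∈ X.terminals \ y.2 := by
  refine ⟨Finset.sdiff_subset, Finset.mem_sdiff.2 ⟨X.root_mem, fun h => ?_⟩⟩
  have := hy.1 h
  simp [SteinerInstance.sources] at this

/-- Of the 1000 units, 300 go to the new node on the stack and 500 to the node that may become
hollow; the rest covers the tests and `pushProg`. The number `r` is credit that passes through for
later use. -/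
theorem W_relax {B : Set (Label V)} {r : ℕ} (hO : E.Evaluates O L f) (hpw : s.nv 5 = 2 ^ X.k)
    (h : E.Rel L (memOf s) st φ) (hy : X.IsLabel y) (h12 : s.nv 12 = E.idx y)
    (h13 : s.nv 13 = E.vertex y.1) (h14 : s.nv 14 = E.mask y.2)
    (hB : E.BackCode (s.nv 15) (s.nv 16) (s.nv 17) y B)
    (hc : potential X f (memOf s) st φ + 1000 + r ≤ c) :
    W O relaxProg (fun s' c' => ∃ φ',
      E.Rel L (memOf s') (st.relax y (s.rv 0 : ℝ) B) φ' ∧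
      s'.nv 9 ≤ s.nv 9 + 1 ∧
      potential X f (memOf s') (st.relax y (s.rv 0 : ℝ) B) φ' + r ≤ c') s c := by
  have himp : ∀ (s' : Store) (φ' : Forest) (d : ℝ) (t q₁ q₂ : ℕ) (μ : Mem),
      memOf s' = μ.improve (E.idx y) d t q₁ q₂ → μ.heap.fresh = s.nv 9 → s'.nv 9 = s.nv 9 + 1 := by
    intro s' φ' d t q₁ q₂ μ h1 h2
    have := congrArg (fun μ => μ.heap.fresh) h1
    simpa [memOf, heapOf, Mem.improve, HeapMem.push, h2] using this
  rw [relaxProg, W_ite]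
  simp only [Test.cost, NExp.cost, Test.eval, NExp.eval, h12]
  refine ⟨by omega, fun hp => ?_, fun hp => ?_⟩
  · rw [W_skip, State.relax_of_not (fun h' => h'.2 ((h.perm y hy).2 hp))]
    exact ⟨by omega, φ, h, by omega, by omega⟩
  have hP : y ∉ st.P := fun h' => hp ((h.perm y hy).1 h')
  rw [W_ite]
  simp only [Test.cost, NExp.cost, Test.eval, NExp.eval, h12]
  refine ⟨by omega, fun hn => ?_, fun hn => ?_⟩
  · have htop : st.l y = ⊤ := (h.l_eq_top hy).2 hn
    have hd : ((s.rv 0 : ℝ) : WithTop ℝ) < st.l y := by rw [htop]; exact WithTop.coe_lt_top _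
    obtain ⟨hv, ht⟩ := hO y.1 (X.terminals \ y.2) hy.sdiff.1 hy.sdiff.2
    have hm : E.mask (X.terminals \ y.2) = 2 ^ X.k - 1 - E.mask y.2 := by
      rw [E.mask_sdiff hy.subset]
      have := E.mask_terminals
      omega
    have hun := SteinerInstance.untouched_update (st := st) (st.relax y (s.rv 0 : ℝ) B) hy
      (d := (s.rv 0 : ℝ)) WithTop.coe_ne_top (by rw [State.relax_of ⟨hd, hP⟩])
    rw [if_pos htop] at hun
    -- The label is touched for the first time: `f` of the released units pay for the oracle, 100
    -- for storing its answer and the data of the label.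
    have hmul : (f + 100) * X.untouched st =
        (f + 100) * X.untouched (st.relax y (s.rv 0 : ℝ) B) + (f + 100) := by
      rw [← hun]; ring
    unfold potential at hc
    simp only [W_seq, W_ask, W_rput, W_nput]
    simp only [NExp.eval, NExp.cost, RExp.eval, RExp.cost, setR_nv, setR_rv, putR_nv, putN_nv,
      h12, h13, h14, hpw]
    rw [← hm, hv, if_true]
    refine ⟨by omega, by omega, by omega, by omega, ?_⟩
    refine (W_push (by omega)).mono ?_
    rintro s' c' ⟨hc', hmem⟩
    have ht2 := h.touch hy htop (E.vertex y.1) (E.mask y.2) (L y.1 (X.terminals \ y.2))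
    obtain ⟨φ', hr, hh⟩ := ht2.improve hy hB hd hP (by simp [Mem.touch])
    simp only [putN_nv, putR_nv, setR_nv, putN_rv, putR_rv, setR_rv, h12] at hmem
    have hmem' : memOf s' = ((memOf s).touch (E.idx y) (E.vertex y.1) (E.mask y.2)
        (L y.1 (X.terminals \ y.2))).improve (E.idx y) (s.rv 0) (s.nv 15) (s.nv 16) (s.nv 17) := by
      rw [hmem]
      simp [memOf, heapOf, stackOf, Mem.touch]
    rw [← hmem'] at hr hh
    refine ⟨φ', hr, (himp s' φ' _ _ _ _ _ hmem' rfl).le, ?_⟩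
    have hlen : (memOf s').stack.length = (memOf s).stack.length + 1 := by
      rw [hmem']; simp [Mem.improve, Mem.touch]
    have hh' : (memOf s').heap.hollow φ' ≤ (memOf s).heap.hollow φ + 1 := hh
    unfold potential
    rw [hlen]
    omega
  · have hfin : st.l y ≠ ⊤ := fun h' => hn ((h.l_eq_top hy).1 h')
    have hl := h.l_of_ne hy hfin
    have hcost : (memOf s).cost (E.idx y) = s.ra 1 (E.idx y) := rfl
    rw [W_ite]
    simp only [Test.cost, NExp.cost, RExp.cost, Test.eval, RExp.eval, NExp.eval, h12]
    refine ⟨by omega, fun hd => ?_, fun hd => ?_⟩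
    · have hd' : ((s.rv 0 : ℝ) : WithTop ℝ) < st.l y := by
        rw [hl, WithTop.coe_lt_coe, hcost]; exact hd
      have hun := SteinerInstance.untouched_update (st := st) (st.relax y (s.rv 0 : ℝ) B) hy
        (d := (s.rv 0 : ℝ)) WithTop.coe_ne_top (by rw [State.relax_of ⟨hd', hP⟩])
      rw [if_neg hfin, add_zero] at hun
      refine (W_push (by omega)).mono ?_
      rintro s' c' ⟨hc', hmem⟩
      rw [h12] at hmem
      obtain ⟨φ', hr, hh⟩ := h.improve hy hB hd' hP (h.data y hy hn)
      rw [← hmem] at hr hh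
      refine ⟨φ', hr, (himp s' φ' _ _ _ _ _ hmem rfl).le, ?_⟩
      have hlen : (memOf s').stack.length = (memOf s).stack.length + 1 := by
        rw [hmem]; simp [Mem.improve]
      unfold potential at hc ⊢
      rw [hlen, hun]
      omega
    · rw [W_skip, State.relax_of_not]
      · exact ⟨by omega, φ, h, by omega, by omega⟩
      · rintro ⟨h', -⟩
        rw [hl, WithTop.coe_lt_coe, hcost] at h'
        exact hd h'

end Relax

/-! ### The program: extracting the minimum -/

/-- Makes the root in register `w` a child of the root in register `u`, which is pushed. -/
def linkProg (u w : ℕ) : Prog :=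
  .nput 20 §w (.get 19 §u) ;; .nput 19 §u §w ;; .nput 21 §u (.add (.get 21 §u) ¢1) ;;
  .nput 23 §10 §u ;; .nset 10 (.add §10 ¢1)

/-- Processes the full root in register `19`. -/
def settleProg : Prog :=
  .nset 21 (.get 21 §19) ;; .nset 20 (.get 24 §21) ;;
  .ite (.neq §20 ¢0)
    (.nput 24 §21 §19 ;; .ite (.nlt §11 §21) (.nset 11 §21) .skip)
    (.nput 24 §21 ¢0 ;;
      .ite (.rlt (.get 3 §20) (.get 3 §19)) (linkProg 20 19) (linkProg 19 20))

/-- Destroys the hollow root in register `19`. -/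
def destroyProg : Prog :=
  .ite (.nlt ¢0 (.get 21 §19))
    (.nput 23 §10 (.get 19 §19) ;; .nset 10 (.add §10 ¢1) ;;
      .ite (.nlt ¢1 (.get 21 §19))
        (.nput 23 §10 (.get 20 (.get 19 §19)) ;; .nset 10 (.add §10 ¢1)) .skip)
    .skip

/-- Empties the stack and leaves full roots of distinct ranks in the buckets. -/
def consolidateProg : Prog :=
  .loop (.nlt ¢0 §10)
    (.nset 10 (.sub §10 ¢1) ;; .nset 19 (.get 23 §10) ;;
      .ite (.neq (.get 12 (.get 22 §19)) §19) settleProg destroyProg)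

/-- `bl` lists the nodes in the buckets, all of which are full and of rank at most `M`. -/
structure Buckets (μ : HeapMem) (bucket : ℕ → ℕ) (bl : List ℕ) (M : ℕ) : Prop where
  mem : ∀ r, bucket r ≠ 0 → bucket r ∈ bl ∧ μ.rank (bucket r) = r
  eq : ∀ w ∈ bl, bucket (μ.rank w) = w ∧ μ.Full w ∧ μ.rank w ≤ M

section Extract

variable {O : Oracle} {s : Store} {c : ℕ} {φ : Forest} {G r : ℕ}

/-- The loop invariant of `consolidateProg`. -/
def ConsolidateInv (s₀ : Store) (φ₀ : Forest) (G r : ℕ) (s : Store) (c : ℕ) : Prop :=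
  ∃ φ bl, (heapOf s).Inv φ ∧ HeapMem.Roots φ (stackOf s ++ bl) ∧
    Buckets (heapOf s) (s.na 24) bl (s.nv 11) ∧ φ.alive ⊆ φ₀.alive ∧
    (∀ v ∈ φ₀.alive, (heapOf s₀).Full v → v ∈ φ.alive) ∧ s.nv 11 ≤ G ∧
    300 * (stackOf s).length + 150 * bl.length + 500 * (heapOf s).hollow φ + 10 + r ≤ c

theorem stackOf_pop (h : 0 < s.nv 10) :
    stackOf s = (List.range (s.nv 10 - 1)).map (s.na 23) ++ [s.na 23 (s.nv 10 - 1)] := by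
  obtain ⟨p, hp⟩ : ∃ p, s.nv 10 = p + 1 := ⟨s.nv 10 - 1, by omega⟩
  simp [stackOf, hp, List.range_succ]

theorem HeapMem.Full.congr {s' : Store} (h1 : s'.na 12 = s.na 12) (h2 : s'.na 22 = s.na 22)
    (v : ℕ) : (heapOf s').Full v ↔ (heapOf s).Full v := by
  simp [HeapMem.Full, heapOf, h1, h2]

/-- Symbolic execution of `linkProg`. -/
theorem W_link {u w : ℕ} {Q : Store → ℕ → Prop} (hu : u ≠ 10) (hw : w ≠ 10) (hc : 40 ≤ c)
    (hQ : ∀ s' c', c ≤ c' + 40 → heapOf s' = (heapOf s).link (s.nv u) (s.nv w) →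
      stackOf s' = stackOf s ++ [s.nv u] → s'.na 24 = s.na 24 → s'.nv 11 = s.nv 11 → Q s' c') :
    W O (linkProg u w) Q s c := by
  simp only [linkProg, W_seq, W_nset, W_nput]
  simp
  refine ⟨?_, ?_, ?_, ?_, ?_, ?_⟩
  all_goals first | omega | skip
  apply hQ
  · omega
  · simp [heapOf, HeapMem.link]
  · simp [stackOf, map_range_succ_update]
  · simp
  · simp

/-- When `w` is taken from its bucket to be linked with `u`, the link may raise the rank of either
of them. Neither remains in a bucket, so the other entries stay correct. -/
theorem Buckets.erase {μ μ' : HeapMem} {bucket : ℕ → ℕ} {bl : List ℕ} {M w u : ℕ}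
    (h : Buckets μ bucket bl M) (hn : (u :: bl).Nodup) (hw : w ∈ bl) (hw0 : w ≠ 0)
    (hrank : ∀ v, v ≠ u → v ≠ w → μ'.rank v = μ.rank v) (hf : ∀ v, μ.Full v → μ'.Full v)
    (hu : u ≠ 0) :
    Buckets μ' (Function.update bucket (μ.rank w) 0) (bl.erase w) M := by
  have hnd := (List.nodup_cons.1 hn).2
  have hub := (List.nodup_cons.1 hn).1
  refine ⟨?_, ?_⟩
  · intro r hr
    rw [Function.update_apply] at hr ⊢
    split_ifs at hr ⊢ with hrw
    · exact absurd rfl hr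
    · obtain ⟨h1, h2⟩ := h.mem r hr
      have h3 : bucket r ≠ w := by rintro rfl; exact hrw h2.symm
      have h4 : bucket r ≠ u := fun e => hub (e ▸ h1)
      exact ⟨(List.mem_erase_of_ne h3).2 h1, by rw [hrank _ h4 h3, h2]⟩
  · intro v hv
    have hv' := hnd.mem_erase_iff.1 hv
    have hvu : v ≠ u := fun e => hub (e ▸ hv'.2)
    obtain ⟨h1, h2, h3⟩ := h.eq v hv'.2
    rw [hrank v hvu hv'.1]
    refine ⟨?_, hf v h2, h3⟩
    rw [Function.update_of_ne, h1]
    intro e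
    rw [e, (h.eq w hw).1] at h1
    exact hv'.1 h1.symm

theorem Buckets.cons {μ : HeapMem} {bucket : ℕ → ℕ} {bl : List ℕ} {M M' u : ℕ}
    (h : Buckets μ bucket bl M) (hu : μ.Full u) (hb : bucket (μ.rank u) = 0) (h0 : 0 ∉ bl)
    (hM : M ≤ M') (hu' : μ.rank u ≤ M') :
    Buckets μ (Function.update bucket (μ.rank u) u) (u :: bl) M' := by
  refine ⟨?_, ?_⟩
  · intro r hr
    rw [Function.update_apply] at hr ⊢
    split_ifs at hr ⊢ with hru
    · exact ⟨by simp, hru.symm⟩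
    · obtain ⟨h1, h2⟩ := h.mem r hr
      exact ⟨List.mem_cons_of_mem _ h1, h2⟩
  · intro v hv
    rcases List.mem_cons.1 hv with rfl | hv
    · exact ⟨by simp, hu, hu'⟩
    · obtain ⟨h1, h2, h3⟩ := h.eq v hv
      refine ⟨?_, h2, h3.trans hM⟩
      rw [Function.update_of_ne, h1]
      intro e
      rw [e, hb] at h1
      exact h0 (h1 ▸ hv)

theorem perm_middle (l : List ℕ) (a : ℕ) (l' : List ℕ) :
    (l ++ [a] ++ l').Perm (a :: (l ++ l')) := by
  simp

/-- The popped root carries 300 units. If its bucket is free, 150 stay with it there and 150 pay for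
the work. Otherwise the occupant adds 150, the winner of the link takes 300 back to the stack, and
150 are left. The logarithm enters only through `hG`, which turns the size bound for roots into the
rank bound `G`. -/
theorem W_settle {s₀ : Store} {φ₀ : Forest} {bl : List ℕ}
    (hG : ∀ k, 2 ^ (k / 2) ≤ s.nv 9 → k ≤ G)
    (hi : (heapOf s).Inv φ) (hr : HeapMem.Roots φ (stackOf s ++ [s.nv 19] ++ bl))
    (hb : Buckets (heapOf s) (s.na 24) bl (s.nv 11)) (ha : φ.alive ⊆ φ₀.alive)
    (hfull : ∀ v ∈ φ₀.alive, (heapOf s₀).Full v → v ∈ φ.alive) (hM : s.nv 11 ≤ G)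
    (hf : (heapOf s).Full (s.nv 19))
    (hc : 300 * (stackOf s).length + 300 + 150 * bl.length + 500 * (heapOf s).hollow φ + r ≤ c + 20) :
    W O settleProg (ConsolidateInv s₀ φ₀ G r) s c := by
  set u := s.nv 19 with hu
  have hrp := hr.perm (perm_middle _ _ _)
  have hur := (hrp.2 u).1 (by simp)
  have hu0 : u ≠ 0 := by have := hi.pos u hur.1; omega
  have h0bl : 0 ∉ bl := fun h => by
    have := (hrp.2 0).1 (by simp [h])
    have := (hi.pos 0 this.1).1
    omega
  have hrankG : (heapOf s).rank u ≤ G := hG _ (hi.two_pow_rank_le hur.1 hur.2)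
  have hrk : (heapOf s).rank u = s.na 21 u := rfl
  simp only [settleProg, W_seq, W_nset]
  simp only [NExp.cost, NExp.eval, setN_nv, setN_na, if_true, ← hu]
  refine ⟨by omega, by omega, ?_⟩
  simp only [W_ite, W_seq, W_nput]
  simp
  simp only [← hu]
  refine ⟨by omega, fun hw => ⟨by omega, by omega, fun hlt => ?_, fun hlt => ?_⟩,
    fun hw => ⟨by omega, by omega, fun hlt => ?_, fun hlt => ?_⟩⟩
  · rw [W_nset]
    simp only [NExp.cost]
    refine ⟨by omega, φ, u :: bl, hi, ?_, ?_, ha, hfull, ?_, ?_⟩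
    · refine hr.perm ?_
      simp [stackOf]
    · simp
      rw [← hrk] at hlt hw ⊢
      exact hb.cons hf hw h0bl hlt.le le_rfl
    · simp
      rw [← hrk]
      exact hrankG
    · simp [stackOf, heapOf] at hc ⊢
      omega
  · rw [W_skip]
    refine ⟨by omega, φ, u :: bl, hi, ?_, ?_, ha, hfull, ?_, ?_⟩
    · refine hr.perm ?_
      simp [stackOf]
    · simp
      rw [← hrk] at hlt hw ⊢
      exact hb.cons hf hw h0bl le_rfl hlt
    · simpa using hM
    · simp [stackOf, heapOf] at hc ⊢
      omega
  -- In the two remaining cases the bucket holds a full root `w` of the same rank, and the cases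
  -- differ only in which of `u` and `w` has the smaller key.
  all_goals
    set w := s.na 24 (s.na 21 u) with hwdef
    obtain ⟨hwb, hwr⟩ := hb.mem _ hw
    have hwr' : s.na 21 w = s.na 21 u := hwr
    have hnd := hrp.1
    have hwu : w ≠ u := by
      rintro e
      rw [List.nodup_cons] at hnd
      exact hnd.1 (by rw [← e]; exact List.mem_append_right _ hwb)
    have hblp : bl.Perm (w :: bl.erase w) := List.perm_cons_erase hwb
    have hlen : bl.length = (bl.erase w).length + 1 := by rw [hblp.length_eq]; rfl
    have hndu : (u :: bl).Nodup := hnd.sublist (by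
      refine List.Sublist.cons_cons _ ?_
      exact List.sublist_append_right _ _)
    have hwf := (hb.eq w hwb).2.1
  · have hp : (stackOf s ++ [u] ++ bl).Perm (u :: w :: (stackOf s ++ bl.erase w)) := by
      refine (perm_middle _ _ _).trans (List.Perm.cons _ ?_)
      refine (List.Perm.append_left _ hblp).trans ?_
      simp
    obtain ⟨φ', h1, h2, h3, h4⟩ := hi.link (hr.perm hp) hwf hwr'.symm hlt.le
    refine W_link (by decide) (by decide) (by omega) ?_
    intro s' c' hc' hh hs hbk hm
    have hhs : heapOf (((s.setN 21 (s.na 21 u)).setN 20 w).putN 24 (s.na 21 u) 0) = heapOf s := by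
      simp [heapOf]
    have hss : stackOf (((s.setN 21 (s.na 21 u)).setN 20 w).putN 24 (s.na 21 u) 0) = stackOf s := by
      simp [stackOf]
    rw [hhs] at hh
    rw [hss] at hs
    simp [← hu] at hh hs hbk hm
    refine ⟨φ', bl.erase w, ?_, ?_, ?_, ?_, ?_, ?_, ?_⟩
    · rw [hh]; exact h2
    · rw [hs]; exact h3.perm (by simpa using List.perm_middle.symm)
    · rw [hbk, hm, ← hwr', hh]
      refine hb.erase hndu hwb hw ?_ (fun _ h => h) hu0
      intro v _ hv
      simp [HeapMem.link, Function.update_of_ne hv]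
    · rw [h1]; exact ha
    · rw [h1]; exact hfull
    · rw [hm]; exact hM
    · rw [hs, hh, h4]
      simp
      omega
  · have hp : (stackOf s ++ [u] ++ bl).Perm (w :: u :: (stackOf s ++ bl.erase w)) := by
      refine (perm_middle _ _ _).trans (List.Perm.trans (List.Perm.cons _ ?_) (List.Perm.swap _ _ _))
      refine (List.Perm.append_left _ hblp).trans ?_
      simp
    obtain ⟨φ', h1, h2, h3, h4⟩ := hi.link (hr.perm hp) hf hwr' hlt
    refine W_link (by decide) (by decide) (by omega) ?_
    intro s' c' hc' hh hs hbk hm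
    have hhs : heapOf (((s.setN 21 (s.na 21 u)).setN 20 w).putN 24 (s.na 21 u) 0) = heapOf s := by
      simp [heapOf]
    have hss : stackOf (((s.setN 21 (s.na 21 u)).setN 20 w).putN 24 (s.na 21 u) 0) = stackOf s := by
      simp [stackOf]
    rw [hhs] at hh
    rw [hss] at hs
    simp [← hu] at hh hs hbk hm
    refine ⟨φ', bl.erase w, ?_, ?_, ?_, ?_, ?_, ?_, ?_⟩
    · rw [hh]; exact h2
    · rw [hs]; exact h3.perm (by simpa using List.perm_middle.symm)
    · rw [hbk, hm, ← hwr', hh]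
      refine hb.erase hndu hwb hw ?_ (fun _ h => h) hu0
      intro v hv _
      simp [HeapMem.link, Function.update_of_ne hv]
    · rw [h1]; exact ha
    · rw [h1]; exact hfull
    · rw [hm]; exact hM
    · rw [hs, hh, h4]
      simp
      omega

/-- A hollow node has at most two children. Its 300 units as a stack entry and its 500 units as a
hollow node cover 600 for the children and the actual work. -/
theorem W_destroy {s₀ : Store} {φ₀ : Forest} {bl : List ℕ}
    (hi : (heapOf s).Inv φ) (hr : HeapMem.Roots φ (stackOf s ++ [s.nv 19] ++ bl))
    (hb : Buckets (heapOf s) (s.na 24) bl (s.nv 11)) (ha : φ.alive ⊆ φ₀.alive)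
    (hs₀ : ∀ v, (heapOf s).Full v ↔ (heapOf s₀).Full v)
    (hfull : ∀ v ∈ φ₀.alive, (heapOf s₀).Full v → v ∈ φ.alive) (hM : s.nv 11 ≤ G)
    (hf : ¬ (heapOf s).Full (s.nv 19))
    (hc : 300 * (stackOf s).length + 300 + 150 * bl.length + 500 * (heapOf s).hollow φ + r ≤ c + 20) :
    W O destroyProg (ConsolidateInv s₀ φ₀ G r) s c := by
  set u := s.nv 19 with hu
  have hrp := hr.perm (perm_middle _ _ _)
  have hur := (hrp.2 u).1 (by simp)
  obtain ⟨φ', h1, h2, h3, h4⟩ := hi.remove hrp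
  rw [if_neg hf] at h4
  have hlen := hi.kids_length_hollow hur.1 hf
  have hlnk := hi.linked u hur.1
  have halive : φ'.alive ⊆ φ₀.alive := by
    rw [h1]; exact (Finset.erase_subset _ _).trans ha
  have hfull' : ∀ v ∈ φ₀.alive, (heapOf s₀).Full v → v ∈ φ'.alive := by
    intro v hv hvf
    rw [h1]
    refine Finset.mem_erase.2 ⟨?_, hfull v hv hvf⟩
    rintro rfl
    exact hf ((hs₀ _).2 hvf)
  have hrk : (heapOf s).rank u = s.na 21 u := rfl
  have hch : (heapOf s).child u = s.na 19 u := rfl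
  have hnx : (heapOf s).next = s.na 20 := rfl
  rw [hrk] at hlen
  rw [hch, hnx] at hlnk
  simp only [destroyProg, W_seq, W_ite, W_skip, W_nput, W_nset]
  simp
  simp only [← hu]
  refine ⟨by omega, fun hpos => ⟨by omega, by omega, by omega, fun h1lt => ⟨by omega, by omega, ?_⟩,
    fun h1lt => ⟨by omega, ?_⟩⟩, fun hpos => ⟨by omega, ?_⟩⟩
  · rw [min_eq_left (by omega)] at hlen
    obtain ⟨a, b, hk⟩ := List.length_eq_two.1 hlen
    rw [hk] at hlnk h3
    obtain ⟨rfl, rfl, -⟩ := hlnk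
    refine ⟨φ', bl, h2, ?_, ⟨hb.mem, hb.eq⟩, halive, hfull', hM, ?_⟩
    · refine h3.perm ?_
      simpa [stackOf, map_range_succ_update] using List.perm_append_comm_assoc
        [s.na 19 u, s.na 20 (s.na 19 u)] ((List.range (s.nv 10)).map (s.na 23)) bl
    · simp [stackOf, heapOf] at hc h4 ⊢
      omega
  · have h21 : s.na 21 u = 1 := by omega
    rw [h21] at hlen
    obtain ⟨a, hk⟩ := List.length_eq_one_iff.1 (by simpa using hlen)
    rw [hk] at hlnk h3
    obtain ⟨rfl, -⟩ := hlnk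
    refine ⟨φ', bl, h2, ?_, ⟨hb.mem, hb.eq⟩, halive, hfull', hM, ?_⟩
    · refine h3.perm ?_
      simpa [stackOf, map_range_succ_update] using List.perm_append_comm_assoc
        [s.na 19 u] ((List.range (s.nv 10)).map (s.na 23)) bl
    · simp [stackOf, heapOf] at hc h4 ⊢
      omega
  · rw [hpos] at hlen
    have hk := List.length_eq_zero_iff.1 (by simpa using hlen)
    rw [hk] at h3
    refine ⟨φ', bl, h2, h3, hb, halive, hfull', hM, ?_⟩
    simp [stackOf, heapOf] at hc h4 ⊢
    omega

/-- There is no bound on the number of passes other than the credit: each pass is paid for by the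
node that it pops. Afterwards all roots are in the buckets and hence full. -/
theorem W_consolidate (hG : ∀ k, 2 ^ (k / 2) ≤ s.nv 9 → k ≤ G) (hi : (heapOf s).Inv φ)
    (hr : HeapMem.Roots φ (stackOf s)) (hb : ∀ r, s.na 24 r = 0) (hM : s.nv 11 ≤ G)
    (hc : 300 * (stackOf s).length + 500 * (heapOf s).hollow φ + 10 + r ≤ c) :
    W O consolidateProg (fun s' c' => s'.nv 10 = 0 ∧ ConsolidateInv s φ G r s' (c' + 10)) s c := by
  refine W_loop (ConsolidateInv s φ G r) ?_ ?_ ?_ ?_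
  · refine ⟨φ, [], hi, by simpa using hr, ⟨fun r h => absurd (hb r) h, by simp⟩, subset_rfl,
      fun v hv _ => hv, hM, by simpa using hc⟩
  · rintro s' c' - ⟨φ', bl, -, -, -, -, -, -, h⟩
    simp
    omega
  · rintro s' c' hF ⟨φ', bl, h1, h2, h3, h4, h5, h6, h7⟩ hpos
    simp at hpos
    rw [stackOf_pop hpos] at h2 h7
    simp at h7
    have h9 : s'.nv 9 = s.nv 9 := hF.nv 9 (by decide)
    have h12 : s'.na 12 = s.na 12 := hF.na 12 (by decide)
    have h22 : s'.na 22 = s.na 22 := hF.na 22 (by decide)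
    simp only [W_seq, W_nset, W_ite]
    simp
    refine ⟨by omega, by omega, by omega, fun hf => ?_, fun hf => ?_⟩
    · refine W_settle (φ := φ') (bl := bl) ?_ h1 ?_ ?_ h4 h5 ?_ ?_ ?_
      · simpa [h9] using hG
      · simpa [stackOf] using h2
      · exact ⟨by simpa [heapOf] using h3.mem, by simpa [heapOf, HeapMem.Full] using h3.eq⟩
      · simpa using h6
      · simpa [HeapMem.Full, heapOf] using hf
      · simp [stackOf, heapOf] at h7 ⊢
        omega
    · refine W_destroy (φ := φ') (bl := bl) h1 ?_ ?_ h4 ?_ h5 ?_ ?_ ?_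
      · simpa [stackOf] using h2
      · exact ⟨by simpa [heapOf] using h3.mem, by simpa [heapOf, HeapMem.Full] using h3.eq⟩
      · exact HeapMem.Full.congr h12 h22
      · simpa using h6
      · simpa [HeapMem.Full, heapOf] using hf
      · simp [stackOf, heapOf] at h7 ⊢
        omega
  · rintro s' c' - ⟨φ', bl, h1, h2, h3, h4, h5, h6, h7⟩ h0
    simp at h0
    refine ⟨h0, φ', bl, h1, h2, h3, h4, h5, h6, ?_⟩
    simp
    omega

end Extract

/-! ### Selecting the root of minimum key and recording its label. -/

/-- Moves the root of minimum key from the buckets to register `22` and the other roots from the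
buckets to the stack. -/
def scanProg : Prog :=
  .nset 22 ¢0 ;; .nset 21 ¢0 ;;
  .loop (.nlt §21 (.add §11 ¢1))
    (.nset 20 (.get 24 §21) ;;
      .ite (.neq §20 ¢0) .skip
        (.nput 24 §21 ¢0 ;;
          .ite (.neq §22 ¢0) (.nset 22 §20)
            (.ite (.rlt (.get 3 §20) (.get 3 §22))
              (.nput 23 §10 §22 ;; .nset 10 (.add §10 ¢1) ;; .nset 22 §20)
              (.nput 23 §10 §20 ;; .nset 10 (.add §10 ¢1)))) ;;
      .nset 21 (.add §21 ¢1))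

/-- Pushes the children of the full node in register `22`. -/
def pushKidsProg : Prog :=
  .nset 19 (.get 19 §22) ;; .nset 21 (.get 21 §22) ;;
  .loop (.nlt ¢0 §21)
    (.nput 23 §10 §19 ;; .nset 10 (.add §10 ¢1) ;; .nset 19 (.get 20 §19) ;;
      .nset 21 (.sub §21 ¢1))

/-- Removes the node of minimum key, which is left in register `22`. -/
def extractHeapProg : Prog := consolidateProg ;; scanProg ;; pushKidsProg

/-- Makes the item of the node in register `22` permanent and records it; its number, vertex and set
are left in registers `23` to `25`. -/
def recordProg : Prog :=
  .nset 23 (.get 22 §22) ;; .nput 13 §23 ¢1 ;; .nset 24 (.get 14 §23) ;; .nset 25 (.get 15 §23) ;;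
  .nput 4 §4 §24 ;; .nput 5 §4 §25 ;; .nset 4 (.add §4 ¢1)

/-- Selects the label of minimum key. -/
def extractProg : Prog := extractHeapProg ;; recordProg

section Extract

variable {O : Oracle} {s : Store} {c : ℕ} {φ : Forest} {G r : ℕ}

/-- The list of the node in a register, if it is not `0`. -/
def optNode (v : ℕ) : List ℕ := if v = 0 then [] else [v]

/-- The loop invariant of `scanProg`. -/
def ScanInv (μ : HeapMem) (φ : Forest) (r : ℕ) (s : Store) (c : ℕ) : Prop :=
  ∃ bl, HeapMem.Roots φ (stackOf s ++ optNode (s.nv 22) ++ bl) ∧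
    Buckets μ (s.na 24) bl (s.nv 11) ∧ (∀ r < s.nv 21, s.na 24 r = 0) ∧
    (∀ v ∈ stackOf s, s.nv 22 ≠ 0 ∧ μ.key (s.nv 22) ≤ μ.key v) ∧
    (s.nv 22 ≠ 0 → μ.Full (s.nv 22)) ∧
    300 * (stackOf s).length + 150 * bl.length + 250 * (s.nv 11 + 1 - s.nv 21) + 10 + r ≤ c

theorem Buckets.remove {μ : HeapMem} {bucket : ℕ → ℕ} {bl : List ℕ} {M r : ℕ}
    (h : Buckets μ bucket bl M) (hn : bl.Nodup) (hr : bucket r ≠ 0) :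
    Buckets μ (Function.update bucket r 0) (bl.erase (bucket r)) M := by
  obtain ⟨h1, h2⟩ := h.mem r hr
  refine ⟨?_, ?_⟩
  · intro r' hr'
    rw [Function.update_apply] at hr' ⊢
    split_ifs at hr' ⊢ with e
    · exact absurd rfl hr'
    · obtain ⟨h3, h4⟩ := h.mem r' hr'
      refine ⟨(List.mem_erase_of_ne ?_).2 h3, h4⟩
      intro e'
      rw [e', h2] at h4
      exact e h4.symm
  · intro v hv
    have hv' := hn.mem_erase_iff.1 hv
    obtain ⟨h3, h4, h5⟩ := h.eq v hv'.2
    refine ⟨?_, h4, h5⟩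
    rw [Function.update_of_ne, h3]
    intro e
    rw [e] at h3
    exact hv'.1 h3.symm

/-- Each slot brings 250 units and each root found there another 150. A root moved to the stack
needs 300 of these; the remaining 100 pay for the pass. -/
theorem W_scan {bl : List ℕ} (hi : (heapOf s).Inv φ) (hr : HeapMem.Roots φ bl)
    (hs : s.nv 10 = 0) (hb : Buckets (heapOf s) (s.na 24) bl (s.nv 11))
    {q : ℕ} (hq : s.nv 11 + 1 = q)
    (hc : 150 * bl.length + 250 * q + 20 + r ≤ c) :
    W O scanProg (fun s' c' =>
      HeapMem.Roots φ (stackOf s' ++ optNode (s'.nv 22)) ∧ (∀ r, s'.na 24 r = 0) ∧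
      (∀ v ∈ stackOf s', s'.nv 22 ≠ 0 ∧ (heapOf s).key (s'.nv 22) ≤ (heapOf s).key v) ∧
      (s'.nv 22 ≠ 0 → (heapOf s).Full (s'.nv 22)) ∧
      300 * (stackOf s').length + r ≤ c') s c := by
  have halive : ∀ {l v}, HeapMem.Roots φ l → v ∈ l → v ≠ 0 := fun h hv => by
    have := (hi.pos _ ((h.2 _).1 hv).1).1
    omega
  simp only [scanProg, W_seq, W_nset]
  simp
  refine ⟨by omega, by omega, ?_⟩
  refine W_loop (ScanInv (heapOf s) φ r) ?_ ?_ ?_ ?_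
  · refine ⟨bl, ?_, ?_, ?_, ?_, ?_, ?_⟩
    · simpa [stackOf, hs, optNode] using hr
    · simpa using hb
    · simp
    · simp [stackOf, hs]
    · simp
    · simp [stackOf, hs, hq]
      omega
  · rintro s' c' - ⟨bl, -, -, -, -, -, h⟩
    simp
    omega
  · rintro s' c' hF ⟨bl, h1, h2, h3, h4, h5, h6⟩ hlt
    simp at hlt
    have hk : s'.ra 3 = (heapOf s).key := hF.ra 3 (by decide)
    set w := s'.na 24 (s'.nv 21) with hw
    obtain ⟨q, hq⟩ : ∃ q, s'.nv 11 + 1 - s'.nv 21 = q + 1 :=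
      ⟨s'.nv 11 - s'.nv 21, by omega⟩
    have hq' : s'.nv 11 + 1 - (s'.nv 21 + 1) = q := by omega
    rw [hq] at h6
    have hlt3 : ∀ r < s'.nv 21 + 1, Function.update (s'.na 24) (s'.nv 21) 0 r = 0 := by
      intro r hr
      rw [Function.update_apply]
      split_ifs with e
      · rfl
      · exact h3 r (by omega)
    have hblnd : bl.Nodup := (List.nodup_append.1 h1.1).2.1
    simp only [W_seq, W_nset, W_ite, W_skip, W_nput]
    simp
    simp only [← hw]
    refine ⟨by omega, by omega, fun hw0 => ⟨by omega, by omega, ?_⟩,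
      fun hw0 => ⟨by omega, by omega, fun hb0 => ⟨by omega, by omega, ?_⟩,
        fun hb0 => ⟨by omega, fun hkey => ⟨by omega, by omega, by omega, by omega, ?_⟩,
          fun hkey => ⟨by omega, by omega, by omega, ?_⟩⟩⟩⟩
    · refine ⟨bl, ?_, ?_, ?_, ?_, ?_, ?_⟩
      · simpa [stackOf] using h1
      · simpa using h2
      · simp
        intro r hr
        rcases Nat.lt_or_eq_of_le hr with hr | rfl
        · exact h3 r hr
        · exact hw0
      · simpa [stackOf] using h4
      · simpa using h5
      · simp [stackOf, hq'] at h6 ⊢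
        omega
    all_goals
      have hwb := (h2.mem _ hw0).1
      have h2' := h2.remove hblnd hw0
      rw [← hw] at h2'
      have hperm : bl.Perm (w :: bl.erase w) := List.perm_cons_erase hwb
      have hlen : bl.length = (bl.erase w).length + 1 := by rw [hperm.length_eq]; rfl
      have hwf := (h2.eq w hwb).2.1
    -- Roots reach the stack only after losing against a candidate for the minimum, so without a
    -- candidate the stack is empty.
    · have hst : stackOf s' = [] := by
        cases hst : stackOf s' with
        | nil => rfl
        | cons a l => exact absurd hb0 (h4 a (by simp [hst])).1
      have hst' : s'.nv 10 = 0 := by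
        have := congrArg List.length hst
        simpa [stackOf] using this
      refine ⟨bl.erase w, ?_, ?_, ?_, ?_, ?_, ?_⟩
      · rw [hst] at h1
        simp only [optNode, hb0, if_true, List.nil_append] at h1
        have := h1.perm hperm
        simpa [stackOf, hst', optNode, hw0] using this
      · simpa using h2'
      · simpa using hlt3
      · simp [stackOf, hst']
      · simpa [hw0] using hwf
      · rw [hst] at h6
        simp [stackOf, hq', hst'] at h6 ⊢
        omega
    · refine ⟨bl.erase w, ?_, ?_, ?_, ?_, ?_, ?_⟩
      · have := h1.perm (List.Perm.append_left _ hperm)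
        simp [optNode, hb0, hw0] at this
        simpa [stackOf, map_range_succ_update, optNode, hw0] using this
      · simpa using h2'
      · simpa using hlt3
      · intro v hv
        simp [stackOf, map_range_succ_update] at hv ⊢
        rw [hk] at hkey
        refine ⟨hw0, ?_⟩
        rcases hv with ⟨a, ha, rfl⟩ | rfl
        · refine hkey.le.trans (h4 _ ?_).2
          simp [stackOf]
          exact ⟨a, ha, rfl⟩
        · exact hkey.le
      · simpa [hw0] using hwf
      · simp [stackOf, hq'] at h6 ⊢
        omega
    · refine ⟨bl.erase w, ?_, ?_, ?_, ?_, ?_, ?_⟩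
      · have := h1.perm (List.Perm.append_left _ hperm)
        simp [optNode, hb0] at this
        have h' := this.perm (List.Perm.append_left _ (List.Perm.swap _ _ _))
        simpa [stackOf, map_range_succ_update, optNode, hb0] using h'
      · simpa using h2'
      · simpa using hlt3
      · intro v hv
        simp [stackOf, map_range_succ_update] at hv ⊢
        rw [hk] at hkey
        refine ⟨hb0, ?_⟩
        rcases hv with ⟨a, ha, rfl⟩ | rfl
        · refine (h4 _ ?_).2
          simp [stackOf]
          exact ⟨a, ha, rfl⟩
        · exact hkey
      · simpa [hb0] using h5
      · simp [stackOf, hq'] at h6 ⊢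
        omega
  · rintro s' c' hF ⟨bl, h1, h2, h3, h4, h5, h6⟩ hlt
    simp at hlt
    -- A root still in a bucket would occupy the slot of its rank, which lies in the scanned range,
    -- but all these slots have been cleared.
    have hbl : bl = [] := by
      refine List.eq_nil_iff_forall_not_mem.2 fun w hw => ?_
      have hw0 := halive h1 (List.mem_append_right _ hw)
      obtain ⟨h7, -, h8⟩ := h2.eq w hw
      rw [h3 _ (by omega)] at h7
      exact hw0 h7.symm
    subst hbl
    refine ⟨by simpa using h1, ?_, h4, h5, ?_⟩
    · intro r
      by_contra hr
      have := (h2.mem r hr).1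
      simp at this
    · simp
      omega

/-- A full node has exactly as many children as its rank, so a counter can stop the traversal where
the linked list has no reliable end marker. -/
theorem W_pushKids (hi : (heapOf s).Inv φ) (hu : s.nv 22 ∈ φ.alive)
    (hf : (heapOf s).Full (s.nv 22)) (hG : (heapOf s).rank (s.nv 22) ≤ G)
    (hc : 300 * (stackOf s).length + 350 * G + 20 + r ≤ c) :
    W O pushKidsProg (fun s' c' => stackOf s' = stackOf s ++ φ.kids (s.nv 22) ∧
      300 * (stackOf s').length + r ≤ c') s c := by
  set u := s.nv 22 with hudef
  have hlen := hi.kids_length_full hu hf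
  have hl := hi.linked u hu
  simp only [pushKidsProg, W_seq, W_nset]
  simp
  simp only [← hudef]
  refine ⟨by omega, by omega, ?_⟩
  refine W_loop (fun s' c' => ∃ done rest, φ.kids u = done ++ rest ∧
    Linked (s.na 20) (s'.nv 19) rest ∧ s'.nv 21 = rest.length ∧ stackOf s' = stackOf s ++ done ∧
    300 * (stackOf s').length + 350 * rest.length + 10 + r ≤ c') ?_ ?_ ?_ ?_
  · refine ⟨[], φ.kids u, rfl, ?_, ?_, ?_, ?_⟩
    · simpa [heapOf] using hl
    · rw [hlen]; rfl
    · simp [stackOf]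
    · simp [stackOf] at hc ⊢
      omega
  · rintro s' c' - ⟨done, rest, -, -, -, -, h⟩
    simp
    omega
  · rintro s' c' hF ⟨done, rest, h1, h2, h3, h4, h5⟩ hpos
    simp at hpos
    have hn : s'.na 20 = s.na 20 := by
      rw [hF.na 20 (by decide)]; rfl
    cases rest with
    | nil => simp at h3; omega
    | cons a rest =>
      obtain ⟨ha, h2⟩ := h2
      simp only [W_seq, W_nset, W_nput]
      simp at h3 h5 ⊢
      refine ⟨by omega, by omega, by omega, by omega, done ++ [a], rest, by simp [h1], ?_, ?_, ?_, ?_⟩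
      · rw [hn, ha]; exact h2
      · omega
      · rw [← List.append_assoc, ← h4]
        simp [stackOf, map_range_succ_update, ha]
      · simp [stackOf] at h5 ⊢
        omega
  · rintro s' c' - ⟨done, rest, h1, h2, h3, h4, h5⟩ hpos
    simp at hpos
    have hr : rest = [] := List.length_eq_zero_iff.1 (by omega)
    subst hr
    simp at h1 h5 ⊢
    exact ⟨by rw [h4, h1], by omega⟩

/-- Consolidation leaves only full roots and loses no full node. By heap order the smallest root is
then minimal among all full nodes. The term `600 * G` is 250 per slot for the scan plus 350 per
child of the extracted node. -/
theorem W_extractHeap (hG : ∀ k, 2 ^ (k / 2) ≤ s.nv 9 → k ≤ G) (hi : (heapOf s).Inv φ)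
    (hr : HeapMem.Roots φ (stackOf s)) (hb : ∀ r, s.na 24 r = 0) (hM : s.nv 11 ≤ G)
    (hne : ∃ v ∈ φ.alive, (heapOf s).Full v)
    (hc : 300 * (stackOf s).length + 500 * (heapOf s).hollow φ + 600 * G + 650 + r ≤ c) :
    W O extractHeapProg (fun s' c' => ∃ φ', s'.nv 22 ∈ φ.alive ∧ (heapOf s).Full (s'.nv 22) ∧
      (∀ v ∈ φ.alive, (heapOf s).Full v → (heapOf s).key (s'.nv 22) ≤ (heapOf s).key v) ∧
      (heapOf s').Inv φ' ∧ HeapMem.Roots φ' (stackOf s') ∧ (∀ r, s'.na 24 r = 0) ∧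
      s'.nv 11 ≤ G ∧ φ'.alive ⊆ φ.alive.erase (s'.nv 22) ∧
      (∀ v ∈ φ.alive, (heapOf s).Full v → v ≠ s'.nv 22 → v ∈ φ'.alive) ∧
      300 * (stackOf s').length + 500 * (heapOf s').hollow φ' + r ≤ c') s c := by
  rw [extractHeapProg, W_seq]
  refine (W_consolidate (r := r + 600 * G + 640) hG hi hr hb hM (by omega)).frame.mono ?_
  rintro s1 c1 ⟨⟨h10, φ1, bl, hi1, hr1, hb1, ha1, hf1, hM1, hc1⟩, hF1⟩
  have hst1 : stackOf s1 = [] := by simp [stackOf, h10]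
  rw [hst1] at hr1 hc1
  rw [List.nil_append] at hr1
  simp at hc1
  have hfull1 : ∀ v, (heapOf s1).Full v ↔ (heapOf s).Full v :=
    HeapMem.Full.congr (hF1.na 12 (by decide)) (hF1.na 22 (by decide))
  have hkey1 : (heapOf s1).key = (heapOf s).key := hF1.ra 3 (by decide)
  have h91 : s1.nv 9 = s.nv 9 := hF1.nv 9 (by decide)
  rw [W_seq]
  obtain ⟨q, hq⟩ : ∃ q, s1.nv 11 + 1 = q := ⟨_, rfl⟩
  refine (W_scan (r := r + 500 * (heapOf s1).hollow φ1 + 350 * G + 20) hi1 hr1 h10 hb1 hq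
    (by omega)).frame.mono ?_
  rintro s2 c2 ⟨⟨hr2, hb2, hmin, hbf, hc2⟩, hF2⟩
  have hheap2 : heapOf s2 = heapOf s1 := by
    simp only [heapOf, HeapMem.mk.injEq]
    exact ⟨hF2.na _ (by decide), hF2.na _ (by decide), hF2.na _ (by decide), hF2.na _ (by decide),
      hF2.na _ (by decide), hF2.ra _ (by decide), hF2.nv _ (by decide)⟩
  set u := s2.nv 22 with hu
  have hu0 : u ≠ 0 := by
    obtain ⟨v, hv, hvf⟩ := hne
    obtain ⟨w, hw, -⟩ := hi1.exists_root_le hr2 (hf1 v hv hvf)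
    rcases List.mem_append.1 hw with hw | hw
    · exact (hmin w hw).1
    · intro h0
      simp [optNode, h0] at hw
  have hopt : optNode u = [u] := by simp [optNode, hu0]
  rw [hopt] at hr2
  have hroot := (hr2.2 u).1 (by simp)
  have hrank : (heapOf s1).rank u ≤ G := by
    refine hG _ ?_
    rw [← h91]
    exact hi1.two_pow_rank_le hroot.1 hroot.2
  have hi2 := hi1
  rw [← hheap2] at hi2
  refine (W_pushKids (G := G) (r := r + 500 * (heapOf s1).hollow φ1) hi2 hroot.1
    (by rw [hheap2]; exact hbf hu0) (by rw [hheap2]; exact hrank) (by omega)).frame.mono ?_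
  rintro s3 c3 ⟨⟨hst3, hc3⟩, hF3⟩
  have hheap3 : heapOf s3 = heapOf s1 := by
    rw [← hheap2]
    simp only [heapOf, HeapMem.mk.injEq]
    exact ⟨hF3.na _ (by decide), hF3.na _ (by decide), hF3.na _ (by decide), hF3.na _ (by decide),
      hF3.na _ (by decide), hF3.ra _ (by decide), hF3.nv _ (by decide)⟩
  have hu3 : s3.nv 22 = u := hF3.nv 22 (by decide)
  rw [← hu] at hst3
  obtain ⟨φ', h1, h2, h3, h4⟩ := hi1.remove (v := u) (l := stackOf s2) (hr2.perm (by simp))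
  rw [hu3, hheap3]
  refine ⟨φ', ha1 hroot.1, (hfull1 u).1 (hbf hu0), ?_, h2, ?_, ?_, ?_, ?_, ?_, ?_⟩
  · intro v hv hvf
    obtain ⟨w, hw, hwv⟩ := hi1.exists_root_le hr2 (hf1 v hv hvf)
    rw [hkey1] at hwv hmin
    refine le_trans ?_ hwv
    rcases List.mem_append.1 hw with hw | hw
    · exact (hmin w hw).2
    · rw [List.mem_singleton.1 hw]
  · rw [hst3]
    exact h3.perm List.perm_append_comm
  · intro r
    rw [hF3.na 24 (by decide)]
    exact hb2 r
  · rw [hF3.nv 11 (by decide), hF2.nv 11 (by decide)]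
    exact hM1
  · rw [h1]
    exact Finset.erase_subset_erase _ ha1
  · intro v hv hvf hvu
    rw [h1]
    exact Finset.mem_erase.2 ⟨hvu, hf1 v hv hvf⟩
  · omega

variable {V : Type*} [Fintype V] [DecidableEq V] {X : SteinerInstance V} {E : Encoding X}
  {L : V → Finset V → ℝ} {st : State V} {f : ℕ}

theorem W_record {Q : Store → ℕ → Prop} {y : ℕ} (hy : s.na 22 (s.nv 22) = y) (hc : 50 ≤ c)
    (hQ : ∀ s' c', c ≤ c' + 50 → s'.nv 23 = y → s'.nv 24 = s.na 14 y → s'.nv 25 = s.na 15 y →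
      s'.nv 4 = s.nv 4 + 1 → s'.na 4 = Function.update (s.na 4) (s.nv 4) (s.na 14 y) →
      s'.na 5 = Function.update (s.na 5) (s.nv 4) (s.na 15 y) → s'.na 24 = s.na 24 →
      s'.nv 11 = s.nv 11 →
      memOf s' = { memOf s with perm := Function.update (s.na 13) y 1 } → Q s' c') :
    W O recordProg Q s c := by
  simp only [recordProg, W_seq, W_nset, W_nput]
  simp
  simp only [hy]
  refine ⟨by omega, by omega, by omega, by omega, by omega, by omega, by omega, ?_⟩
  apply hQ
  · omega
  all_goals simp [memOf, heapOf, stackOf]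

/-- Full nodes of the forest correspond to candidates and carry their keys, so the minimum of the
heap is a valid choice for the algorithm. The extracted node is still the current node of its label,
but it has left the forest, as the field `dead` demands of permanent labels. -/
theorem W_extract (hG : ∀ k, 2 ^ (k / 2) ≤ s.nv 9 → k ≤ G) (h : E.Rel L (memOf s) st φ)
    (hN : st.N.Nonempty) (hb : ∀ r, s.na 24 r = 0)
    (hM : s.nv 11 ≤ G)
    (hc : potential X f (memOf s) st φ + 600 * G + 700 + r ≤ c) :
    W O extractProg (fun s' c' => ∃ (x : Label V) (φ' : Forest),
      x ∈ st.N ∧ (∀ y ∈ st.N, X.key L st x ≤ X.key L st y) ∧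
      E.Rel L (memOf s') (st.makePermanent x) φ' ∧ s'.nv 23 = E.idx x ∧
      s'.nv 24 = E.vertex x.1 ∧ s'.nv 25 = E.mask x.2 ∧
      s'.na 4 = Function.update (s.na 4) (s.nv 4) (E.vertex x.1) ∧
      s'.na 5 = Function.update (s.na 5) (s.nv 4) (E.mask x.2) ∧
      s'.nv 4 = s.nv 4 + 1 ∧ (∀ r, s'.na 24 r = 0) ∧ s'.nv 11 ≤ G ∧
      potential X f (memOf s') (st.makePermanent x) φ' + r ≤ c') s c := by
  have hcand : ∀ y ∈ st.N, X.IsLabel y ∧ (memOf s).heap.node (E.idx y) ≠ 0 ∧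
      (memOf s).perm (E.idx y) ≠ 1 := fun y hy =>
    ⟨h.cand_label y hy, (h.cand y (h.cand_label y hy)).1 hy⟩
  have hnodefull : ∀ y, s.na 12 y ≠ 0 → (heapOf s).Full (s.na 12 y) := by
    intro y hy
    have : s.na 22 (s.na 12 y) = y := h.heap.item_node y hy
    show s.na 12 (s.na 22 (s.na 12 y)) = s.na 12 y
    rw [this]
  have hne : ∃ v ∈ φ.alive, (heapOf s).Full v := by
    obtain ⟨y, hy⟩ := hN
    obtain ⟨hl, h1, h2⟩ := hcand y hy
    exact ⟨_, (h.live y hl h1 h2).1, hnodefull _ h1⟩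
  rw [extractProg, W_seq]
  unfold potential at hc
  have e1 : (memOf s).stack = stackOf s := rfl
  have e2 : (memOf s).heap = heapOf s := rfl
  rw [e1, e2] at hc
  refine (W_extractHeap (r := r + (f + 100) * X.untouched st + 50) hG h.heap h.roots hb hM hne
    (by omega)).frame.mono ?_
  rintro s1 c1 ⟨⟨φ', hu, huf, hmin, hi', hr', hb', hM', ha', hal', hc'⟩, hF⟩
  have hna : ∀ a ∉ extractHeapProg.wna, s1.na a = s.na a := hF.na
  have hra : ∀ a ∉ extractHeapProg.wra, s1.ra a = s.ra a := hF.ra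
  have n12 := hna 12 (by decide)
  have n13 := hna 13 (by decide)
  have n14 := hna 14 (by decide)
  have n15 := hna 15 (by decide)
  have n16 := hna 16 (by decide)
  have n17 := hna 17 (by decide)
  have n18 := hna 18 (by decide)
  have n22 := hna 22 (by decide)
  have n4 := hna 4 (by decide)
  have n5 := hna 5 (by decide)
  have r1 := hra 1 (by decide)
  have r2 := hra 2 (by decide)
  have r3 := hra 3 (by decide)
  have v4 : s1.nv 4 = s.nv 4 := hF.nv 4 (by decide)
  set u := s1.nv 22 with hudef
  obtain ⟨x, hx, hxi, hxn⟩ := h.item u hu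
  have hxi' : s.na 22 u = E.idx x := hxi
  have hxu : s.na 12 (E.idx x) = u := by rw [← hxi']; exact huf
  -- The node of a permanent label is not in the forest, whereas `u` is.
  have hxp : (memOf s).perm (E.idx x) ≠ 1 := by
    intro hp
    apply h.dead x hx hp
    show s.na 12 (E.idx x) ∈ φ.alive
    rw [hxu]; exact hu
  have hxN : x ∈ st.N := (h.cand x hx).2 ⟨hxn, hxp⟩
  obtain ⟨-, hxv, hxm⟩ := h.data x hx hxn
  have hxv' : s.na 14 (E.idx x) = E.vertex x.1 := hxv
  have hxm' : s.na 15 (E.idx x) = E.mask x.2 := hxm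
  have hkey : ∀ y ∈ st.N, X.key L st y = (((heapOf s).key (s.na 12 (E.idx y)) : ℝ) : WithTop ℝ) := by
    intro y hy
    obtain ⟨hl, h1, h2⟩ := hcand y hy
    have h3 := (h.live y hl h1 h2).2
    have h4 := (h.data y hl h1).1
    rw [SteinerInstance.key, h.l y hl, if_neg h1, ← h4, ← WithTop.coe_add, WithTop.coe_inj]
    exact h3.symm
  refine W_record (y := E.idx x) (by rw [n22]; exact hxi') (by omega) ?_
  intro s2 c2 hc2 m23 m24 m25 m4 ma4 ma5 ma24 m11 hmem
  rw [n14, hxv'] at m24 ma4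
  rw [n15, hxm'] at m25 ma5
  rw [v4] at m4 ma4 ma5
  rw [n4] at ma4
  rw [n5] at ma5
  refine ⟨x, φ', hxN, ?_, ?_, m23, m24, m25, ma4, ma5, m4, by rwa [ma24], by rwa [m11], ?_⟩
  · intro y hy
    obtain ⟨hl, h1, h2⟩ := hcand y hy
    rw [hkey x hxN, hkey y hy, WithTop.coe_le_coe, hxu]
    exact hmin _ (h.live y hl h1 h2).1 (hnodefull _ h1)
  · have hpne : ∀ y, X.IsLabel y → y ≠ x →
        Function.update (s.na 13) (E.idx x) 1 (E.idx y) = s.na 13 (E.idx y) := fun y hy hyx => by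
      rw [Function.update_of_ne (E.idx_ne hy hx hyx)]
    rw [hmem]
    constructor
    · exact hi'
    · exact hr'
    · intro y hy
      refine (h.l y hy).trans ?_
      show (if s.na 12 _ = 0 then (⊤ : WithTop ℝ) else ((s.ra 1 _ : ℝ) : WithTop ℝ)) =
        if s1.na 12 _ = 0 then (⊤ : WithTop ℝ) else ((s1.ra 1 _ : ℝ) : WithTop ℝ)
      rw [n12, r1]
    · intro y hy
      simp [memOf, n13, State.makePermanent]
      by_cases hyx : y = x
      · subst hyx; simp
      · rw [hpne y hy hyx]
        simpa [memOf, hyx] using h.perm y hy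
    · intro y hy
      simp [memOf, heapOf, n12, n13, State.makePermanent]
      by_cases hyx : y = x
      · subst hyx; simp
      · rw [hpne y hy hyx]
        simpa [memOf, heapOf, hyx] using h.cand y hy
    · rintro y ⟨hy, -⟩
      exact h.cand_label y hy
    · intro y hy
      simpa [memOf, heapOf, n12, r2, n14, n15] using h.data y hy
    · intro y hy
      show E.BackCode _ _ _ y (st.b y)
      simpa [memOf, n16, n17, n18] using h.back y hy
    · intro v hv
      have := h.item v (Finset.mem_of_mem_erase (ha' hv))
      simpa [memOf, heapOf, n12, n22] using this
    · intro y hy hyn hyp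
      simp [memOf, heapOf, n12, n13, r1, r2, r3] at hyn hyp ⊢
      by_cases hyx : y = x
      · subst hyx; simp at hyp
      · rw [hpne y hy hyx] at hyp
        obtain ⟨h1, h2⟩ := h.live y hy hyn hyp
        refine ⟨hal' _ h1 (hnodefull _ hyn) ?_, h2⟩
        intro e
        have h3 : s.na 22 (s.na 12 (E.idx y)) = E.idx y := h.heap.item_node _ hyn
        have e' : s.na 12 (E.idx y) = u := e
        rw [e', hxi'] at h3
        exact E.idx_ne hy hx hyx h3.symm
    · intro y hy hyp
      simp [memOf, heapOf, n12, n13] at hyp ⊢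
      by_cases hyx : y = x
      · subst hyx
        rw [hxu]
        intro hmem
        have := ha' hmem
        simp at this
      · rw [hpne y hy hyx] at hyp
        intro hmem
        exact h.dead y hy hyp (Finset.mem_of_mem_erase (ha' hmem))
  · have h1 : X.untouched (st.makePermanent x) = X.untouched st := rfl
    have h2 : (300 * (stackOf s1).length + 500 * (heapOf s1).hollow φ') +
      (r + (f + 100) * X.untouched st + 50) ≤ c1 := by omega
    have h3 : (memOf s2).stack = stackOf s1 := by rw [hmem]; rfl
    have h4 : (memOf s2).heap = heapOf s1 := by rw [hmem]; rfl
    unfold potential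
    rw [h1, h3, h4]
    omega

end Extract

/-! ### The program: the inner loops -/

/-- One pass of the loop over the edges, for the half-edge in register `26`. -/
def edgeProg : Prog :=
  .nset 13 (.get 8 §26) ;; .nset 12 (.add (.get 11 §13) §25) ;; .nset 14 §25 ;; .nset 15 ¢1 ;;
  .nset 16 §23 ;; .nset 17 (.get 9 §26) ;;
  .rset 0 (.add (.get 1 §23) (.get 0 (.get 9 §26))) ;;
  relaxProg ;; .nset 26 (.get 7 §26)

/-- The loop over the edges, for the label in registers `23` to `25`. -/
def edgesProg : Prog :=
  .nset 26 (.get 6 §24) ;; .loop (.not (.neq §26 ¢0)) edgeProg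

/-- Appends a copy of the list in array `25`, shifted by the bit in register `29`. -/
def doubleProg : Prog :=
  .nset 31 §28 ;; .nset 27 ¢0 ;;
  .loop (.nlt §27 §31)
    (.nput 25 §28 (.add (.get 25 §27) (.get 10 §29)) ;; .nset 28 (.add §28 ¢1) ;;
      .nset 27 (.add §27 ¢1))

/-- Lists in array `25` all subsets of the complement of the set in register `25`; their number is
left in register `28`. -/
def enumProg : Prog :=
  .nset 30 (.sub §7 §25) ;; .nput 25 ¢0 ¢0 ;; .nset 28 ¢1 ;; .nset 29 §2 ;;
  .loop (.nlt ¢0 §29)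
    (.nset 29 (.sub §29 ¢1) ;;
      .ite (.nlt §30 (.get 10 §29)) .skip
        (.nset 30 (.sub §30 (.get 10 §29)) ;; doubleProg))

/-- One pass of the loop over the sets, for the set at the position in register `27`. -/
def mergeProg : Prog :=
  .ite (.neq (.get 13 (.add (.sub §23 §25) (.get 25 §27))) ¢1)
    (.nset 12 (.add §23 (.get 25 §27)) ;; .nset 13 §24 ;; .nset 14 (.add §25 (.get 25 §27)) ;;
      .nset 15 ¢2 ;; .nset 16 §23 ;; .nset 17 (.add (.sub §23 §25) (.get 25 §27)) ;;
      .rset 0 (.add (.get 1 §23) (.get 1 §17)) ;; relaxProg)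
    .skip ;;
  .nset 27 (.add §27 ¢1)

/-- The loop over the sets, for the label in registers `23` to `25`. -/
def mergesProg : Prog :=
  .nset 27 ¢1 ;; .loop (.nlt §27 §28) mergeProg

/-! ### Adjacency lists and other data computed before the main loop. -/

section Static

variable {V : Type*} [Fintype V] [DecidableEq V] {X : SteinerInstance V} (E : Encoding X)

/-- The list `ps` of half-edges and their end vertices is the adjacency list of `v`, for the
half-edges that satisfy `P`. -/
structure Encoding.AdjList (P : V → Prop) (first next target edge : ℕ → ℕ) (v : V)
    (ps : List (ℕ × V)) : Prop where
  chained : Chained next (first (E.vertex v)) (ps.map Prod.fst)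
  nodup : (ps.map Prod.snd).Nodup
  mem : ∀ w, w ∈ ps.map Prod.snd ↔ P w
  data : ∀ p ∈ ps, target p.1 = E.vertex p.2 ∧
    ∃ i : Fin X.m, edge p.1 = i ∧ s(E.tail i, E.head i) = s(v, p.2)

/-- The data that are computed before the main loop. -/
structure Encoding.Static (s : Store) : Prop where
  k : s.nv 2 = X.k
  pw : s.nv 5 = 2 ^ X.k
  sm : s.nv 7 = E.mask X.sources
  goal : s.nv 8 = E.idx (X.root, X.sources)
  cost : ∀ i : Fin X.m, s.ra 0 i = X.c s(E.tail i, E.head i)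
  pow : ∀ j < X.k, s.na 10 j = 2 ^ j
  row : ∀ v, s.na 11 (E.vertex v) = E.vertex v * 2 ^ X.k
  adj : ∀ v, ∃ ps, E.AdjList (X.G.Adj v) (s.na 6) (s.na 7) (s.na 8) (s.na 9) v ps

variable {E} {s s' : Store}

theorem Encoding.Static.of_frame {p : Prog} (h : E.Static s) (hF : Frame p s s')
    (h1 : ∀ x ∈ [2, 5, 7, 8], x ∉ p.wnv) (h2 : ∀ x ∈ [6, 7, 8, 9, 10, 11], x ∉ p.wna)
    (h3 : 0 ∉ p.wra) : E.Static s' := by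
  have v : ∀ x ∈ [2, 5, 7, 8], s'.nv x = s.nv x := fun x hx => hF.nv x (h1 x hx)
  have a : ∀ x ∈ [6, 7, 8, 9, 10, 11], s'.na x = s.na x := fun x hx => hF.na x (h2 x hx)
  refine ⟨?_, ?_, ?_, ?_, ?_, ?_, ?_, ?_⟩
  · rw [v 2 (by simp)]; exact h.k
  · rw [v 5 (by simp)]; exact h.pw
  · rw [v 7 (by simp)]; exact h.sm
  · rw [v 8 (by simp)]; exact h.goal
  · rw [hF.ra 0 h3]; exact h.cost
  · rw [a 10 (by simp)]; exact h.pow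
  · rw [a 11 (by simp)]; exact h.row
  · rw [a 6 (by simp), a 7 (by simp), a 8 (by simp), a 9 (by simp)]; exact h.adj

open Classical in
/-- The degree of a vertex. -/
noncomputable def SteinerInstance.deg (X : SteinerInstance V) (v : V) : ℕ :=
  (Finset.univ.filter fun w => X.G.Adj v w).card

theorem Encoding.AdjList.length_eq {first next target edge : ℕ → ℕ} {v : V} {ps : List (ℕ × V)}
    (h : E.AdjList (X.G.Adj v) first next target edge v ps) : ps.length = X.deg v := by
  classical
  rw [SteinerInstance.deg, ← List.length_map (f := Prod.snd), ← List.toFinset_card_of_nodup h.nodup]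
  congr 1
  ext w
  rw [List.mem_toFinset, h.mem]
  simp

end Static

section Loops

variable {O : Oracle} {s : Store} {c r : ℕ} {V : Type*} [Fintype V] [DecidableEq V]
  {X : SteinerInstance V} {E : Encoding X} {L : V → Finset V → ℝ} {st : State V} {φ : Forest}
  {xs : List (Label V)} {x : Label V} {f : ℕ}

@[simp] theorem memOf_setN {a v : ℕ} (h9 : a ≠ 9) (h10 : a ≠ 10) :
    memOf (s.setN a v) = memOf s := by
  simp [memOf, heapOf, stackOf, h9.symm, h10.symm]

@[simp] theorem memOf_setR {a : ℕ} {z : ℝ} : memOf (s.setR a z) = memOf s := rfl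

/-- Any order of the edges is allowed, so the order of the adjacency list serves as `ws`. Each
half-edge gets 1100 units, 1000 of them for `relaxProg`, and creates at most one heap node. -/
theorem W_edges (hO : E.Evaluates O L f) (hs : E.Static s) (h : E.Rel L (memOf s) st φ)
    (hI : X.Inv st xs) (hx : x ∈ xs) (h23 : s.nv 23 = E.idx x) (h24 : s.nv 24 = E.vertex x.1)
    (h25 : s.nv 25 = E.mask x.2)
    (hc : potential X f (memOf s) st φ + 1100 * X.deg x.1 + 100 + r ≤ c) :
    W O edgesProg (fun s' c' => ∃ ws φ', ws.Nodup ∧ (∀ w, w ∈ ws ↔ X.G.Adj x.1 w) ∧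
      E.Rel L (memOf s') (X.edgeLoop x ws st) φ' ∧ s'.nv 9 ≤ s.nv 9 + X.deg x.1 ∧
      potential X f (memOf s') (X.edgeLoop x ws st) φ' + r ≤ c') s c := by
  obtain ⟨ps, hps⟩ := hs.adj x.1
  have hl := hI.label x hx
  rw [← hps.length_eq] at hc ⊢
  rw [edgesProg, W_seq, W_nset]
  simp only [NExp.cost, NExp.eval, h24]
  refine ⟨by omega, ?_⟩
  -- The invariant says that finishing the loop from `st'` gives the same state as the whole loop
  -- from `st`; this avoids any description of intermediate states.
  refine W_loop (fun s' c' => ∃ (rest : List (ℕ × V)) (st' : State V) (φ' : Forest),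
    X.edgeLoop x (rest.map Prod.snd) st' = X.edgeLoop x (ps.map Prod.snd) st ∧
    E.Rel L (memOf s') st' φ' ∧ X.Inv st' xs ∧
    Chained (s.na 7) (s'.nv 26) (rest.map Prod.fst) ∧ (∀ p ∈ rest, p ∈ ps) ∧
    s'.nv 9 + rest.length ≤ s.nv 9 + ps.length ∧
    potential X f (memOf s') st' φ' + 1100 * rest.length + 20 + r ≤ c') ?_ ?_ ?_ ?_
  · refine ⟨ps, st, φ, rfl, ?_, hI, ?_, fun _ h => h, by simp, ?_⟩
    · simpa using h
    · simpa using hps.chained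
    · simp only [memOf_setN, ne_eq, Nat.reduceEqDiff, not_false_eq_true]
      omega
  · rintro s' c' - ⟨rest, st', φ', -, -, -, -, -, -, h⟩
    simp
    omega
  · rintro s' c' hF ⟨rest, st', φ', h1, h2, h3, h4, h5, h6, h7⟩ hne
    have hv : ∀ a ∉ 26 :: edgeProg.wnv, s'.nv a = s.nv a := fun a ha => by
      rw [List.mem_cons, not_or] at ha
      rw [hF.nv a ha.2]; simp [ha.1]
    have ha : ∀ a ∉ edgeProg.wna, s'.na a = s.na a := fun a ha => by
      rw [hF.na a ha]; rfl
    have hra : s'.ra 0 = s.ra 0 := by rw [hF.ra 0 (by decide)]; rfl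
    cases rest with
    | nil =>
      simp [Chained] at h4 hne
      exact absurd h4 hne
    | cons p rest =>
      obtain ⟨h4a, -, h4b⟩ := h4
      obtain ⟨ht, i, hi, hi'⟩ := hps.data p (h5 p (by simp))
      simp only [List.map_cons, SteinerInstance.edgeLoop_cons] at h1
      have hlx := h2.l_of_ne hl (h3.fin_of_mem hx)
      have hcost : (memOf s').cost (E.idx x) = s'.ra 1 (E.idx x) := rfl
      simp only [edgeProg, W_seq, W_nset, W_rset]
      simp only [List.length_cons] at h6 h7
      simp only [NExp.eval, NExp.cost, RExp.eval, RExp.cost, Test.cost, setN_nv, setN_na, setN_ra,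
        Nat.reduceEqDiff, reduceIte, Nat.reduceAdd]
      rw [hv 23 (by decide), hv 25 (by decide), ha 8 (by decide), ha 9 (by decide),
        ha 11 (by decide), hra, h4a, ht, hi, h23, h25, hs.row, hs.cost]
      refine ⟨by omega, by omega, by omega, by omega, by omega, by omega, by omega, ?_⟩
      obtain ⟨q, hq⟩ : ∃ q, 1100 * rest.length = q := ⟨_, rfl⟩
      rw [mul_add, hq, mul_one] at h7
      refine (W_relax (L := L) (st := st') (φ := φ') (y := (p.2, x.2)) (f := f) (B := {x})
        (r := q + 40 + r) hO ?_ ?_ (SteinerInstance.isLabel_edge hl p.2) ?_ ?_ ?_ ?_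
        ?_).frame.mono ?_
      · simp [hv 5 (by decide), hs.pw]
      · simpa using h2
      · simp [Encoding.idx]
      · simp
      · simp
      · right; left
        exact ⟨by simp, x.1, rfl, by simp, i, by simp, by rw [hi', Sym2.eq_swap]⟩
      · simp only [memOf_setN, memOf_setR, ne_eq, Nat.reduceEqDiff, not_false_eq_true]
        repeat apply Nat.le_sub_of_add_le
        omega
      · rintro s2 c2 ⟨⟨φ2, hr2, h92, hc2⟩, hF2⟩
        simp at hr2 h92 hc2
        rw [hi'] at hr2 hc2
        rw [hlx, hcost] at h1
        have hn26 : s2.nv 26 = s'.nv 26 := by rw [hF2.nv 26 (by decide)]; simp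
        have hn7 : s2.na 7 = s.na 7 := by rw [hF2.na 7 (by decide)]; simpa using ha 7 (by decide)
        rw [W_nset]
        refine ⟨by simp; omega, rest, _, φ2, h1, ?_, ?_, ?_, ?_, ?_, ?_⟩
        · simpa using hr2
        · exact h3.relax (SteinerInstance.isLabel_edge hl p.2) (by simpa using hx)
        · simp [hn7, hn26, h4a]
          exact h4b
        · exact fun q hq => h5 q (List.mem_cons_of_mem _ hq)
        · simp
          omega
        · simp
          omega
  · rintro s' c' hF ⟨rest, st', φ', h1, h2, h3, h4, h5, h6, h7⟩ hne
    cases rest with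
    | cons p rest =>
      obtain ⟨h4a, h4b, -⟩ := h4
      simp at hne
      exact absurd (h4a.symm.trans hne) h4b
    | nil =>
      refine ⟨ps.map Prod.snd, φ', hps.nodup, hps.mem, ?_, ?_, ?_⟩
      · rw [← h1]; exact h2
      · simpa using h6
      · rw [← h1]
        simp [SteinerInstance.edgeLoop] at h7 ⊢
        omega

end Loops

theorem Encoding.high_subset {V : Type*} [Fintype V] [DecidableEq V] {X : SteinerInstance V}
    (E : Encoding X) {C : Finset V} {j : ℕ} : E.high C j ⊆ C := by
  intro v
  simp only [Encoding.high, Finset.mem_image, Finset.mem_filter, Finset.mem_univ, true_and]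
  rintro ⟨i, ⟨-, hi⟩, rfl⟩
  exact hi

section Loops

variable {O : Oracle} {s : Store} {c r : ℕ}

/-- Entries are appended to the array that is being read. The old length is saved first, so the
copies themselves are not copied. -/
theorem W_double (hc : 25 * s.nv 28 + 20 + r ≤ c) :
    W O doubleProg (fun s' c' => s'.nv 28 = s.nv 28 + s.nv 28 ∧
      (∀ i < s.nv 28, s'.na 25 i = s.na 25 i ∧
        s'.na 25 (s.nv 28 + i) = s.na 25 i + s.na 10 (s.nv 29)) ∧ r ≤ c') s c := by
  simp only [doubleProg, W_seq, W_nset]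
  simp
  refine ⟨by omega, by omega, ?_⟩
  refine W_loop (fun s' c' => s'.nv 31 = s.nv 28 ∧ s'.nv 27 ≤ s.nv 28 ∧
    s'.nv 28 = s.nv 28 + s'.nv 27 ∧ (∀ i < s.nv 28, s'.na 25 i = s.na 25 i) ∧
    (∀ i < s'.nv 27, s'.na 25 (s.nv 28 + i) = s.na 25 i + s.na 10 (s.nv 29)) ∧
    25 * s.nv 28 + 10 + r ≤ c' + 25 * s'.nv 27) ?_ ?_ ?_ ?_
  · simp
    omega
  · rintro s' c' - ⟨-, h1, -, -, -, h⟩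
    simp
    omega
  · rintro s' c' hF ⟨h1, h2, h3, h4, h5, h6⟩ hlt
    have h10 : s'.na 10 = s.na 10 := by rw [hF.na 10 (by decide)]; rfl
    have h29 : s'.nv 29 = s.nv 29 := by rw [hF.nv 29 (by decide)]; simp
    simp only [Test.eval, NExp.eval, h1] at hlt
    simp only [W_seq, W_nset, W_nput]
    simp [h10, h29, h1, h3]
    refine ⟨by omega, by omega, by omega, by omega, by omega, ?_, ?_, by omega⟩
    · intro i hi
      rw [Function.update_of_ne (by omega)]
      exact h4 i hi
    · intro i hi
      rcases Nat.lt_or_ge i (s'.nv 27) with hi' | hi'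
      · rw [Function.update_of_ne (by omega)]
        exact h5 i hi'
      · obtain rfl : i = s'.nv 27 := by omega
        rw [Function.update_self, h4 _ hlt]
  · rintro s' c' hF ⟨h1, h2, h3, h4, h5, h6⟩ hlt
    simp only [Test.eval, NExp.eval, h1, not_lt] at hlt
    have : s'.nv 27 = s.nv 28 := by omega
    rw [this] at h3 h5
    refine ⟨h3, fun i hi => ⟨h4 i hi, h5 i hi⟩, ?_⟩
    simp
    omega

variable {V : Type*} [Fintype V] [DecidableEq V]
  {X : SteinerInstance V} {E : Encoding X} {L : V → Finset V → ℝ} {st : State V} {φ : Forest}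
  {xs : List (Label V)} {x : Label V} {f : ℕ}

/-- Bits of the complement are found from the top. Each set bit doubles the list, so the total time
is proportional to the final length, apart from a constant for each of the `k` positions. -/
theorem W_enum (hs : E.Static s) (hx : X.IsLabel x) (h25 : s.nv 25 = E.mask x.2)
    (hc : 50 * X.k + 25 * 2 ^ (X.sources \ x.2).card + 50 + r ≤ c) :
    W O enumProg (fun s' c' => ∃ l : List (Finset V), EnumSubsets l (X.sources \ x.2) ∧
      s'.nv 28 = l.length ∧ (∀ (i : ℕ) (h : i < l.length), s'.na 25 i = E.mask l[i]) ∧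
      r ≤ c') s c := by
  set C := X.sources \ x.2 with hC
  have hCt : C ⊆ X.terminals := Finset.sdiff_subset.trans (Finset.erase_subset _ _)
  have hmC : s.nv 7 - s.nv 25 = E.mask C := by rw [hs.sm, h25, hC, E.mask_sdiff hx.1]
  simp only [enumProg, W_seq, W_nset, W_nput]
  simp only [NExp.eval, NExp.cost, setN_nv, putN_nv, Nat.reduceEqDiff, reduceIte, Nat.reduceAdd,
    hmC, hs.k]
  obtain ⟨q, hq⟩ : ∃ q, 25 * 2 ^ C.card = q := ⟨_, rfl⟩
  rw [hq] at hc
  refine ⟨by omega, by omega, by omega, by omega, ?_⟩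
  -- The term `25 * s'.nv 28` is what has been spent on doubling so far: extending the list costs in
  -- proportion to its growth.
  refine W_loop (fun s' c' => ∃ l : List (Finset V), s'.nv 29 ≤ X.k ∧
    EnumSubsets l (E.high C (s'.nv 29)) ∧ s'.nv 28 = l.length ∧
    (∀ (i : ℕ) (h : i < l.length), s'.na 25 i = E.mask l[i]) ∧
    s'.nv 30 = E.low C (s'.nv 29) ∧ 50 * s'.nv 29 + q + 10 + r ≤ c' + 25 * s'.nv 28)
    ?_ ?_ ?_ ?_
  · refine ⟨[∅], ?_⟩
    simp only [setN_nv, putN_na, setN_na, Nat.reduceEqDiff, reduceIte, E.high_k, le_refl,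
      List.length_singleton, true_and, EnumSubsets.empty]
    refine ⟨?_, E.mask_eq_low, by omega⟩
    intro i hi
    obtain rfl : i = 0 := by omega
    simp [E.mask_empty]
  · rintro s' c' - ⟨l, h1, h2, h3, -, -, h⟩
    have h4 : 25 * s'.nv 28 ≤ q := by
      rw [h3, h2.length_eq, ← hq]
      gcongr
      · norm_num
      · exact E.high_subset
    simp
    omega
  · rintro s' c' hF ⟨l, h1, h2, h3, h4, h5, h6⟩ hlt
    simp only [Test.eval, NExp.eval] at hlt
    obtain ⟨j, hj⟩ : ∃ j, s'.nv 29 = j + 1 := ⟨s'.nv 29 - 1, by omega⟩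
    rw [hj] at h1 h2 h5 h6
    have h10 : s'.na 10 j = 2 ^ j := by
      rw [hF.na 10 (by decide)]
      exact hs.pow j (by omega)
    have hb := E.low_succ_lt_iff (C := C) (j := j)
    have hls := E.low_succ (C := C) (j := j)
    simp only [W_seq, W_nset, W_ite, W_skip]
    simp only [NExp.eval, NExp.cost, Test.cost, Test.eval, setN_nv, setN_na, putN_nv,
      Nat.reduceEqDiff, reduceIte, Nat.reduceAdd, hj, Nat.add_sub_cancel, h10, h5, hb, not_not]
    have hq4 : 25 * s'.nv 28 ≤ q := by
      rw [h3, h2.length_eq, ← hq]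
      gcongr
      · norm_num
      · exact E.high_subset
    refine ⟨by omega, by omega, fun hbit => ⟨by omega, l, by omega, ?_, h3, h4, ?_, ?_⟩,
      fun hbit => ⟨by omega, ?_⟩⟩
    · rwa [E.high_of_not_bit hbit]
    · rw [hls, if_neg hbit, add_zero]
    · omega
    · have hj' : j < X.k := h1
      set t := E.term ⟨j, hj'⟩ with ht
      have hti := h2.insert (E.term_notMem_high (C := C) hj')
      rw [← E.high_of_bit hj' hbit] at hti
      have hq8 : 25 * (s'.nv 28 + s'.nv 28) ≤ q := by
        have := hti.length_eq
        rw [List.length_append, List.length_map, ← h3] at this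
        rw [this, ← hq]
        gcongr
        · norm_num
        · exact E.high_subset
      refine (W_double (r := 50 * j + q + 10 + r - 25 * (s'.nv 28 + s'.nv 28)) ?_).frame.mono ?_
      · simp
        omega
      · rintro s2 c2 ⟨⟨h28, hE, hc2⟩, hF2⟩
        simp [h10, hj] at h28 hE
        have e29 : s2.nv 29 = j := by
          rw [hF2.nv 29 (by decide)]
          simp
        have e30 : s2.nv 30 = E.low C j := by
          rw [hF2.nv 30 (by decide)]
          simp [hls, hbit]
        refine ⟨l ++ l.map (insert t), ?_⟩
        rw [e29]
        refine ⟨by omega, hti, by simp [h28, h3], ?_, e30, ?_⟩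
        · intro i hi
          simp only [List.length_append, List.length_map] at hi
          rcases Nat.lt_or_ge i l.length with hil | hil
          · rw [List.getElem_append_left hil, (hE i (by omega)).1, h4 i hil]
          · obtain ⟨i', rfl⟩ : ∃ i', i = l.length + i' := ⟨i - l.length, by omega⟩
            have hi' : i' < l.length := by omega
            rw [List.getElem_append_right (by omega)]
            have hEi := (hE i' (by omega)).2
            rw [h3, h4 i' hi'] at hEi
            rw [hEi]
            simp only [List.getElem_map, Nat.add_sub_cancel_left]
            rw [E.mask_insert_term]
            intro hmem
            exact E.term_notMem_high hj' ((h2.mem _).1 (List.getElem_mem hi') hmem)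
        · omega
  · rintro s' c' hF ⟨l, h1, h2, h3, h4, h5, h6⟩ hlt
    simp only [Test.eval, NExp.eval, not_lt, Nat.le_zero] at hlt
    rw [hlt, E.high_zero hCt] at h2
    refine ⟨l, h2, h3, h4, ?_⟩
    rw [h3, h2.length_eq, hq] at h6
    simp
    omega

/-- The program visits every nonempty `J` in the complement of `I` and skips those with `(v, J)` not
permanent. Permanence does not change during the loop, so the visited sets that survive the test are
exactly those that the algorithm prescribes. -/
theorem W_merges (hO : E.Evaluates O L f) (hs : E.Static s) (h : E.Rel L (memOf s) st φ)
    (hI : X.Inv st xs) (hx : x ∈ xs) (h23 : s.nv 23 = E.idx x) (h24 : s.nv 24 = E.vertex x.1)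
    (h25 : s.nv 25 = E.mask x.2) {l : List (Finset V)} (hl : EnumSubsets l (X.sources \ x.2))
    (h28 : s.nv 28 = l.length) (hsub : ∀ (i : ℕ) (h : i < l.length), s.na 25 i = E.mask l[i])
    (hc : potential X f (memOf s) st φ + 1100 * l.length + 100 + r ≤ c) :
    W O mergesProg (fun s' c' => ∃ (Js : List (Finset V)) (φ' : Forest), Js.Nodup ∧
      (∀ J, J ∈ Js ↔ X.Mergeable st.P x J) ∧
      E.Rel L (memOf s') (st.mergeLoop x Js) φ' ∧ s'.nv 9 ≤ s.nv 9 + l.length ∧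
      potential X f (memOf s') (st.mergeLoop x Js) φ' + r ≤ c') s c := by
  classical
  have hxl := hI.label x hx
  obtain ⟨l', rfl⟩ := hl.head
  have h0 : ∀ J ∈ l', J ≠ ∅ := fun J hJ h' => (List.nodup_cons.1 hl.nodup).1 (h' ▸ hJ)
  -- The invariant again speaks of the rest of the loop, now filtered by permanence in the state
  -- before the loop.
  set flt := fun ls : List (Finset V) => ls.filter fun J => (x.1, J) ∈ st.P with hflt
  rw [mergesProg, W_seq, W_nset]
  simp only [NExp.cost, NExp.eval]
  refine ⟨by omega, ?_⟩
  refine W_loop (fun s' c' => ∃ (done rest : List (Finset V)) (st' : State V) (φ' : Forest),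
    l' = done ++ rest ∧ s'.nv 27 = done.length + 1 ∧
    st'.mergeLoop x (flt rest) = st.mergeLoop x (flt l') ∧ st'.P = st.P ∧
    E.Rel L (memOf s') st' φ' ∧ X.Inv st' xs ∧
    s'.nv 9 + rest.length ≤ s.nv 9 + l'.length ∧
    potential X f (memOf s') st' φ' + 1100 * rest.length + 20 + r ≤ c') ?_ ?_ ?_ ?_
  · refine ⟨[], l', st, φ, rfl, by simp, rfl, rfl, by simpa using h, hI, by simp, ?_⟩
    simp at hc ⊢
    omega
  · rintro s' c' - ⟨done, rest, st', φ', -, -, -, -, -, -, -, h⟩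
    simp
    omega
  · rintro s' c' hF ⟨done, rest, st', φ', h1, h2, h3, h4, h5, h6, h7, h8⟩ hlt
    have hv : ∀ a ∉ 27 :: mergeProg.wnv, s'.nv a = s.nv a := fun a ha => by
      rw [List.mem_cons, not_or] at ha
      rw [hF.nv a ha.2]; simp [ha.1]
    have h25' : s'.na 25 = s.na 25 := by rw [hF.na 25 (by decide)]; rfl
    simp only [Test.eval, NExp.eval, hv 28 (by decide), h28, h2, h1] at hlt
    cases rest with
    | nil => simp at hlt
    | cons J rest =>
      have hJmem : J ∈ l' := by simp [h1]
      have hJ0 := h0 J hJmem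
      have hJs : J ⊆ X.sources \ x.2 := (hl.mem J).1 (List.mem_cons_of_mem _ hJmem)
      have hJl : X.IsLabel (x.1, J) := ⟨hJs.trans Finset.sdiff_subset, hJ0⟩
      have hdis : Disjoint x.2 J := by
        rw [Finset.disjoint_left]
        exact fun v hv hv' => (Finset.mem_sdiff.1 (hJs hv')).2 hv
      have hul := SteinerInstance.isLabel_union hxl hJs
      have hsubJ : s.na 25 (done.length + 1) = E.mask J := by
        rw [hsub _ (by simp [h1])]
        congr 1
        simp [h1]
      have hidx : E.idx x - E.mask x.2 + E.mask J = E.idx (x.1, J) := by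
        simp [Encoding.idx]
      have hperm := h5.perm _ hJl
      rw [h4] at hperm
      change _ ↔ s'.na 13 (E.idx (x.1, J)) = 1 at hperm
      simp only [List.length_cons] at h7 h8
      obtain ⟨q, hq⟩ : ∃ q, 1100 * rest.length = q := ⟨_, rfl⟩
      rw [mul_add, hq, mul_one] at h8
      have hdr : l' = (done ++ [J]) ++ rest := by simp [h1]
      simp only [mergeProg, W_seq, W_nset, W_ite, W_skip, W_rset]
      simp only [NExp.eval, NExp.cost, RExp.eval, RExp.cost, Test.cost, Test.eval, setN_nv, setN_na,
        setN_ra, Nat.reduceEqDiff, reduceIte, Nat.reduceAdd]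
      rw [hv 23 (by decide), hv 24 (by decide), hv 25 (by decide), h25', h2, hsubJ, h23, h24, h25,
        hidx]
      refine ⟨by omega, fun hP => ?_, fun hP => ?_⟩
      · rw [← hperm] at hP
        have hJx : (x.1, J) ∈ xs := h6.mem_of_mergeable ⟨hJ0, hJs, h4 ▸ hP⟩
        have hlx := h5.l_of_ne hxl (h6.fin_of_mem hx)
        have hlJ := h5.l_of_ne hJl (h6.fin_of_mem hJx)
        have hcost : (memOf s').cost = s'.ra 1 := rfl
        rw [hcost] at hlx hlJ
        have e3 : flt (J :: rest) = J :: flt rest := by simp [hflt, hP]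
        rw [e3, SteinerInstance.mergeLoop_cons, hlx, hlJ] at h3
        refine ⟨by omega, by omega, by omega, by omega, by omega, by omega, by omega, ?_⟩
        refine (W_relax (L := L) (st := st') (φ := φ') (y := (x.1, x.2 ∪ J)) (f := f)
          (B := {x, (x.1, J)}) (r := q + 40 + r) hO ?_ ?_ hul ?_ ?_ ?_ ?_ ?_).frame.mono ?_
        · simp [hv 5 (by decide), hs.pw]
        · simpa using h5
        · simp [E.idx_union hdis]
        · simp
        · simp [E.mask_union hdis]
        -- The two labels are distinct because `J` is nonempty and disjoint from `I`; thus a merge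
        -- is never mistaken for an edge step in backtracking.
        · right; right
          refine ⟨by simp, x, (x.1, J), ?_, rfl, by simp, by simp⟩
          intro h'
          have h' := congrArg Prod.snd h'
          simp only at h'
          rw [h'] at hdis
          exact hJ0 ((Finset.disjoint_self_iff_empty _).1 hdis)
        · simp only [memOf_setN, memOf_setR, ne_eq, Nat.reduceEqDiff, not_false_eq_true]
          repeat apply Nat.le_sub_of_add_le
          linarith
        · rintro s2 c2 ⟨⟨φ2, hr2, h92, hc2⟩, hF2⟩
          have hn27 : s2.nv 27 = s'.nv 27 := by rw [hF2.nv 27 (by decide)]; simp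
          simp at hr2 h92 hc2
          rw [W_nset]
          refine ⟨by simp; omega, done ++ [J], rest, _, φ2, hdr, ?_, h3, ?_, ?_, ?_, ?_, ?_⟩
          · simp [hn27, h2]
          · rw [State.relax_P, h4]
          · simpa using hr2
          · refine h6.relax hul ?_
            rintro z (rfl | rfl)
            · exact hx
            · exact hJx
          · simp
            omega
          · simp
            omega
      · rw [← hperm] at hP
        have e3 : flt (J :: rest) = flt rest := by simp [hflt, hP]
        rw [e3] at h3
        refine ⟨by omega, by omega, done ++ [J], rest, st', φ', hdr, ?_, h3, h4, ?_, h6, ?_, ?_⟩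
        · simp
        · simpa using h5
        · omega
        · simp
          omega
  · rintro s' c' hF ⟨done, rest, st', φ', h1, h2, h3, h4, h5, h6, h7, h8⟩ hlt
    have hv : s'.nv 28 = s.nv 28 := by rw [hF.nv 28 (by decide)]; simp
    simp only [Test.eval, NExp.eval, hv, h28, h2, h1] at hlt
    cases rest with
    | cons J rest => simp at hlt
    | nil =>
      have e : st' = st.mergeLoop x (flt l') := by rw [← h3]; rfl
      refine ⟨flt l', φ', (List.nodup_cons.1 hl.nodup).2.filter _, ?_, e ▸ h5, ?_, ?_⟩
      · intro J
        have hm := hl.mem J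
        simp only [hflt, List.mem_filter, decide_eq_true_eq, SteinerInstance.Mergeable, ← hm,
          List.mem_cons]
        constructor
        · rintro ⟨a, b⟩
          exact ⟨h0 J a, Or.inr a, b⟩
        · rintro ⟨a, b, c⟩
          exact ⟨b.resolve_left a, c⟩
      · simp at h7 ⊢
        omega
      · rw [← e]
        simp at h8 ⊢
        omega

end Loops

/-! ### The program: the main loop -/

/-- One iteration of the main loop. -/
def bodyProg : Prog := extractProg ;; edgesProg ;; enumProg ;; mergesProg

/-- The main loop. -/
def mainProg : Prog := .loop (.and (.not (.neq (.get 13 §8) ¢1)) (.nlt ¢0 §7)) bodyProg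

/-- A bound for the number of insertions into the heap while the edges and sets at `x` are
processed. -/
noncomputable def SteinerInstance.pushes {V : Type*} [Fintype V] [DecidableEq V]
    (X : SteinerInstance V) (x : Label V) : ℕ :=
  X.deg x.1 + 2 ^ (X.sources \ x.2).card

/-- A bound for the amortized time of one iteration. -/
noncomputable def SteinerInstance.stepCost {V : Type*} [Fintype V] [DecidableEq V]
    (X : SteinerInstance V) (G : ℕ) (x : Label V) : ℕ :=
  600 * G + 1200 * X.pushes x + 50 * X.k + 1100

section Main

variable {O : Oracle} {s : Store} {c r G : ℕ} {V : Type*} [Fintype V] [DecidableEq V]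
  {X : SteinerInstance V} {E : Encoding X} {L : V → Finset V → ℝ} {st : State V} {φ : Forest}
  {xs : List (Label V)} {x : Label V} {f : ℕ}

/-- Every label that is not yet permanent holds credit `stepCost` and an allowance `pushes` of heap
nodes, and the selected label spends its own. A subset costs 25 units for enumeration and 1100 for
merging, within the 1200 allotted. -/
theorem W_body (hO : E.Evaluates O L f) (hs : E.Static s) (h : E.Rel L (memOf s) st φ)
    (hI : X.Inv st xs) (hN : st.N.Nonempty) (hG : ∀ k, 2 ^ (k / 2) ≤ s.nv 9 → k ≤ G)
    (hb : ∀ r, s.na 24 r = 0) (hM : s.nv 11 ≤ G) (hR : E.Records s xs)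
    (hc : potential X f (memOf s) st φ + X.pending (X.stepCost G) st + r ≤ c) :
    W O bodyProg (fun s' c' => ∃ (x : Label V) (st' : State V) (φ' : Forest),
      X.Iteration L st x st' ∧ E.Rel L (memOf s') st' φ' ∧ E.Records s' (xs ++ [x]) ∧
      (∀ r, s'.na 24 r = 0) ∧ s'.nv 11 ≤ G ∧
      s'.nv 9 + X.pending X.pushes st' ≤ s.nv 9 + X.pending X.pushes st ∧
      potential X f (memOf s') st' φ' + X.pending (X.stepCost G) st' + r + 20 ≤ c') s c := by
  have hpend : ∀ (g : Label V → ℕ), ∀ y ∈ st.N,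
      X.pending g (st.makePermanent y) + g y = X.pending g st := fun g y hy =>
    SteinerInstance.pending_makePermanent g (hI.cand y hy).1 (hI.cand y hy).2
  -- The extraction must be paid for before it is known which label it selects; any candidate
  -- guarantees enough credit.
  have hlow : 600 * G + 1100 ≤ X.pending (X.stepCost G) st := by
    obtain ⟨y, hy⟩ := hN
    rw [← hpend _ y hy]
    unfold SteinerInstance.stepCost
    omega
  obtain ⟨A, hA⟩ : ∃ A, X.pending (X.stepCost G) st = 600 * G + 700 + A :=
    Nat.exists_eq_add_of_le (by omega)
  rw [bodyProg, W_seq]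
  refine (W_extract (f := f) (r := A + r) hG h hN hb hM
    (by omega)).frame.mono ?_
  rintro s1 c1 ⟨⟨x, φ1, hx, hmin, hr1, h23, h24, h25, h4, h5, hn4, hb1, hM1, hc1⟩, hF1⟩
  obtain ⟨q, hq⟩ : ∃ q, 2 ^ (X.sources \ x.2).card = q := ⟨_, rfl⟩
  have hp : X.pending (X.stepCost G) (st.makePermanent x) +
      (600 * G + 1200 * (X.deg x.1 + q) + 50 * X.k + 1100) = X.pending (X.stepCost G) st := by
    rw [← hpend _ x hx, SteinerInstance.stepCost, SteinerInstance.pushes, hq]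
  have hp' : X.pending X.pushes (st.makePermanent x) + (X.deg x.1 + q) = X.pending X.pushes st := by
    rw [← hpend _ x hx, SteinerInstance.pushes, hq]
  have hI1 := hI.makePermanent hx
  have hxx : x ∈ xs ++ [x] := by simp
  have hs1 := hs.of_frame hF1 (by decide) (by decide) (by decide)
  have h91 : s1.nv 9 = s.nv 9 := hF1.nv 9 (by decide)
  set st1 := st.makePermanent x with hst1
  rw [W_seq]
  refine (W_edges (r := r + X.pending (X.stepCost G) st1 + 50 * X.k + 1125 * q + 300) hO hs1 hr1 hI1
    hxx h23 h24 h25 (by linarith)).frame.mono ?_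
  rintro s2 c2 ⟨⟨ws, φ2, hws, hwm, hr2, h92, hc2⟩, hF2⟩
  have hs2 := hs1.of_frame hF2 (by decide) (by decide) (by decide)
  have hI2 := hI1.edgeLoop hxx ws
  have hxl := hI1.label x hxx
  rw [W_seq]
  refine (W_enum (r := r + potential X f (memOf s2) (X.edgeLoop x ws st1) φ2 +
    X.pending (X.stepCost G) st1 + 1100 * q + 200) hs2 hxl
    (by rw [hF2.nv 25 (by decide), h25]) (by rw [hq]; omega)).frame.mono ?_
  rintro s3 c3 ⟨⟨l, hl, h28, hsub, hc3⟩, hF3⟩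
  have hs3 := hs2.of_frame hF3 (by decide) (by decide) (by decide)
  have hm3 : memOf s3 = memOf s2 := by
    simp only [memOf, heapOf, stackOf]
    rw [hF3.nv 9 (by decide), hF3.nv 10 (by decide), hF3.na 12 (by decide), hF3.na 13 (by decide),
      hF3.na 14 (by decide), hF3.na 15 (by decide), hF3.na 16 (by decide), hF3.na 17 (by decide),
      hF3.na 18 (by decide), hF3.na 19 (by decide), hF3.na 20 (by decide), hF3.na 21 (by decide),
      hF3.na 22 (by decide), hF3.na 23 (by decide), hF3.ra 1 (by decide), hF3.ra 2 (by decide),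
      hF3.ra 3 (by decide)]
  have hll := hl.length_eq
  rw [hq] at hll
  rw [← hm3] at hr2 hc3
  have k3 : ∀ a ∈ [23, 24, 25], s3.nv a = s1.nv a := by
    intro a ha
    rw [hF3.nv a (by fin_cases ha <;> decide), hF2.nv a (by fin_cases ha <;> decide)]
  refine (W_merges (r := r + X.pending (X.stepCost G) st1 + 20) hO hs3 hr2 hI2 hxx
    (by rw [k3 23 (by simp), h23]) (by rw [k3 24 (by simp), h24]) (by rw [k3 25 (by simp), h25]) hl
    h28 hsub (by rw [hll]; omega)).frame.mono ?_
  rintro s4 c4 ⟨⟨Js, φ4, hJs, hJm, hr4, h94, hc4⟩, hF4⟩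
  have hP4 : ((X.edgeLoop x ws st1).mergeLoop x Js).P = st1.P := by
    rw [SteinerInstance.mergeLoop_P, SteinerInstance.edgeLoop_P]
  refine ⟨x, (X.edgeLoop x ws st1).mergeLoop x Js, φ4,
    ⟨hx, hmin, ws, Js, hws, hwm, hJs, ?_, rfl⟩, hr4, ?_, ?_, ?_, ?_, ?_⟩
  · intro J
    rw [hJm, SteinerInstance.edgeLoop_P]
    rfl
  · have e4 : s4.nv 4 = s1.nv 4 := by
      rw [hF4.nv 4 (by decide), hF3.nv 4 (by decide), hF2.nv 4 (by decide)]
    have a4 : s4.na 4 = s1.na 4 := by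
      rw [hF4.na 4 (by decide), hF3.na 4 (by decide), hF2.na 4 (by decide)]
    have a5 : s4.na 5 = s1.na 5 := by
      rw [hF4.na 5 (by decide), hF3.na 5 (by decide), hF2.na 5 (by decide)]
    refine ⟨by rw [e4, hn4, hR.1]; simp, fun i hi => ?_⟩
    rw [a4, a5, h4, h5, hR.1]
    rcases Nat.lt_or_ge i xs.length with hlt | hge
    · rw [Function.update_of_ne (by omega), Function.update_of_ne (by omega),
        List.getElem_append_left hlt]
      exact hR.2 i hlt
    · obtain rfl : i = xs.length := by simp at hi; omega
      simp
  · intro r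
    rw [hF4.na 24 (by decide), hF3.na 24 (by decide), hF2.na 24 (by decide)]
    exact hb1 r
  · rw [hF4.nv 11 (by decide), hF3.nv 11 (by decide), hF2.nv 11 (by decide)]
    exact hM1
  · rw [SteinerInstance.pending_congr hP4]
    have h93 : s3.nv 9 = s2.nv 9 := hF3.nv 9 (by decide)
    omega
  · rw [SteinerInstance.pending_congr hP4]
    omega

/-- The number of nodes created so far plus the allowance of pending labels never increases. Its
initial value therefore bounds the size of the heap, and with it all ranks of roots, throughout the
run. -/
theorem W_main (hO : E.Evaluates O L f) (hs : E.Static s) (h : E.Rel L (memOf s) X.init φ)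
    (hb : ∀ r, s.na 24 r = 0) (hM : s.nv 11 = 0) (h4 : s.nv 4 = 0)
    (hG : ∀ k, 2 ^ (k / 2) ≤ s.nv 9 + X.pending X.pushes X.init → k ≤ G)
    (hc : potential X f (memOf s) X.init φ + X.pending (X.stepCost G) X.init + 10 + r ≤ c) :
    W O mainProg (fun s' c' => ∃ (xs : List (Label V)) (st : State V) (φ' : Forest),
      X.MainLoop L X.init xs st ∧ (X.root, X.sources) ∈ st.P ∧ X.Inv st xs ∧
      E.Rel L (memOf s') st φ' ∧ E.Records s' xs ∧ E.Static s' ∧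
      r ≤ c') s c := by
  have hm0 : E.mask X.sources = 0 ↔ X.sources = ∅ := by
    constructor
    · intro h0
      exact E.mask_injOn (Finset.erase_subset _ _) (Finset.empty_subset _)
        (h0.trans E.mask_empty.symm)
    · intro h0
      rw [h0, E.mask_empty]
  have hgoal : ∀ (s' : Store) (st : State V) (φ' : Forest) (xs : List (Label V)), E.Static s' →
      E.Rel L (memOf s') st φ' → X.Inv st xs →
      ((Test.and (.not (.neq (.get 13 §8) ¢1)) (.nlt ¢0 §7)).eval s' ↔
        (X.root, X.sources) ∉ st.P) := by
    intro s' st φ' xs hs' hr' hI'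
    simp only [Test.eval, NExp.eval, hs'.goal, hs'.sm]
    -- With a single terminal the goal `(root, ∅)` is permanent from the start, but the flags
    -- describe only labels with nonempty sets; the second conjunct of the test stops the loop in
    -- this case.
    by_cases h0 : X.sources = ∅
    · rw [hm0.2 h0, h0]
      simp only [lt_irrefl, and_false, false_iff, not_not]
      exact (hI'.perm _).2 (Or.inl rfl)
    · rw [hr'.perm _ ⟨subset_rfl, h0⟩]
      have : 0 < E.mask X.sources := Nat.pos_of_ne_zero fun h' => h0 (hm0.1 h')
      simp only [this, and_true]
      rfl
  -- `MainLoop` is built from its first step, so the part already executed is recorded as a way to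
  -- extend every continuation from the current state.
  refine W_loop (fun s' c' => ∃ (xs : List (Label V)) (st : State V) (φ' : Forest),
    E.Static s' ∧ E.Rel L (memOf s') st φ' ∧ X.Inv st xs ∧ X.Closed st xs ∧
    (∀ ys s'', X.MainLoop L st ys s'' → X.MainLoop L X.init (xs ++ ys) s'') ∧
    E.Records s' xs ∧ (∀ r, s'.na 24 r = 0) ∧ s'.nv 11 ≤ G ∧
    s'.nv 9 + X.pending X.pushes st ≤ s.nv 9 + X.pending X.pushes X.init ∧
    potential X f (memOf s') st φ' + X.pending (X.stepCost G) st + 10 + r ≤ c') ?_ ?_ ?_ ?_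
  · exact ⟨[], X.init, φ, hs, h, SteinerInstance.inv_init, SteinerInstance.closed_init,
      fun _ _ h => h, ⟨by simp [h4], by simp⟩, hb, by omega, le_rfl, hc⟩
  · rintro s' c' - ⟨xs, st, φ', -, -, -, -, -, -, -, -, -, h⟩
    simp
    omega
  · rintro s' c' - ⟨xs, st, φ', h1, h2, h3, h4, h5, h6, h7, h8, h9, h10⟩ ht
    rw [hgoal s' st φ' xs h1 h2 h3] at ht
    have hN := h4.nonempty h3 ht
    refine (W_body (r := r) hO h1 h2 h3 hN (fun k hk => hG k (by omega)) h7 h8 h6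
      (by simp; omega)).frame.mono ?_
    rintro s2 c2 ⟨⟨x, st2, φ2, hit, hr2, hR2, hb2, hM2, h92, hc2⟩, hF⟩
    obtain ⟨hI2, hC2⟩ := h3.iteration h4 hit
    refine ⟨xs ++ [x], st2, φ2, h1.of_frame hF (by decide) (by decide) (by decide), hr2, hI2, hC2,
      ?_, hR2, hb2, hM2, by omega, by omega⟩
    intro ys s'' hm
    rw [List.append_assoc]
    exact h5 _ _ (.step _ _ _ _ _ ht hit hm)
  · rintro s' c' - ⟨xs, st, φ', h1, h2, h3, h4, h5, h6, h7, h8, h9, h10⟩ ht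
    rw [hgoal s' st φ' xs h1 h2 h3, not_not] at ht
    refine ⟨xs, st, φ', ?_, ht, h3, h2, h6, h1, ?_⟩
    · simpa using h5 [] st (.done _ ht)
    · simp
      omega

end Main

/-! ### The program: initialization -/

/-- Computes the powers of two. -/
def powProg : Prog :=
  .nset 5 ¢1 ;; .nset 27 ¢0 ;;
  .loop (.nlt §27 §2) (.nput 10 §27 §5 ;; .nset 5 (.add §5 §5) ;; .nset 27 (.add §27 ¢1))

/-- Computes the first index for each vertex. -/
def rowProg : Prog :=
  .nset 28 ¢0 ;; .nset 27 ¢0 ;;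
  .loop (.nlt §27 §0) (.nput 11 §27 §28 ;; .nset 28 (.add §28 §5) ;; .nset 27 (.add §27 ¢1))

/-- Adds the half-edge that leads from the vertex in array `a` to the vertex in array `b`. -/
def halfProg (a b : ℕ) : Prog :=
  .nset 26 (.add §26 ¢1) ;; .nput 8 §26 (.get b §27) ;; .nput 9 §26 §27 ;;
  .nput 7 §26 (.get 6 (.get a §27)) ;; .nput 6 (.get a §27) §26

/-- Computes the adjacency lists. -/
def adjProg : Prog :=
  .nset 26 ¢0 ;; .nset 27 ¢0 ;;
  .loop (.nlt §27 §1) (halfProg 0 1 ;; halfProg 1 0 ;; .nset 27 (.add §27 ¢1))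

/-- Inserts the labels of the source terminals. -/
def sourcesProg : Prog :=
  .rset 0 .zero ;; .nset 27 ¢0 ;;
  .loop (.nlt §27 §2)
    (.ite (.neq §27 §3) .skip
      (.nset 13 (.get 2 §27) ;; .nset 12 (.add (.get 11 §13) (.get 10 §27)) ;;
        .nset 14 (.get 10 §27) ;; .nset 15 ¢0 ;; relaxProg) ;;
      .nset 27 (.add §27 ¢1))

/-- The initialization. -/
def initProg : Prog :=
  powProg ;; rowProg ;; adjProg ;; .nset 7 (.sub (.sub §5 ¢1) (.get 10 §3)) ;;
  .nset 8 (.add (.get 11 (.get 2 §3)) §7) ;; sourcesProg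

section Init

variable {O : Oracle} {s : Store} {c r : ℕ}

theorem W_pow (hc : 20 * s.nv 2 + 20 + r ≤ c) :
    W O powProg (fun s' c' => s'.nv 5 = 2 ^ s.nv 2 ∧ (∀ j < s.nv 2, s'.na 10 j = 2 ^ j) ∧
      r ≤ c') s c := by
  simp only [powProg, W_seq, W_nset]
  simp only [NExp.eval, NExp.cost]
  refine ⟨by omega, by omega, ?_⟩
  refine W_loop (fun s' c' => s'.nv 27 ≤ s.nv 2 ∧ s'.nv 5 = 2 ^ s'.nv 27 ∧
    (∀ j < s'.nv 27, s'.na 10 j = 2 ^ j) ∧ 20 * s.nv 2 + 10 + r ≤ c' + 20 * s'.nv 27) ?_ ?_ ?_ ?_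
  · simp
    omega
  · rintro s' c' - ⟨h1, -, -, h⟩
    simp
    omega
  · rintro s' c' hF ⟨h1, h2, h3, h4⟩ hlt
    have hv : s'.nv 2 = s.nv 2 := by rw [hF.nv 2 (by decide)]; simp
    simp only [Test.eval, NExp.eval, hv] at hlt
    simp only [W_seq, W_nset, W_nput]
    simp
    refine ⟨by omega, by omega, by omega, by omega, by rw [h2, pow_succ]; omega, ?_, by omega⟩
    intro j hj
    rcases Nat.lt_or_ge j (s'.nv 27) with hj' | hj'
    · rw [Function.update_of_ne (by omega)]
      exact h3 j hj'
    · obtain rfl : j = s'.nv 27 := by omega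
      rw [Function.update_self, h2]
  · rintro s' c' hF ⟨h1, h2, h3, h4⟩ hlt
    have hv : s'.nv 2 = s.nv 2 := by rw [hF.nv 2 (by decide)]; simp
    simp only [Test.eval, NExp.eval, hv, not_lt] at hlt
    have e : s'.nv 27 = s.nv 2 := by omega
    rw [e] at h2 h3
    simp
    exact ⟨h2, h3, by omega⟩

theorem W_row (hc : 20 * s.nv 0 + 20 + r ≤ c) :
    W O rowProg (fun s' c' => (∀ j < s.nv 0, s'.na 11 j = j * s.nv 5) ∧ r ≤ c') s c := by
  simp only [rowProg, W_seq, W_nset]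
  simp only [NExp.eval, NExp.cost]
  refine ⟨by omega, by omega, ?_⟩
  refine W_loop (fun s' c' => s'.nv 27 ≤ s.nv 0 ∧ s'.nv 28 = s'.nv 27 * s.nv 5 ∧
    (∀ j < s'.nv 27, s'.na 11 j = j * s.nv 5) ∧ 20 * s.nv 0 + 10 + r ≤ c' + 20 * s'.nv 27)
    ?_ ?_ ?_ ?_
  · simp
    omega
  · rintro s' c' - ⟨h1, -, -, h⟩
    simp
    omega
  · rintro s' c' hF ⟨h1, h2, h3, h4⟩ hlt
    have hv : s'.nv 0 = s.nv 0 := by rw [hF.nv 0 (by decide)]; simp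
    have hv5 : s'.nv 5 = s.nv 5 := by rw [hF.nv 5 (by decide)]; simp
    simp only [Test.eval, NExp.eval, hv] at hlt
    simp only [W_seq, W_nset, W_nput]
    simp [hv5]
    refine ⟨by omega, by omega, by omega, by omega, by rw [h2, Nat.succ_mul], ?_, by omega⟩
    intro j hj
    rcases Nat.lt_or_ge j (s'.nv 27) with hj' | hj'
    · rw [Function.update_of_ne (by omega)]
      exact h3 j hj'
    · obtain rfl : j = s'.nv 27 := by omega
      rw [Function.update_self, h2]
  · rintro s' c' hF ⟨h1, h2, h3, h4⟩ hlt
    have hv : s'.nv 0 = s.nv 0 := by rw [hF.nv 0 (by decide)]; simp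
    simp only [Test.eval, NExp.eval, hv, not_lt] at hlt
    have e : s'.nv 27 = s.nv 0 := by omega
    rw [e] at h3
    simp
    exact ⟨h3, by omega⟩

variable {V : Type*} [Fintype V] [DecidableEq V] {X : SteinerInstance V} {E : Encoding X}
  {L : V → Finset V → ℝ} {st : State V} {φ : Forest} {f : ℕ}

/-- The half-edges up to the one in register `26` form adjacency lists for the relation `P`. -/
def Encoding.AdjUpTo (E : Encoding X) (P : V → V → Prop) (s : Store) : Prop :=
  ∀ v, ∃ ps, E.AdjList (P v) (s.na 6) (s.na 7) (s.na 8) (s.na 9) v ps ∧ ∀ p ∈ ps, p.1 ≤ s.nv 26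

/-- Half-edges are numbered from `1`, since `0` ends a list. The new number exceeds all numbers in
use, so the writes do not disturb existing lists; `hP` keeps the neighbours in the list of `u`
distinct. -/
theorem W_half {P : V → V → Prop} (h : E.AdjUpTo P s) {a b : ℕ} (ha : a < 6) (hb : b < 6)
    {u w : V} (i : Fin X.m) (hi : s.nv 27 = i) (hu : s.na a i = E.vertex u)
    (hw : s.na b i = E.vertex w) (he : s(E.tail i, E.head i) = s(u, w)) (hP : ¬ P u w)
    (hc : 25 + r ≤ c) :
    W O (halfProg a b) (fun s' c' => E.AdjUpTo (fun v z => P v z ∨ v = u ∧ z = w) s' ∧ r ≤ c')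
      s c := by
  have a7 : a ≠ 7 := by omega
  have a8 : a ≠ 8 := by omega
  have a9 : a ≠ 9 := by omega
  have b8 : b ≠ 8 := by omega
  simp only [halfProg, W_seq, W_nset, W_nput]
  simp [a7, a8, a9, b8, hi, hu, hw]
  refine ⟨by omega, by omega, by omega, by omega, by omega, ?_, by omega⟩
  intro v
  obtain ⟨ps, ⟨h1, h2, h3, h4⟩, h5⟩ := h v
  have hne : ∀ p ∈ ps, p.1 ≠ s.nv 26 + 1 := fun p hp => by have := h5 p hp; omega
  have hch : Chained (Function.update (s.na 7) (s.nv 26 + 1) (s.na 6 (E.vertex u)))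
      (s.na 6 (E.vertex v)) (ps.map Prod.fst) := by
    refine h1.congr ?_
    intro c hc
    obtain ⟨p, hp, rfl⟩ := List.mem_map.1 hc
    rw [Function.update_of_ne (hne p hp)]
  have hdata : ∀ p ∈ ps, Function.update (s.na 8) (s.nv 26 + 1) (E.vertex w : ℕ) p.1 = E.vertex p.2 ∧
      ∃ i' : Fin X.m, Function.update (s.na 9) (s.nv 26 + 1) (i : ℕ) p.1 = i' ∧
        s(E.tail i', E.head i') = s(v, p.2) := by
    intro p hp
    rw [Function.update_of_ne (hne p hp), Function.update_of_ne (hne p hp)]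
    exact h4 p hp
  by_cases hv : v = u
  · subst hv
    refine ⟨(s.nv 26 + 1, w) :: ps, ⟨?_, ?_, ?_, ?_⟩, ?_⟩
    · simpa [Chained] using hch
    · simp only [List.map_cons, List.nodup_cons]
      exact ⟨fun h' => hP ((h3 w).1 h'), h2⟩
    · intro z
      simp only [List.map_cons, List.mem_cons, h3]
      simp [or_comm]
    · intro p hp
      rcases List.mem_cons.1 hp with rfl | hp
      · exact ⟨by simp, i, by simp, he⟩
      · simpa using hdata p hp
    · intro p hp
      rcases List.mem_cons.1 hp with rfl | hp
      · simp
      · have := h5 p hp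
        simp
        omega
  · have hvu : (E.vertex v : ℕ) ≠ E.vertex u := fun h' => hv (E.vertex.injective (Fin.ext h'))
    refine ⟨ps, ⟨?_, h2, ?_, ?_⟩, ?_⟩
    · simpa [Function.update_of_ne hvu] using hch
    · intro z
      simp [h3, hv]
    · simpa using hdata
    · intro p hp
      have := h5 p hp
      simp
      omega

theorem W_adj (h1 : s.nv 1 = X.m) (ht : ∀ i : Fin X.m, s.na 0 i = E.vertex (E.tail i))
    (hh : ∀ i : Fin X.m, s.na 1 i = E.vertex (E.head i)) (h6 : ∀ i, s.na 6 i = 0)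
    (hc : 80 * X.m + 20 + r ≤ c) :
    W O adjProg (fun s' c' => (∀ v, ∃ ps, E.AdjList (X.G.Adj v) (s'.na 6) (s'.na 7) (s'.na 8)
      (s'.na 9) v ps) ∧ r ≤ c') s c := by
  set P : ℕ → V → V → Prop := fun i v w => ∃ e : Fin X.m, (e : ℕ) < i ∧
    s(E.tail e, E.head e) = s(v, w) with hP
  simp only [adjProg, W_seq, W_nset]
  simp only [NExp.eval, NExp.cost]
  refine ⟨by omega, by omega, ?_⟩
  refine W_loop (fun s' c' => s'.nv 27 ≤ X.m ∧ E.AdjUpTo (P (s'.nv 27)) s' ∧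
    80 * X.m + 10 + r ≤ c' + 80 * s'.nv 27) ?_ ?_ ?_ ?_
  · refine ⟨by simp, fun v => ⟨[], ⟨?_, by simp, ?_, by simp⟩, by simp⟩, by simp; omega⟩
    · simp [Chained, h6]
    · intro w
      simp [hP]
  · rintro s' c' - ⟨h1, -, h⟩
    simp
    omega
  · rintro s' c' hF ⟨h2, h3, h4⟩ hlt
    have hv : s'.nv 1 = X.m := by rw [hF.nv 1 (by decide), ← h1]; simp
    simp only [Test.eval, NExp.eval, hv] at hlt
    set i : Fin X.m := ⟨s'.nv 27, hlt⟩ with hi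
    have ht' : s'.na 0 i = E.vertex (E.tail i) := by rw [hF.na 0 (by decide)]; exact ht i
    have hh' : s'.na 1 i = E.vertex (E.head i) := by rw [hF.na 1 (by decide)]; exact hh i
    have hadj : X.G.Adj (E.tail i) (E.head i) := E.edge_bij.mapsTo (Set.mem_univ i)
    have hinj : ∀ e : Fin X.m, s(E.tail e, E.head e) = s(E.tail i, E.head i) → e = i := fun e he =>
      E.edge_bij.injOn (Set.mem_univ e) (Set.mem_univ i) he
    -- Each edge is listed only once, so neither half is present before; and as the graph has no
    -- loops, the first half does not coincide with the second.
    have hnP : ¬ P (s'.nv 27) (E.tail i) (E.head i) := by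
      rintro ⟨e, he, he'⟩
      rw [hinj e he'] at he
      simp [hi] at he
    rw [W_seq]
    refine (W_half (r := 35 + (80 * X.m + 10 + r - 80 * (s'.nv 27 + 1))) h3 (by omega) (by omega) i
      rfl ht' hh' rfl hnP (by simp; omega)).frame.mono ?_
    rintro s2 c2 ⟨⟨h3, hc2⟩, hF2⟩
    have ht2 : s2.na 0 i = E.vertex (E.tail i) := by rw [hF2.na 0 (by decide)]; exact ht'
    have hh2 : s2.na 1 i = E.vertex (E.head i) := by rw [hF2.na 1 (by decide)]; exact hh'
    have e2 : s2.nv 27 = s'.nv 27 := hF2.nv 27 (by decide)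
    rw [W_seq]
    refine (W_half (r := 10 + (80 * X.m + 10 + r - 80 * (s'.nv 27 + 1))) h3 (by omega) (by omega) i
      e2 hh2 ht2 Sym2.eq_swap ?_ (by omega)).frame.mono ?_
    · rintro (⟨e, he, he'⟩ | ⟨h', -⟩)
      · rw [hinj e (he'.trans Sym2.eq_swap)] at he
        simp [hi] at he
      · exact hadj.ne h'.symm
    · rintro s3 c3 ⟨⟨h3, hc3⟩, hF3⟩
      have e3 : s3.nv 27 = s'.nv 27 := by rw [hF3.nv 27 (by decide), e2]
      simp only [W_nset, NExp.cost, NExp.eval]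
      refine ⟨by omega, by simp [e3]; omega, ?_, by simp [e3]; omega⟩
      intro v
      obtain ⟨ps, ⟨a1, a2, a3, a4⟩, a5⟩ := h3 v
      refine ⟨ps, ⟨by simpa using a1, a2, fun w => ?_, by simpa using a4⟩, by simpa using a5⟩
      rw [a3]
      simp only [hP, setN_nv, if_true, e3]
      constructor
      · rintro ((⟨e, he, he'⟩ | ⟨rfl, rfl⟩) | ⟨rfl, rfl⟩)
        · exact ⟨e, by omega, he'⟩
        · exact ⟨i, by simp [hi], rfl⟩
        · exact ⟨i, by simp [hi], Sym2.eq_swap⟩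
      · rintro ⟨e, he, he'⟩
        rcases Nat.lt_or_ge (e : ℕ) (s'.nv 27) with hlt' | hge
        · exact Or.inl (Or.inl ⟨e, hlt', he'⟩)
        · obtain rfl : e = i := Fin.ext (by simp [hi]; omega)
          rcases Sym2.eq_iff.1 he' with ⟨rfl, rfl⟩ | ⟨rfl, rfl⟩
          · exact Or.inl (Or.inr ⟨rfl, rfl⟩)
          · exact Or.inr ⟨rfl, rfl⟩
  · rintro s' c' hF ⟨h2, h3, h4⟩ hlt
    have hv : s'.nv 1 = X.m := by rw [hF.nv 1 (by decide), ← h1]; simp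
    simp only [Test.eval, NExp.eval, hv, not_lt] at hlt
    have e : s'.nv 27 = X.m := by omega
    refine ⟨fun v => ?_, by simp; omega⟩
    obtain ⟨ps, ⟨a1, a2, a3, a4⟩, -⟩ := h3 v
    refine ⟨ps, a1, a2, fun w => ?_, a4⟩
    rw [a3, e]
    constructor
    · rintro ⟨e, -, he⟩
      have := E.edge_bij.mapsTo (Set.mem_univ e)
      simp only [he] at this
      exact this
    · intro hvw
      obtain ⟨e, -, he⟩ := E.edge_bij.surjOn (show s(v, w) ∈ X.G.edgeSet from hvw)
      exact ⟨e, e.2, he⟩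

open Classical in
/-- The initial state if only the terminals in `T` are used as sources. -/
noncomputable def initOn (T : Finset V) : State V where
  l := fun x => if x.2 = ∅ ∨ (x.1 ∈ T ∧ x.2 = {x.1}) then 0 else ⊤
  b := fun _ => ∅
  N := {x | x.1 ∈ T ∧ x.2 = {x.1}}
  P := {x | x.2 = ∅}

theorem initOn_sources : initOn X.sources = X.init := rfl

/-- Making `t` a source is a relaxation with cost `0` and no predecessor, so `relaxProg` also builds
the initial state. -/
theorem initOn_relax {T : Finset V} {t : V} (ht : t ∉ T) :
    (initOn T).relax (t, {t}) 0 ∅ = initOn (insert t T) := by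
  have h1 : (initOn T).l (t, {t}) = ⊤ := by simp [initOn, ht]
  rw [State.relax_of ⟨by rw [h1]; exact WithTop.coe_lt_top 0, by simp [initOn]⟩]
  simp only [initOn, State.mk.injEq, and_true]
  refine ⟨?_, ?_, ?_⟩
  · ext x
    rcases eq_or_ne x (t, {t}) with rfl | hx
    · simp
    · rw [Function.update_of_ne hx]
      have : ¬ (x.1 = t ∧ x.2 = {x.1}) := by
        rintro ⟨h2, h3⟩
        exact hx (Prod.ext h2 (h2 ▸ h3))
      congr 1
      simp only [Finset.mem_insert, eq_iff_iff]
      tauto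
  · simp
  · ext x
    simp only [Set.mem_insert_iff, Set.mem_ofPred_eq, Finset.mem_insert]
    constructor
    · rintro (rfl | ⟨h2, h3⟩)
      · simp
      · exact ⟨Or.inr h2, h3⟩
    · rintro ⟨rfl | h2, h3⟩
      · exact Or.inl (Prod.ext rfl h3)
      · exact Or.inr ⟨h2, h3⟩

/-- Zero means infinite cost, not permanent and no predecessor, so the blank memory needs no
initialization for the individual labels. -/
theorem rel_initOn_empty {μ : Mem} (hc : ∀ i, μ.heap.node i = 0) (hr : ∀ i, μ.heap.rank i = 0)
    (hs : μ.stack = []) (hp : ∀ i, μ.perm i = 0) (hk : ∀ i, μ.kind i = 0) :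
    E.Rel L μ (initOn ∅) ⟨∅, fun _ => [], fun _ => 0⟩ := by
  have hl : ∀ x, X.IsLabel x → x.2 ≠ ∅ := fun x hx => hx.2
  refine ⟨⟨by simp, by simp [hc], by simp [hc], rfl, hr 0, by simp, by simp, by simp, by simp,
    by simp⟩, ⟨by simp [hs], by simp [hs]⟩, ?_, ?_, ?_, ?_, ?_, ?_, by simp, ?_, by simp⟩
  · intro x hx
    simp [initOn, hc, hl x hx]
  · intro x hx
    simp [initOn, hp, hl x hx]
  · intro x hx
    simp [initOn, hc]
  · simp [initOn]
  · intro x hx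
    simp [hc]
  · intro x hx
    exact Or.inl ⟨hk _, rfl⟩
  · intro x hx
    simp [hc]

theorem W_sources (hO : E.Evaluates O L f) (h : E.Rel L (memOf s) (initOn ∅) φ)
    (h2 : s.nv 2 = X.k) (h3 : s.nv 3 = E.rootIndex) (h5 : s.nv 5 = 2 ^ X.k)
    (ht : ∀ j : Fin X.k, s.na 2 j = E.vertex (E.term j)) (hpow : ∀ j < X.k, s.na 10 j = 2 ^ j)
    (hrow : ∀ v, s.na 11 (E.vertex v) = E.vertex v * 2 ^ X.k)
    (hc : potential X f (memOf s) (initOn ∅) φ + 1100 * X.k + 20 + r ≤ c) :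
    W O sourcesProg (fun s' c' => ∃ φ', E.Rel L (memOf s') X.init φ' ∧ s'.nv 9 ≤ s.nv 9 + X.k ∧
      potential X f (memOf s') X.init φ' + r ≤ c') s c := by
  simp only [sourcesProg, W_seq, W_nset, W_rset]
  simp only [NExp.eval, NExp.cost, RExp.eval, RExp.cost]
  refine ⟨by omega, by omega, ?_⟩
  refine W_loop (fun s' c' => ∃ (T : Finset V) (φ' : Forest), s'.nv 27 ≤ X.k ∧
    (∀ v, v ∈ T ↔ ∃ j : Fin X.k, (j : ℕ) < s'.nv 27 ∧ j ≠ E.rootIndex ∧ E.term j = v) ∧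
    E.Rel L (memOf s') (initOn T) φ' ∧ s'.nv 9 ≤ s.nv 9 + s'.nv 27 ∧
    potential X f (memOf s') (initOn T) φ' + 1100 * X.k + 10 + r ≤ c' + 1100 * s'.nv 27) ?_ ?_ ?_ ?_
  · refine ⟨∅, φ, by simp, by simp, by simpa using h, by simp, ?_⟩
    simp
    omega
  · rintro s' c' - ⟨T, φ', h1, -, -, -, h⟩
    simp
    omega
  · rintro s' c' hF ⟨T, φ', h1, hT, hr, h9, h10⟩ hlt
    have hv : ∀ a ∈ [2, 3, 5], s'.nv a = s.nv a := fun a ha => by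
      rw [hF.nv a (by fin_cases ha <;> decide)]
      fin_cases ha <;> simp
    have ha : ∀ a ∈ [2, 10, 11], s'.na a = s.na a := fun a ha => by
      rw [hF.na a (by fin_cases ha <;> decide)]; rfl
    have hrv : s'.rv 0 = 0 := by
      rw [hF.rv 0 (by decide)]; simp
    simp only [Test.eval, NExp.eval, hv 2 (by simp), h2] at hlt
    obtain ⟨i, hi⟩ : ∃ i : Fin X.k, s'.nv 27 = i := ⟨⟨s'.nv 27, hlt⟩, rfl⟩
    have hTi : E.term i ∉ T := by
      rw [hT]
      rintro ⟨j, hj, -, hj'⟩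
      rw [E.term_injective hj'] at hj
      omega
    -- The number `q` is the credit reserved for the remaining terminals together with `r`.
    obtain ⟨q, hq⟩ : ∃ q, 1100 * X.k + r = q + 1100 * (s'.nv 27 + 1) :=
      ⟨1100 * (X.k - (s'.nv 27 + 1)) + r, by omega⟩
    simp only [W_seq, W_nset, W_ite, W_skip]
    simp only [NExp.eval, NExp.cost, Test.cost, Test.eval, setN_nv, setN_na, Nat.reduceEqDiff,
      reduceIte, Nat.reduceAdd]
    rw [hv 3 (by simp), h3, ha 2 (by simp), ha 10 (by simp), ha 11 (by simp), hi, ht, hrow,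
      hpow i i.2]
    refine ⟨by omega, fun hroot => ?_, fun hroot => ?_⟩
    · refine ⟨by omega, by omega, T, φ', by omega, ?_, by simpa using hr, by omega, ?_⟩
      · intro v
        rw [hT, hi]
        constructor
        · rintro ⟨j, hj, hj'⟩
          exact ⟨j, by omega, hj'⟩
        · rintro ⟨j, hj, hj1, hj2⟩
          refine ⟨j, ?_, hj1, hj2⟩
          have : (j : ℕ) ≠ E.rootIndex := fun h' => hj1 (Fin.ext h')
          omega
      · simp
        omega
    · have hlab : X.IsLabel (E.term i, {E.term i}) := by
        refine ⟨Finset.singleton_subset_iff.2 (Finset.mem_erase.2 ⟨?_, E.term_mem i⟩),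
          Finset.singleton_ne_empty _⟩
        rw [← E.term_rootIndex]
        exact fun h' => hroot (congrArg Fin.val (E.term_injective h'))
      refine ⟨by omega, by omega, by omega, by omega, ?_⟩
      refine (W_relax (L := L) (st := initOn T) (φ := φ') (y := (E.term i, {E.term i})) (f := f)
        (B := ∅) (r := q + 30) hO ?_ ?_ hlab ?_ ?_ ?_ ?_ ?_).frame.mono ?_
      · simp [hv 5 (by simp), h5]
      · simpa using hr
      · simp [Encoding.idx, E.mask_singleton_term]
      · simp
      · simp [E.mask_singleton_term]
      · exact Or.inl ⟨by simp, rfl⟩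
      · simp only [memOf_setN, ne_eq, Nat.reduceEqDiff, not_false_eq_true]
        repeat apply Nat.le_sub_of_add_le
        linarith
      · rintro s2 c2 ⟨⟨φ2, hr2, h92, hc2⟩, hF2⟩
        have hn27 : s2.nv 27 = i := by rw [hF2.nv 27 (by decide)]; simp [hi]
        simp only [setN_nv, setN_rv, hrv, Nat.reduceEqDiff, reduceIte, WithTop.coe_zero,
          initOn_relax hTi] at hr2 h92 hc2
        rw [W_nset]
        simp only [NExp.cost, NExp.eval, hn27]
        refine ⟨by omega, insert (E.term i) T, φ2, by simp, ?_, by simpa using hr2, ?_, ?_⟩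
        · intro v
          simp only [Finset.mem_insert, hT, setN_nv, if_true]
          constructor
          · rintro (rfl | ⟨j, hj, hj'⟩)
            · exact ⟨i, by omega, fun h' => hroot (congrArg Fin.val h'), rfl⟩
            · exact ⟨j, by omega, hj'⟩
          · rintro ⟨j, hj, hj1, hj2⟩
            rcases Nat.lt_or_ge (j : ℕ) i with hlt' | hge
            · exact Or.inr ⟨j, by omega, hj1, hj2⟩
            · obtain rfl : j = i := Fin.ext (by omega)
              exact Or.inl hj2.symm
        · simp
          omega
        · simp
          rw [hi] at hq
          have := Nat.le_sub_of_add_le (show _ + q + 26 + 4 ≤ c2 from hc2)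
          linarith
  · rintro s' c' hF ⟨T, φ', h1, hT, hr, h9, h10⟩ hlt
    have hv : s'.nv 2 = s.nv 2 := by rw [hF.nv 2 (by decide)]; simp
    simp only [Test.eval, NExp.eval, hv, h2, not_lt] at hlt
    have e : s'.nv 27 = X.k := by omega
    have hTs : T = X.sources := by
      ext v
      rw [hT, SteinerInstance.sources, Finset.mem_erase, e]
      constructor
      · rintro ⟨j, -, hj1, rfl⟩
        refine ⟨?_, E.term_mem j⟩
        rw [← E.term_rootIndex]
        exact fun h' => hj1 (E.term_injective h')
      · rintro ⟨hv1, hv2⟩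
        obtain ⟨j, rfl⟩ := E.exists_term hv2
        refine ⟨j, j.2, ?_, rfl⟩
        rintro rfl
        exact hv1 E.term_rootIndex
    rw [hTs, initOn_sources] at hr h10
    refine ⟨φ', hr, by omega, ?_⟩
    simp
    omega

end Init

/-! ### The program: backtracking -/

/-- Runs through the selected labels in reverse order, marking the labels that are reached by
backtracking and putting the edges that are found into the output. -/
def backProg : Prog :=
  .nput 26 §8 ¢1 ;; .nset 27 §4 ;;
  .loop (.nlt ¢0 §27)
    (.nset 27 (.sub §27 ¢1) ;; .nset 23 (.add (.get 11 (.get 4 §27)) (.get 5 §27)) ;;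
      .ite (.neq (.get 26 §23) ¢1)
        (.ite (.neq (.get 16 §23) ¢1) (.nput 3 (.get 18 §23) ¢1 ;; .nput 26 (.get 17 §23) ¢1)
          (.ite (.neq (.get 16 §23) ¢2)
            (.nput 26 (.get 17 §23) ¢1 ;; .nput 26 (.get 18 §23) ¢1) .skip))
        .skip)

section Init

variable {O : Oracle} {c r : ℕ} {V : Type*} [Fintype V] [DecidableEq V] {X : SteinerInstance V}
  {E : Encoding X} {L : V → Finset V → ℝ} {f : ℕ}

theorem W_init (hO : E.Evaluates O L f)
    (hc : (f + 100) * X.labels.card + 1200 * X.k + 20 * X.n + 80 * X.m + 200 + r ≤ c) :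
    W O initProg (fun s' c' => ∃ φ : Forest, E.Static s' ∧ E.Rel L (memOf s') X.init φ ∧
      (∀ i, s'.na 24 i = 0) ∧ s'.nv 11 = 0 ∧ s'.nv 4 = 0 ∧ s'.nv 9 ≤ X.k ∧
      (∀ i, s'.na 3 i = 0) ∧ (∀ i, s'.na 26 i = 0) ∧
      potential X f (memOf s') X.init φ + r ≤ c') E.input c := by
  have hn0 : E.input.nv 0 = X.n := rfl
  have hn1 : E.input.nv 1 = X.m := rfl
  have hn2 : E.input.nv 2 = X.k := rfl
  have hn3 : E.input.nv 3 = E.rootIndex := rfl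
  obtain ⟨A, hA⟩ : ∃ A, (f + 100) * X.labels.card = A := ⟨_, rfl⟩
  rw [hA] at hc
  rw [initProg, W_seq]
  refine (W_pow (r := A + 1180 * X.k + 20 * X.n + 80 * X.m + 180 + r)
    (by rw [hn2]; linarith)).frame.mono ?_
  rintro s1 c1 ⟨⟨h5, h10, hc1⟩, hF1⟩
  rw [hn2] at h5 h10
  rw [W_seq]
  refine (W_row (r := A + 1180 * X.k + 80 * X.m + 160 + r)
    (by rw [hF1.nv 0 (by decide), hn0]; linarith)).frame.mono ?_
  rintro s2 c2 ⟨⟨h11, hc2⟩, hF2⟩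
  rw [hF1.nv 0 (by decide), hn0, h5] at h11
  rw [W_seq]
  refine (W_adj (E := E) (r := A + 1180 * X.k + 140 + r) ?_ ?_ ?_ ?_ (by linarith)).frame.mono ?_
  · rw [hF2.nv 1 (by decide), hF1.nv 1 (by decide), hn1]
  · intro i
    rw [hF2.na 0 (by decide), hF1.na 0 (by decide)]
    simp [Encoding.input]
  · intro i
    rw [hF2.na 1 (by decide), hF1.na 1 (by decide)]
    simp [Encoding.input]
  · intro i
    rw [hF2.na 6 (by decide), hF1.na 6 (by decide)]
    simp [Encoding.input]
  rintro s3 c3 ⟨⟨hadj, hc3⟩, hF3⟩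
  have kv : ∀ a ∉ powProg.wnv ++ rowProg.wnv ++ adjProg.wnv, s3.nv a = E.input.nv a := by
    intro a ha
    simp only [List.mem_append, not_or] at ha
    rw [hF3.nv a ha.2, hF2.nv a ha.1.2, hF1.nv a ha.1.1]
  have ka : ∀ a ∉ powProg.wna ++ rowProg.wna ++ adjProg.wna, s3.na a = E.input.na a := by
    intro a ha
    simp only [List.mem_append, not_or] at ha
    rw [hF3.na a ha.2, hF2.na a ha.1.2, hF1.na a ha.1.1]
  have kz : ∀ a ∉ powProg.wna ++ rowProg.wna ++ adjProg.wna, a ∉ [0, 1, 2] → ∀ i, s3.na a i = 0 := by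
    intro a ha ha' i
    rw [ka a ha]
    simp only [List.mem_cons, List.not_mem_nil, or_false, not_or] at ha'
    simp [Encoding.input, ha']
  have e5 : s3.nv 5 = 2 ^ X.k := by rw [hF3.nv 5 (by decide), hF2.nv 5 (by decide), h5]
  have e10 : s3.na 10 = s1.na 10 := by rw [hF3.na 10 (by decide), hF2.na 10 (by decide)]
  have e11 : s3.na 11 = s2.na 11 := hF3.na 11 (by decide)
  have ht : ∀ j : Fin X.k, s3.na 2 j = E.vertex (E.term j) := by
    intro j
    rw [ka 2 (by decide)]
    simp [Encoding.input]
  have hpow : ∀ j < X.k, s3.na 10 j = 2 ^ j := by rw [e10]; exact h10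
  have hrow : ∀ v, s3.na 11 (E.vertex v) = E.vertex v * 2 ^ X.k := by
    intro v
    rw [e11]
    exact h11 _ (E.vertex v).2
  have hsm : 2 ^ X.k - 1 - 2 ^ (E.rootIndex : ℕ) = E.mask X.sources := E.mask_sources.symm
  simp only [W_seq, W_nset]
  simp only [NExp.eval, NExp.cost, setN_nv, setN_na, Nat.reduceEqDiff, reduceIte]
  rw [kv 3 (by decide), hn3, e5, hpow _ E.rootIndex.2, ht, hrow, hsm]
  refine ⟨by omega, by omega, ?_⟩
  set s4 := (s3.setN 7 (E.mask X.sources)).setN 8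
    ((E.vertex (E.term E.rootIndex) : ℕ) * 2 ^ X.k + E.mask X.sources) with hs4
  have hm4 : memOf s4 = memOf s3 := by simp [hs4]
  have hrel : E.Rel L (memOf s4) (initOn ∅) ⟨∅, fun _ => [], fun _ => 0⟩ := by
    rw [hm4]
    refine rel_initOn_empty (kz 12 (by decide) (by decide)) (kz 21 (by decide) (by decide)) ?_
      (kz 13 (by decide) (by decide)) (kz 16 (by decide) (by decide))
    have : s3.nv 10 = 0 := by rw [kv 10 (by decide)]; rfl
    simp [memOf, stackOf, this]
  have hpot : potential X f (memOf s4) (initOn ∅) ⟨∅, fun _ => [], fun _ => 0⟩ ≤ A := by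
    have : s3.nv 10 = 0 := by rw [kv 10 (by decide)]; rfl
    have h1 : (memOf s4).stack = [] := by simp [hs4, memOf, stackOf, this]
    have h2 : (memOf s4).heap.hollow ⟨∅, fun _ => [], fun _ => 0⟩ = 0 := by
      simp [HeapMem.hollow]
    unfold potential
    rw [h1, h2, ← hA]
    simp only [List.length_nil, mul_zero, zero_add]
    exact Nat.mul_le_mul_left _ (Finset.card_filter_le _ _)
  refine (W_sources (L := L) (r := r) hO hrel (by simp [hs4, kv 2 (by decide), hn2])
    (by simp [hs4, kv 3 (by decide), hn3]) (by simp [hs4, e5]) (by simpa [hs4] using ht)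
    (by simpa [hs4] using hpow) (by simpa [hs4] using hrow) (by omega)).frame.mono ?_
  rintro s5 c5 ⟨⟨φ, hr5, h95, hc5⟩, hF5⟩
  have h9 : s4.nv 9 = 0 := by simp only [hs4, setN_nv]; exact kv 9 (by decide)
  have hs : E.Static s4 := by
    refine ⟨by simp [hs4, kv 2 (by decide), hn2], by simp [hs4, e5], by simp [hs4], ?_, ?_,
      by simpa [hs4] using hpow, by simpa [hs4] using hrow, by simpa [hs4] using hadj⟩
    · simp [hs4, Encoding.idx, E.term_rootIndex]
    · intro i
      simp only [hs4, setN_ra]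
      rw [hF3.ra 0 (by decide), hF2.ra 0 (by decide), hF1.ra 0 (by decide)]
      simp [Encoding.input]
  refine ⟨φ, hs.of_frame hF5 (by decide) (by decide) (by decide), hr5, ?_, ?_, ?_, by omega, ?_, ?_,
    hc5⟩
  · intro i
    rw [hF5.na 24 (by decide)]
    exact kz 24 (by decide) (by decide) i
  · rw [hF5.nv 11 (by decide)]
    exact kv 11 (by decide)
  · rw [hF5.nv 4 (by decide)]
    exact kv 4 (by decide)
  · intro i
    rw [hF5.na 3 (by decide)]
    exact kz 3 (by decide) (by decide) i
  · intro i
    rw [hF5.na 26 (by decide)]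
    exact kz 26 (by decide) (by decide) i

end Init

section Back

variable {O : Oracle} {s : Store} {c r : ℕ} {V : Type*} [Fintype V] [DecidableEq V]
  {X : SteinerInstance V} {E : Encoding X} {L : V → Finset V → ℝ} {st : State V} {φ : Forest}
  {xs : List (Label V)} {g : Label V} {μ : Mem} {mark out : ℕ → ℕ} {i : ℕ}

/-- The invariant of backtracking from `g` when the labels at positions at least `i` have been
processed. -/
structure Encoding.BackInv (E : Encoding X) (μ : Mem) (b : Label V → Set (Label V))
    (xs : List (Label V)) (g : Label V) (mark out : ℕ → ℕ) (i : ℕ) : Prop where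
  reach : ∀ y, X.IsLabel y → mark (E.idx y) = 1 → SteinerInstance.Reach b g y
  start : mark (E.idx g) = 1
  step : ∀ (j : ℕ) (h : j < xs.length), i ≤ j → SteinerInstance.Reach b g xs[j] →
    ∀ z ∈ b xs[j], mark (E.idx z) = 1
  out : ∀ e, out e = 1 ↔ ∃ (j : ℕ) (h : j < xs.length), i ≤ j ∧
    SteinerInstance.Reach b g xs[j] ∧ μ.kind (E.idx xs[j]) = 1 ∧ μ.aux (E.idx xs[j]) = e

/-- A label that refers to `xs[i]` stands at a later position, by `back_lt`, and has already been
processed. Hence the mark of `xs[i]` is final when its turn comes. -/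
theorem Encoding.BackInv.marked_iff (h : E.BackInv μ st.b xs g mark out (i + 1))
    (hI : X.Inv st xs) (hg : g ∈ xs) (hi : i < xs.length) :
    mark (E.idx xs[i]) = 1 ↔ SteinerInstance.Reach st.b g xs[i] := by
  refine ⟨h.reach _ (hI.label _ (List.getElem_mem hi)), fun hr => ?_⟩
  rcases Relation.ReflTransGen.cases_tail hr with he | ⟨y, hy, hxy⟩
  · rw [he]; exact h.start
  · obtain ⟨j, hj, rfl⟩ := List.getElem_of_mem (hI.reach_mem hg hy)
    obtain ⟨i', hi', he⟩ := List.mem_take_iff_getElem.1 (hI.back_lt j hj _ hxy)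
    have : i' = i := (hI.nodup.getElem_inj_iff).1 he
    exact h.step j hj (by omega) hy _ hxy

theorem Encoding.BackInv.next (h : E.BackInv μ st.b xs g mark out (i + 1)) (hI : X.Inv st xs)
    (hi : i < xs.length) {mark' out' : ℕ → ℕ}
    (h1 : SteinerInstance.Reach st.b g xs[i] → ∀ z ∈ st.b xs[i], mark' (E.idx z) = 1)
    (h2 : ∀ a, mark a = 1 → mark' a = 1)
    (h3 : ∀ a, mark' a = 1 → mark a = 1 ∨
      SteinerInstance.Reach st.b g xs[i] ∧ ∃ z ∈ st.b xs[i], a = E.idx z)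
    (h4 : ∀ e, out' e = 1 ↔ out e = 1 ∨ SteinerInstance.Reach st.b g xs[i] ∧
      μ.kind (E.idx xs[i]) = 1 ∧ μ.aux (E.idx xs[i]) = e) :
    E.BackInv μ st.b xs g mark' out' i := by
  refine ⟨?_, h2 _ h.start, ?_, ?_⟩
  · intro y hy hm
    rcases h3 _ hm with h' | ⟨hr, z, hz, he⟩
    · exact h.reach y hy h'
    · have hzl := hI.label _ (hI.back_mem _ (hI.label _ (List.getElem_mem hi)) z hz)
      obtain rfl := E.idx_inj hy.subset hzl.subset he
      exact hr.tail hz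
  · intro j hj hij hr z hz
    rcases Nat.eq_or_lt_of_le hij with rfl | hlt
    · exact h1 hr z hz
    · exact h2 _ (h.step j hj hlt hr z hz)
  · intro e
    rw [h4, h.out]
    constructor
    · rintro (⟨j, hj, hij, h'⟩ | h')
      · exact ⟨j, hj, by omega, h'⟩
      · exact ⟨i, hi, le_rfl, h'⟩
    · rintro ⟨j, hj, hij, h'⟩
      rcases Nat.eq_or_lt_of_le hij with rfl | hlt
      · exact Or.inr h'
      · exact Or.inl ⟨j, hj, hlt, h'⟩

/-- Recursion is replaced by one pass in reverse order of selection with constant work per label. If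
nothing was selected, the loop is empty, which is why the goal has to lie in `xs` only when `xs` is
nonempty. -/
theorem W_back (hs : E.Static s) (h : E.Rel L (memOf s) st φ) (hI : X.Inv st xs)
    (hR : E.Records s xs) (hg : xs ≠ [] → (X.root, X.sources) ∈ xs) (h3 : ∀ i, s.na 3 i = 0)
    (h26 : ∀ i, s.na 26 i = 0) (hc : 60 * xs.length + 20 + r ≤ c) :
    W O backProg (fun s' c' => E.Records s' xs ∧
      E.outputEdges s' = {e | ∃ y ∈ xs, SteinerInstance.Reach st.b (X.root, X.sources) y ∧
        ∃ w, st.b y = {(w, y.2)} ∧ e = s(y.1, w)} ∧ r ≤ c') s c := by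
  set g : Label V := (X.root, X.sources) with hgd
  have hgt : g.2 ⊆ X.terminals := Finset.erase_subset _ _
  simp only [backProg, W_seq, W_nset, W_nput]
  simp only [NExp.eval, NExp.cost, putN_nv, hs.goal, hR.1]
  refine ⟨by omega, by omega, ?_⟩
  refine W_loop (fun s' c' => s'.nv 27 ≤ xs.length ∧
    E.BackInv (memOf s) st.b xs g (s'.na 26) (s'.na 3) (s'.nv 27) ∧
    60 * s'.nv 27 + 10 + r ≤ c') ?_ ?_ ?_ ?_
  · refine ⟨by simp, ⟨?_, ?_, ?_, ?_⟩, by simp; omega⟩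
    · intro y hy hm
      by_cases he : E.idx y = E.idx g
      · rw [E.idx_inj hy.subset hgt he]
        exact Relation.ReflTransGen.refl
      · simp [Function.update_of_ne he, h26, ← hgd] at hm
    · simp [← hgd]
    · intro j hj hij
      simp at hij
      omega
    · intro e
      simp [h3]
      omega
  · rintro s' c' - ⟨-, -, h⟩
    simp
    omega
  · rintro s' c' hF ⟨h1, h2, h4⟩ hlt
    simp only [Test.eval, NExp.eval] at hlt
    obtain ⟨i, hi⟩ : ∃ i, s'.nv 27 = i + 1 := ⟨s'.nv 27 - 1, by omega⟩
    rw [hi] at h1 h2 h4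
    have hil : i < xs.length := h1
    have ka : ∀ a ∈ [4, 5, 11, 16, 17, 18], s'.na a = s.na a := fun a ha => by
      rw [hF.na a (by fin_cases ha <;> decide)]
      fin_cases ha <;> simp
    have hgx := hg (List.ne_nil_of_length_pos (by omega))
    have hmark := h2.marked_iff hI hgx hil
    have hxl := hI.label _ (List.getElem_mem hil)
    have hback := h.back _ hxl
    have hnext := fun m o => h2.next hI hil (mark' := m) (out' := o)
    have hidx : (E.vertex xs[i].1 : ℕ) * 2 ^ X.k + E.mask xs[i].2 = E.idx xs[i] := rfl
    simp only [W_seq, W_nset, W_ite, W_skip, W_nput]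
    simp only [NExp.eval, NExp.cost, Test.cost, Test.eval, setN_nv, setN_na, putN_na, putN_nv,
      Nat.reduceEqDiff, reduceIte, Nat.reduceAdd, hi, Nat.add_sub_cancel, ka 4 (by simp),
      ka 5 (by simp), ka 11 (by simp), ka 16 (by simp), ka 17 (by simp), ka 18 (by simp),
      (hR.2 i hil).1, (hR.2 i hil).2, hs.row, hidx, hmark]
    change E.BackCode (s.na 16 (E.idx xs[i])) (s.na 17 (E.idx xs[i])) (s.na 18 (E.idx xs[i])) _ _
      at hback
    change ∀ m o : ℕ → ℕ, _ → _ → _ → (∀ e, o e = 1 ↔ s'.na 3 e = 1 ∨ _ ∧ s.na 16 (E.idx xs[i]) = 1 ∧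
      s.na 18 (E.idx xs[i]) = e) → _ at hnext
    have hupd : ∀ (m : ℕ → ℕ) (a d : ℕ), Function.update m a 1 d = 1 ↔ d = a ∨ m d = 1 := by
      intro m a d
      rcases eq_or_ne d a with rfl | hd
      · simp
      · simp [Function.update_of_ne hd, hd]
    generalize xs[i] = x at *
    refine ⟨by omega, by omega, by omega, fun hr => ⟨by omega, fun hk => ?_, fun hk => ⟨by omega,
      fun hk2 => ?_, fun hk2 => ?_⟩⟩, fun hr => ?_⟩
    · obtain ⟨h', -⟩ | ⟨-, w, hb, hp, e, he, -⟩ | ⟨h', -⟩ := hback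
      · omega
      · refine ⟨by omega, by omega, by omega, hnext _ _ ?_ ?_ ?_ ?_, by omega⟩
        · rintro - z hz
          rw [hb] at hz
          rw [hupd, hp, Set.mem_singleton_iff.1 hz]
          exact Or.inl rfl
        · intro a ha
          rw [hupd]
          exact Or.inr ha
        · intro a ha
          rw [hupd] at ha
          rcases ha with rfl | ha
          · exact Or.inr ⟨hr, _, by rw [hb]; rfl, hp⟩
          · exact Or.inl ha
        · intro a
          rw [hupd]
          simp only [hr, hk, true_and]
          rw [or_comm, eq_comm (a := a)]
      · omega
    · obtain ⟨h', -⟩ | ⟨h', -⟩ | ⟨-, z, z', -, hb, hp, hq⟩ := hback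
      · omega
      · omega
      · refine ⟨by omega, by omega, by omega, hnext _ _ ?_ ?_ ?_ ?_, by omega⟩
        · rintro - y hy
          rw [hb] at hy
          rw [hupd, hupd, hp, hq]
          rcases hy with rfl | rfl
          · exact Or.inr (Or.inl rfl)
          · exact Or.inl rfl
        · intro a ha
          rw [hupd, hupd]
          exact Or.inr (Or.inr ha)
        · intro a ha
          rw [hupd, hupd] at ha
          rcases ha with rfl | rfl | ha
          · exact Or.inr ⟨hr, z', by rw [hb]; simp, hq⟩
          · exact Or.inr ⟨hr, z, by rw [hb]; simp, hp⟩
          · exact Or.inl ha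
        · intro a
          simp [hk]
    · obtain ⟨h', hb⟩ | ⟨h', -⟩ | ⟨h', -⟩ := hback
      · refine ⟨by omega, by omega, hnext _ _ ?_ (fun _ h => h) (fun _ h => Or.inl h) ?_, by omega⟩
        · simp [hb]
        · intro a
          simp [hk]
      · omega
      · omega
    · refine ⟨by omega, by omega, hnext _ _ ?_ (fun _ h => h) (fun _ h => Or.inl h) ?_, by omega⟩
      · exact fun h' => absurd h' hr
      · intro a
        simp [hr]
  · rintro s' c' hF ⟨h1, h2, h4⟩ hlt
    simp only [Test.eval, NExp.eval, not_lt, Nat.le_zero] at hlt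
    rw [hlt] at h2
    refine ⟨⟨?_, fun i hi => ?_⟩, ?_, by simp; omega⟩
    · rw [hF.nv 4 (by decide)]
      simpa using hR.1
    · rw [hF.na 4 (by decide), hF.na 5 (by decide)]
      simpa using hR.2 i hi
    · ext e
      simp only [Encoding.outputEdges, Set.mem_ofPred_eq, h2.out]
      constructor
      · rintro ⟨i, rfl, j, hj, -, hr, hk, ha⟩
        have hm := List.getElem_mem hj
        refine ⟨xs[j], hm, hr, ?_⟩
        rcases h.back _ (hI.label _ hm) with ⟨h', -⟩ | ⟨-, w, hb, -, i', he, hi'⟩ | ⟨h', -⟩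
        · omega
        · obtain rfl : i' = i := Fin.ext (he.symm.trans ha)
          exact ⟨w, hb, hi'⟩
        · omega
      · rintro ⟨y, hy, hr, w, hb, rfl⟩
        obtain ⟨j, hj, rfl⟩ := List.getElem_of_mem hy
        rcases h.back _ (hI.label _ hy) with
          ⟨-, h'⟩ | ⟨hk, w', hb', -, i', he, hi'⟩ | ⟨-, z, z', hne, h', -⟩
        · rw [hb] at h'
          exact absurd h' (Set.singleton_ne_empty _)
        · rw [hb] at hb'
          obtain rfl : w = w' := (Prod.mk.inj (Set.singleton_eq_singleton_iff.1 hb')).1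
          exact ⟨i', hi'.symm, j, hj, by omega, hr, hk, he⟩
        -- A merge refers to two distinct labels, so its backtracking set is not a singleton.
        · rw [hb] at h'
          have e1 : z ∈ ({(w, xs[j].2)} : Set (Label V)) := by rw [h']; simp
          have e2 : z' ∈ ({(w, xs[j].2)} : Set (Label V)) := by rw [h']; simp
          exact absurd (e1.trans e2.symm) hne

end Back

/-! ### The running time -/

/-- The Dijkstra-Steiner algorithm. -/
def steinerProg : Prog := initProg ;; mainProg ;; backProg

section Bounds

variable {V : Type*} [Fintype V] [DecidableEq V] (X : SteinerInstance V)

namespace SteinerInstance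

theorem card_sources : X.sources.card + 1 = X.k :=
  Finset.card_erase_add_one X.root_mem

theorem one_le_n : 1 ≤ X.n := Fintype.card_pos_iff.2 ⟨X.root⟩

theorem card_labels_le : X.labels.card ≤ X.n * 2 ^ X.k := by
  refine (Finset.card_filter_le _ _).trans ?_
  rw [Finset.card_product, Finset.card_powerset, Finset.card_univ, n]
  gcongr
  · norm_num
  · have := X.card_sources
    omega

theorem sum_deg : ∑ v, X.deg v = 2 * X.m := by
  classical
  have h := X.G.sum_degrees_eq_twice_card_edges
  rw [m, ← SimpleGraph.coe_edgeFinset, Set.ncard_coe_finset, ← h]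
  refine Finset.sum_congr rfl fun v _ => ?_
  rw [deg, SimpleGraph.degree]
  congr 1
  ext w
  simp

theorem m_le : X.m ≤ X.n ^ 2 := by
  have h : 2 * X.m ≤ ∑ _v : V, X.n := by
    rw [← X.sum_deg]
    exact Finset.sum_le_sum fun v _ => Finset.card_le_univ _
  rw [Finset.sum_const, Finset.card_univ, smul_eq_mul] at h
  change 2 * X.m ≤ X.n * X.n at h
  rw [sq]
  omega

theorem sum_labels_le (g : Label V → ℕ) :
    ∑ x ∈ X.labels, g x ≤ ∑ v, ∑ I ∈ X.sources.powerset, g (v, I) := by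
  rw [← Finset.sum_product']
  exact Finset.sum_le_sum_of_subset (Finset.filter_subset _ _)

/-- By the handshake lemma the degrees contribute `2 * m` for each of the `2 ^ (k - 1)` sets. For a
fixed vertex the subsets of complements contribute `(1 + 2) ^ (k - 1)`: a pair of disjoint sets `I`
and `J` puts each source into `I`, into `J` or into neither. -/
theorem sum_pushes_le : ∑ x ∈ X.labels, X.pushes x ≤ 2 ^ X.k * X.m + X.n * 3 ^ X.k := by
  refine (X.sum_labels_le _).trans ?_
  have h1 : ∑ I ∈ X.sources.powerset, 2 ^ (X.sources \ I).card = 3 ^ X.sources.card := by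
    have := Finset.sum_pow_mul_eq_add_pow 1 2 X.sources
    rw [show 3 = 1 + 2 from rfl, ← this]
    refine Finset.sum_congr rfl fun I hI => ?_
    rw [Finset.card_sdiff_of_subset (Finset.mem_powerset.1 hI), one_pow, one_mul]
  have h2 := X.card_sources
  simp only [pushes, Finset.sum_add_distrib, h1, Finset.sum_const, Finset.card_powerset,
    smul_eq_mul, Finset.card_univ, ← Finset.mul_sum, X.sum_deg]
  rw [← h2, pow_succ, pow_succ]
  have h3 : Fintype.card V = X.n := rfl
  rw [h3, mul_assoc]
  gcongr
  omega

variable {X}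

theorem pending_le (g : Label V → ℕ) (st : State V) : X.pending g st ≤ ∑ x ∈ X.labels, g x := by
  classical
  exact Finset.sum_le_sum_of_subset (Finset.filter_subset _ _)

theorem sum_stepCost_le (G : ℕ) : ∑ x ∈ X.labels, X.stepCost G x ≤
    X.n * 2 ^ X.k * (600 * G + 50 * X.k + 1100) + 1200 * (2 ^ X.k * X.m + X.n * 3 ^ X.k) := by
  have h : ∑ x ∈ X.labels, X.stepCost G x =
      X.labels.card * (600 * G + 50 * X.k + 1100) + 1200 * ∑ x ∈ X.labels, X.pushes x := by
    rw [Finset.mul_sum, ← smul_eq_mul (a := X.labels.card), ← Finset.sum_const,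
      ← Finset.sum_add_distrib]
    refine Finset.sum_congr rfl fun x _ => ?_
    unfold stepCost
    ring
  rw [h]
  gcongr
  · exact X.card_labels_le
  · exact X.sum_pushes_le

/-- A bound for the ranks in the heap. -/
theorem rank_le {j N : ℕ} (hN : N ≤ X.k) (h : 2 ^ (j / 2) ≤ N + X.pending X.pushes X.init) :
    j ≤ 4 * Nat.log 2 X.n + 4 * X.k + 8 := by
  have h1 := (pending_le X.pushes X.init).trans X.sum_pushes_le
  have h2 : X.n < 2 ^ (Nat.log 2 X.n + 1) := Nat.lt_pow_succ_log_self (by norm_num) _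
  have h3 := X.one_le_n
  have h4 : X.k ≤ 2 ^ X.k := Nat.lt_two_pow_self.le
  have h5 : (3 : ℕ) ^ X.k ≤ 2 ^ X.k * 2 ^ X.k := by
    rw [← mul_pow]
    exact Nat.pow_le_pow_left (by norm_num) _
  have h6 := X.m_le
  have h7 := Nat.one_le_two_pow (n := X.k)
  -- There are three summands, each at most `n ^ 2 * 4 ^ k`, using `m ≤ n ^ 2` and `3 ^ k ≤ 4 ^ k`.
  have h8 : 2 ^ (j / 2) ≤ 4 * (X.n ^ 2 * (2 ^ X.k * 2 ^ X.k)) := by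
    refine h.trans ((Nat.add_le_add (hN.trans h4) h1).trans ?_)
    have a1 : 2 ^ X.k ≤ X.n ^ 2 * (2 ^ X.k * 2 ^ X.k) :=
      calc 2 ^ X.k = 1 ^ 2 * (1 * 2 ^ X.k) := by ring
        _ ≤ _ := by gcongr
    have a2 : 2 ^ X.k * X.m ≤ X.n ^ 2 * (2 ^ X.k * 2 ^ X.k) :=
      calc 2 ^ X.k * X.m ≤ 2 ^ X.k * X.n ^ 2 := Nat.mul_le_mul_left _ h6
        _ = X.n ^ 2 * (2 ^ X.k * 1) := by ring
        _ ≤ _ := by gcongr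
    have a3 : X.n * 3 ^ X.k ≤ X.n ^ 2 * (2 ^ X.k * 2 ^ X.k) := by
      gcongr
      nlinarith
    omega
  have h9 : 2 ^ (j / 2) < 2 ^ (2 + (2 * (Nat.log 2 X.n + 1) + 2 * X.k)) := by
    refine h8.trans_lt ?_
    rw [pow_add, pow_add, pow_mul', pow_mul', sq (2 ^ X.k)]
    have : X.n ^ 2 < (2 ^ (Nat.log 2 X.n + 1)) ^ 2 := Nat.pow_lt_pow_left h2 (by norm_num)
    have : 0 < 2 ^ X.k * 2 ^ X.k := by positivity
    norm_num
    nlinarith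
  have := (Nat.pow_lt_pow_iff_right (by norm_num : 1 < 2)).1 h9
  omega

end SteinerInstance

/-- This absorbs the part of the extraction time that is linear in `k`. The summand `2` makes the
induction go through. -/
theorem pow_mul_le (k : ℕ) : 2 ^ k * (k + 2) ≤ 2 * 3 ^ k := by
  induction k with
  | zero => norm_num
  | succ k ih =>
    rw [pow_succ, pow_succ]
    nlinarith [Nat.zero_le (2 ^ k * k)]

/-- The factor `2` is a generous bound for `1 / log 2`. -/
theorem log_le {n : ℕ} (hn : 1 ≤ n) : (Nat.log 2 n : ℝ) ≤ 2 * Real.log n := by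
  have h1 : (2 : ℝ) ^ Nat.log 2 n ≤ n := by exact_mod_cast Nat.pow_log_le_self 2 (by omega)
  have h2 := Real.log_le_log (by positivity) h1
  rw [Real.log_pow] at h2
  have h3 := Real.log_two_gt_d9
  have h4 : (0 : ℝ) ≤ Nat.log 2 n := by positivity
  nlinarith

/-- The time of the program, in terms of the parameters of the instance. -/
def totalTime (n m k f : ℕ) : ℕ :=
  (f + 100) * (n * 2 ^ k) + 1200 * k + 20 * n + 80 * m + 200 +
    (n * 2 ^ k * (600 * (4 * Nat.log 2 n + 4 * k + 8) + 50 * k + 1100) +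
      1200 * (2 ^ k * m + n * 3 ^ k) + 10) + (60 * (n * 2 ^ k) + 20)

theorem totalTime_le {n m k f : ℕ} (hn : 1 ≤ n) : (totalTime n m k f : ℝ) ≤
    (20000 : ℕ) * ((3 : ℝ) ^ k * n + (2 : ℝ) ^ k * (n * Real.log n + m) + (2 : ℝ) ^ k * n * f) := by
  have hk : (2 : ℝ) ^ k * (k + 2) ≤ 2 * 3 ^ k := by exact_mod_cast pow_mul_le k
  have hl := log_le hn
  have hn' : (1 : ℝ) ≤ n := by exact_mod_cast hn
  have h2 : (1 : ℝ) ≤ 2 ^ k := one_le_pow₀ (by norm_num)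
  have h3 : (1 : ℝ) ≤ 3 ^ k := one_le_pow₀ (by norm_num)
  have h23 : (2 : ℝ) ^ k ≤ 3 ^ k := by gcongr; norm_num
  have hk3 : (k : ℝ) ≤ 3 ^ k := by
    have : k < 2 ^ k := Nat.lt_two_pow_self
    have : (k : ℝ) ≤ 2 ^ k := by exact_mod_cast this.le
    linarith
  have a1 : (1 : ℝ) ≤ 3 ^ k * n := by nlinarith
  have a2 : (n : ℝ) ≤ 3 ^ k * n := by nlinarith
  have a3 : (k : ℝ) ≤ 3 ^ k * n := by nlinarith
  have a4 : (n : ℝ) * 2 ^ k ≤ 3 ^ k * n := by nlinarith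
  have a5 : (n : ℝ) * 2 ^ k * k ≤ 2 * (3 ^ k * n) := by
    have : (2 : ℝ) ^ k * k ≤ 2 * 3 ^ k := by nlinarith
    nlinarith
  have a6 : (m : ℝ) ≤ 2 ^ k * m := by nlinarith [Nat.cast_nonneg (α := ℝ) m]
  have a7 : (n : ℝ) * 2 ^ k * Nat.log 2 n ≤ 2 * (2 ^ k * (n * Real.log n)) := by
    have : (0 : ℝ) ≤ n * 2 ^ k := by positivity
    nlinarith
  have a8 : (0 : ℝ) ≤ 2 ^ k * (n * Real.log n) := by
    have := Real.log_nonneg hn'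
    positivity
  have a9 : (0 : ℝ) ≤ 2 ^ k * n * f := by positivity
  have a10 : (0 : ℝ) ≤ 2 ^ k * m := by positivity
  unfold totalTime
  push_cast
  nlinarith

end Bounds

/-! ### From the final memory to a run of the algorithm. -/

section Correctness

variable {O : Oracle} {c r : ℕ} {V : Type*} [Fintype V] [DecidableEq V] {X : SteinerInstance V}
  {E : Encoding X} {L : V → Finset V → ℝ} {f : ℕ} {st : State V} {xs : List (Label V)}

theorem SteinerInstance.Inv.goal_mem (h : X.Inv st xs) (hg : (X.root, X.sources) ∈ st.P)
    (hxs : xs ≠ []) : (X.root, X.sources) ∈ xs := by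
  refine ((h.perm _).1 hg).resolve_left fun h0 => ?_
  obtain ⟨x, hx⟩ := List.exists_mem_of_ne_nil xs hxs
  have hl := h.label x hx
  have h0 : X.sources = ∅ := h0
  exact hl.2 (Finset.subset_empty.1 (h0 ▸ hl.1))

theorem SteinerInstance.isRun_of_mainLoop (hm : X.MainLoop L X.init xs st) (h : X.Inv st xs)
    (hg : (X.root, X.sources) ∈ st.P) :
    X.IsRun L xs {e | ∃ y ∈ xs, Reach st.b (X.root, X.sources) y ∧
      ∃ w, st.b y = {(w, y.2)} ∧ e = s(y.1, w)} := by
  refine ⟨st, hm, ?_⟩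
  -- Nothing is selected only when the root is the sole terminal. Then `b` is still empty
  -- everywhere, and `backtrack` returns an empty union.
  by_cases hxs : xs = []
  · subst hxs
    cases hm
    have := Backtrack.union (b := (X.init).b) X.root X.sources (fun _ => ∅)
      (by rintro ⟨w, hw⟩; exact Set.singleton_ne_empty _ hw.symm)
      (fun y hy => absurd hy (Set.notMem_empty y))
    simpa [SteinerInstance.init] using this
  · obtain ⟨j, hj, he⟩ := List.getElem_of_mem (h.goal_mem hg hxs)
    have hb := h.backtrack j hj
    rw [he] at hb
    convert hb using 1
    ext e
    constructor
    · rintro ⟨y, -, hr, w, hw, rfl⟩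
      exact ⟨y.1, w, y.2, hr, hw, rfl⟩
    · rintro ⟨v, w, I, hr, hw, rfl⟩
      exact ⟨(v, I), h.reach_mem (h.goal_mem hg hxs) hr, hr, w, hw, rfl⟩

/-- The number of selected labels is at most `n * 2 ^ k` because none is selected twice; this pays
for backtracking in advance. All other credit is computed from the initial state. -/
theorem W_steiner (hO : E.Evaluates O L f) :
    W O steinerProg (fun s' _ => ∃ xs, E.Records s' xs ∧ X.IsRun L xs (E.outputEdges s'))
      E.input (totalTime X.n X.m X.k f) := by
  set G := 4 * Nat.log 2 X.n + 4 * X.k + 8 with hG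
  have hlab := X.card_labels_le
  have hf : (f + 100) * X.labels.card ≤ (f + 100) * (X.n * 2 ^ X.k) := Nat.mul_le_mul_left _ hlab
  have hp := (SteinerInstance.pending_le (X.stepCost G) X.init).trans
    (SteinerInstance.sum_stepCost_le G)
  rw [steinerProg, W_seq]
  refine (W_init (r := X.pending (X.stepCost G) X.init + 10 + (60 * X.labels.card + 20)) hO
    (by unfold totalTime; rw [← hG]; omega)).frame.mono ?_
  rintro s1 c1 ⟨⟨φ, hs, hr, h24, h11, h4, h9, h3, h26, hc⟩, hF⟩
  rw [W_seq]
  refine (W_main (G := G) (r := 60 * X.labels.card + 20) hO hs hr h24 h11 h4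
    (fun j hj => SteinerInstance.rank_le h9 hj) (by omega)).frame.mono ?_
  rintro s2 c2 ⟨⟨xs, st, φ2, hm, hg, hI, hr2, hR2, hs2, hc2⟩, hF2⟩
  have hlen : xs.length ≤ X.labels.card := by
    rw [← List.toFinset_card_of_nodup hI.nodup]
    refine Finset.card_le_card fun x hx => ?_
    exact SteinerInstance.mem_labels.2 (hI.label x (List.mem_toFinset.1 hx))
  refine (W_back (r := 0) hs2 hr2 hI hR2 (hI.goal_mem hg) ?_ ?_ (by omega)).mono ?_
  · rw [hF2.na 3 (by decide)]
    exact h3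
  · rw [hF2.na 26 (by decide)]
    exact h26
  · rintro s3 c3 ⟨hR3, hout, -⟩
    refine ⟨xs, hR3, ?_⟩
    rw [hout]
    exact SteinerInstance.isRun_of_mainLoop hm hI hg

end Correctness

end DijkstraSteiner

theorem mainTheorem2 :
    ∃ (p : DijkstraSteiner.Prog) (C : ℕ),
      ∀ (V : Type) [Fintype V] [DecidableEq V]
        (X : DijkstraSteiner.SteinerInstance V) (E : DijkstraSteiner.Encoding X)
        (L : V → Finset V → ℝ) (_ : X.IsValidLowerBound L)
        (O : DijkstraSteiner.Oracle) (f : ℕ) (_ : E.Evaluates O L f),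
        ∃ (s : DijkstraSteiner.Store) (t : ℕ) (xs : List (DijkstraSteiner.Label V)),
          DijkstraSteiner.Exec O p E.input s t ∧
          (t : ℝ) ≤ C * ((3 : ℝ) ^ X.k * X.n
            + (2 : ℝ) ^ X.k * (X.n * Real.log X.n + X.m)
            + (2 : ℝ) ^ X.k * X.n * f) ∧
          E.Records s xs ∧
          X.IsRun L xs (E.outputEdges s) := by
  refine ⟨DijkstraSteiner.steinerProg, 20000, fun V _ _ X E L _ O f hO => ?_⟩
  obtain ⟨s, t, c, he, hc, xs, hR, hrun⟩ := DijkstraSteiner.W_steiner hO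
  refine ⟨s, t, xs, he, ?_, hR, hrun⟩
  refine le_trans ?_ (DijkstraSteiner.totalTime_le X.one_le_n)
  exact_mod_cast (by omega : t ≤ DijkstraSteiner.totalTime X.n X.m X.k f)
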